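/- **Setting.** Fix an integer $r\ge 1$ and $\rho\in\mathbb C$, and put $c=1-12\rho^2$. All representations below are representations of the Virasoro algebra $[L_m,L_n]=(m-n)L_{m+n}+\delta_{m+n,0}\frac{m^3-m}{12}c$ with this central charge. $M_\Delta$ ($\Delta\in\mathbb C$) is the Verma module with highest weight vector $|\Delta\rangle$. For $\Lambda=(\Lambda_r,\dots,\Lambda_{2r})$, the irregular Verma module $M^{[r]}_\Lambda$ is the representation induced from a vector $|\Lambda\rangle$ with $L_n|\Lambda\rangle=\Lambda_n|\Lambda\rangle$ for $n\ge r$, where $\Lambda_n=0$ for $n>2r$. For a partition $\mu=(\mu_1\ge\dots\ge\mu_k>0)$ put $L_{-\mu}=L_{-\mu_1+r}\cdots L_{-\mu_k+r}$ and $|\mu|=\mu_1+\dots+\mu_k$. Let $U\subseteq\mathbb C^{r+1}$ be an open set of points $\lambda=(\lambda_0,\dots,\lambda_r)$ on which $\lambda_r\neq0$, and let $\mathcal O(U)$ be its ring of holomorphic functions. The parameters $\alpha,\beta_1,\dots,\beta_r,\Lambda_r,\dots,\Lambda_{2r}$ are elements of $\mathcal O(U)$, and $M^{[r]}_\Lambda$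 is taken over $\mathcal O(U)$. An *irregular vertex operator of rank $r$* from $M_\Delta$ to $M_\Lambda^{[r]}$ consists of additive operators $\partial/\partial\lambda_p$ ($1\le p\le r$) on $M^{[r]}_\Lambda$, satisfying the Leibniz rule over $\mathcal O(U)$ and commuting with all $L_n$, together with a linear map $\Phi(z)$ from $M_\Delta$ to the expressions $z^\alpha\exp\bigl(\sum_{i=1}^r\beta_i z^{-i}\bigr)f(z)$ with $f(z)\in M^{[r]}_\Lambda((z))$, where $\partial\alpha/\partial\lambda_p=0$ for $1\le p\le r$, such that for all $n\in\mathbb Z$ $$[L_n,\Phi(z)]=z^{n+1}\partial_z\Phi(z)+\sum_{i=0}^{r-1}\binom{n+1}{i+1}z^{n-i}D_i\Phi(z)+\frac12\sum_{i,j=0}^r\lambda_i\lambda_j\binom{n+1}{i+j+1}z^{n-i-j}\Phi(z)-\rho\sum_{i=0}^r\binom{n+1}{i+1}(i+1)\lambda_iz^{n-i}\Phi(z),$$ with $D_k=\sum_{p=1}^{r-k}p\lambda_{p+k}\frac{\partial}{\partial\lambda_p}$, and $$\Phi(z)|\Delta\rangle=z^\alpha\exp\Bigl(\sum_{i=1}^r\frac{\beta_i}{z^i}\Bigr)\sum_{m=0}^\infty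 v_mz^m,\qquad v_0=|\Lambda\rangle,\quad v_m\in M_\Lambda^{[r]}.$$ **Theorem.** There are polynomials $P_\alpha$, $P_{\beta_i}$ ($1\le i\le r$), $P_{\Lambda_n}$ ($r\le n\le 2r$) and $P^{(m)}_\mu$ ($m\ge0$, $\mu$ a partition) with complex coefficients in the variables $\lambda_0,\dots,\lambda_r,\lambda_r^{-1},\beta_r,\Delta$, depending only on $r$ and $\rho$, such that the following holds for every $U$ as above, every $\Delta\in\mathbb C$ and every $\beta_r\in\mathcal O(U)$. 1. (Existence) An irregular vertex operator of rank $r$ with the given $\Delta$ and $\beta_r$ exists, for some $\alpha,\beta_1,\dots,\beta_{r-1},\Lambda$, if and only if $\lambda_r\,\partial\beta_r/\partial\lambda_r=\beta_r$ and $\partial\beta_r/\partial\lambda_p=0$ for $1\le p<r$, that is, $\beta_r/\lambda_r$ does not depend on $\lambda_1,\dots,\lambda_r$ (locally on $U$). In particular, since locally one may take $\beta_r$ to be a constant multiple of $\lambda_r$, the values of $\lambda$ (with $\lambda_r\ne0$), $\beta_r$ and $\Delta$ at a point may be prescribed arbitrarily. 2. (Uniqueness) For every such operator, $\alpha$, $\beta_i$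 and $\Lambda_n$ are the values of $P_\alpha$, $P_{\beta_i}$ and $P_{\Lambda_n}$ at $(\lambda,\lambda_r^{-1},\beta_r,\Delta)$, $$v_m=\sum_{|\mu|\le m(r+1)}c^{(m)}_\mu L_{-\mu}|\Lambda\rangle\qquad(m\ge0),$$ where $c_\mu^{(m)}$ is the value of $P_\mu^{(m)}$, and the operator (including the action of $\partial/\partial\lambda_p$ on $M^{[r]}_\Lambda$) is unique. -/

import Mathlib

namespace IrrVertex

/-! ### The Virasoro algebra and its irregular Verma modules

`A` is a commutative `ℂ`-algebra of coefficients: `A = ℂ` for ordinary modules, and `A` a ring of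
functions of the parameters for families of modules depending on these parameters. -/

/-- The defining relations
`L_m L_n - L_n L_m = (m - n) L_{m+n} + δ_{m+n,0} (m³ - m)/12 c`
of the universal enveloping algebra of the Virasoro algebra, at central charge `c`. -/
inductive VirRel (A : Type*) [CommRing A] [Algebra ℂ A] (c : ℂ) :
    FreeAlgebra A ℤ → FreeAlgebra A ℤ → Prop
  | comm (m n : ℤ) : VirRel A c
      (FreeAlgebra.ι A m * FreeAlgebra.ι A n - FreeAlgebra.ι A n * FreeAlgebra.ι A m)
      ((m - n) • FreeAlgebra.ι A (m + n)
        + if m + n = 0 then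
            algebraMap A (FreeAlgebra A ℤ) (algebraMap ℂ A (((m : ℂ) ^ 3 - m) / 12 * c))
          else 0)

/-- The universal enveloping algebra over `A` of the Virasoro algebra, at central charge `c`;
a module over it is a representation of the Virasoro algebra on which the central element
acts as `c`. -/
abbrev Vir (A : Type*) [CommRing A] [Algebra ℂ A] (c : ℂ) : Type _ := RingQuot (VirRel A c)

/-- The generator `L_n`. -/
noncomputable def L (A : Type*) [CommRing A] [Algebra ℂ A] (c : ℂ) (n : ℤ) : Vir A c :=
  RingQuot.mkAlgHom A (VirRel A c) (FreeAlgebra.ι A n)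

/-- The left ideal generated by `L_n - Λ_n`, `n ≥ r`. -/
def irrIdeal (A : Type*) [CommRing A] [Algebra ℂ A] (c : ℂ) (r : ℕ) (Λ : ℕ → A) :
    Submodule (Vir A c) (Vir A c) :=
  Submodule.span (Vir A c)
    {x | ∃ n : ℕ, r ≤ n ∧ x = L A c n - algebraMap A (Vir A c) (Λ n)}

/-- The irregular Verma module of rank `r`: the module induced from `L_n |Λ⟩ = Λ_n |Λ⟩`, `n ≥ r`,
where `Λ_n = 0` for `n > 2r`. For `r = 0` it is the Verma module of highest weight `Λ_0`. -/
abbrev IrrVerma (A : Type*) [CommRing A] [Algebra ℂ A] (c : ℂ) (r : ℕ) (Λ : ℕ → A) : Type _ :=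
  Vir A c ⧸ irrIdeal A c r Λ

/-- The irregular vector `|Λ⟩` (for `r = 0`, the highest weight vector). -/
noncomputable def irrVec (A : Type*) [CommRing A] [Algebra ℂ A] (c : ℂ) (r : ℕ) (Λ : ℕ → A) :
    IrrVerma A c r Λ :=
  Submodule.Quotient.mk 1

/-- The Verma module `M_Δ` of highest weight `Δ` over `ℂ`. -/
abbrev Verma (c Δ : ℂ) : Type := IrrVerma ℂ c 0 (fun n => if n = 0 then Δ else 0)

/-- The highest weight vector `|Δ⟩`. -/
noncomputable def hwVec (c Δ : ℂ) : Verma c Δ := irrVec ℂ c 0 _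

/-- `L_{-μ} = L_{-μ_1+r} ⋯ L_{-μ_k+r}` for a partition `μ = (μ_1 ≥ ⋯ ≥ μ_k > 0)`. -/
noncomputable def Lneg (A : Type*) [CommRing A] [Algebra ℂ A] (c : ℂ) (r : ℕ) {k : ℕ}
    (μ : Nat.Partition k) : Vir A c :=
  ((μ.parts.sort (· ≥ ·)).map fun i : ℕ => L A c ((r : ℤ) - (i : ℤ))).prod

/-! ### Irregular vertex operators -/

/-- The parameters `α`, `β_1, …, β_r`, `Λ_r, …, Λ_{2r}` of an irregular vertex operator. -/
@[ext]
structure Params (r : ℕ) (A : Type*) where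
  α : A
  β : Finset.Icc 1 r → A
  Λ : Finset.Icc r (2 * r) → A

/-- `β_i`, for `1 ≤ i ≤ r` (and `0` for other `i`). -/
def Params.b {r : ℕ} {A : Type*} [Zero A] (p : Params r A) (i : ℕ) : A :=
  if h : i ∈ Finset.Icc 1 r then p.β ⟨i, h⟩ else 0

/-- `Λ_n`, for `r ≤ n ≤ 2r`, extended by `Λ_n = 0` to other `n`. -/
def Params.l {r : ℕ} {A : Type*} [Zero A] (p : Params r A) (n : ℕ) : A :=
  if h : n ∈ Finset.Icc r (2 * r) then p.Λ ⟨n, h⟩ else 0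

/-- The operator `D_k = ∑_{p=1}^{r-k} p λ_{p+k} ∂/∂λ_p` acting on an `A`-module `N`, where
`der p` is the action of `∂/∂λ_p` on `N`. -/
def D {r : ℕ} {A : Type*} [CommRing A] (lam : ℕ → A) {N : Type*} [AddCommGroup N] [Module A N]
    (der : Finset.Icc 1 r → N → N) (k : ℕ) (x : N) : N :=
  ∑ p : Finset.Icc 1 r,
    if (p : ℕ) + k ≤ r then (((p : ℕ) : A) * lam ((p : ℕ) + k)) • der p x else 0

/-! In the following, a function `f : ℤ → N` stands for the formal expression
`z^α exp(∑_{i=1}^r β_i z^{-i}) ∑_{m ∈ ℤ} f_m z^m`. -/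

/-- Multiplication by `z^k`. -/
def zpow {N : Type*} (k : ℤ) (f : ℤ → N) : ℤ → N := fun m => f (m - k)

/-- The derivative `∂/∂z`. -/
def dz {r : ℕ} {A : Type*} [CommRing A] (p : Params r A) {N : Type*} [AddCommGroup N] [Module A N]
    (f : ℤ → N) : ℤ → N :=
  fun m => (p.α + ((m + 1 : ℤ) : A)) • f (m + 1)
    - ∑ i ∈ Finset.Icc 1 r, ((i : A) * p.b i) • f (m + 1 + i)

/-- The operator `D_k`, where `∂/∂λ_p` acts on coefficient functions by `pd p`, on vectors by
`nabla p`, and where `α` does not depend on `λ_1, …, λ_r`. -/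
def dlam {r : ℕ} {A : Type*} [CommRing A] [Algebra ℂ A] (lam : ℕ → A)
    (pd : Finset.Icc 1 r → Derivation ℂ A A) (p : Params r A)
    {N : Type*} [AddCommGroup N] [Module A N] (nabla : Finset.Icc 1 r → (N →+ N))
    (k : ℕ) (f : ℤ → N) : ℤ → N :=
  fun m => D lam (fun q => nabla q) k (f m)
    + ∑ i ∈ Finset.Icc 1 r, D lam (fun q => pd q) k (p.b i) • f (m + i)

/-- An irregular vertex operator of rank `r` from the Verma module `M_Δ` to the irregular Verma
module `M_Λ^{[r]}`, at central charge `c = 1 - 12ρ²`, where `λ_0, …, λ_r` are the elements `lam i`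
of the coefficient ring `A`, with `∂/∂λ_p` acting on `A` by `pd p`. -/
@[ext]
structure VertexOp {r : ℕ} {A : Type*} [CommRing A] [Algebra ℂ A] (lam : ℕ → A)
    (pd : Finset.Icc 1 r → Derivation ℂ A A) (ρ Δ : ℂ) (p : Params r A) where
  /-- The action of `∂/∂λ_p`, `1 ≤ p ≤ r`, on the family of modules `M_Λ^{[r]}`. -/
  nabla : Finset.Icc 1 r →
    (IrrVerma A (1 - 12 * ρ ^ 2) r p.l →+ IrrVerma A (1 - 12 * ρ ^ 2) r p.l)
  nabla_smul : ∀ q (a : A) x, nabla q (a • x) = pd q a • x + a • nabla q x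
  nabla_L : ∀ q (n : ℤ) x,
    nabla q (L A (1 - 12 * ρ ^ 2) n • x) = L A (1 - 12 * ρ ^ 2) n • nabla q x
  /-- `Φ u` is the coefficient sequence of
  `Φ(z) u = z^α exp(∑_{i=1}^r β_i z^{-i}) ∑_m (Φ u)_m z^m`. -/
  Φ : Verma (1 - 12 * ρ ^ 2) Δ →ₗ[ℂ] (ℤ → IrrVerma A (1 - 12 * ρ ^ 2) r p.l)
  /-- `Φ(z) u` is a Laurent series, up to the prefactor. -/
  bounded : ∀ u, ∃ N : ℤ, ∀ m < N, Φ u m = 0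
  /-- `α` is constant in `λ_1, …, λ_r`. -/
  α_const : ∀ q, pd q p.α = 0
  /-- The commutation relation of `L_n` and `Φ(z)`. -/
  comm : ∀ (n : ℤ) (u : Verma (1 - 12 * ρ ^ 2) Δ),
    (fun m => L A (1 - 12 * ρ ^ 2) n • Φ u m) - Φ (L ℂ (1 - 12 * ρ ^ 2) n • u)
      = zpow (n + 1) (dz p (Φ u))
        + ∑ i ∈ Finset.range r,
            Ring.choose (n + 1) (i + 1) • zpow (n - i) (dlam lam pd p nabla i (Φ u))
        + ∑ i ∈ Finset.range (r + 1), ∑ j ∈ Finset.range (r + 1),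
            Ring.choose (n + 1) (i + j + 1) •
              (algebraMap ℂ A (1 / 2) * lam i * lam j) • zpow (n - i - j) (Φ u)
        - ∑ i ∈ Finset.range (r + 1),
            Ring.choose (n + 1) (i + 1) •
              (algebraMap ℂ A ρ * ((i : A) + 1) * lam i) • zpow (n - i) (Φ u)
  /-- `Φ(z)|Δ⟩ = z^α exp(∑ β_i z^{-i}) ∑_{m ≥ 0} v_m z^m` with `v_0 = |Λ⟩`. -/
  hw_neg : ∀ m < 0, Φ (hwVec (1 - 12 * ρ ^ 2) Δ) m = 0
  hw_zero : Φ (hwVec (1 - 12 * ρ ^ 2) Δ) 0 = irrVec A (1 - 12 * ρ ^ 2) r p.l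

/-- The vectors `v_m`, `m ≥ 0`. -/
noncomputable def VertexOp.v {r : ℕ} {A : Type*} [CommRing A] [Algebra ℂ A] {lam : ℕ → A}
    {pd : Finset.Icc 1 r → Derivation ℂ A A} {ρ Δ : ℂ} {p : Params r A}
    (V : VertexOp lam pd ρ Δ p) (m : ℕ) : IrrVerma A (1 - 12 * ρ ^ 2) r p.l :=
  V.Φ (hwVec (1 - 12 * ρ ^ 2) Δ) m

/-! ### Holomorphic functions of `λ = (λ_0, …, λ_r)` -/

open Classical in
/-- Extension by zero of a function on `U`. -/
noncomputable def ext0 {r : ℕ} (U : TopologicalSpace.Opens (Fin (r + 1) → ℂ)) (f : U → ℂ) :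
    (Fin (r + 1) → ℂ) → ℂ :=
  fun x => if h : x ∈ U then f ⟨x, h⟩ else 0

theorem ext0_apply {r : ℕ} {U : TopologicalSpace.Opens (Fin (r + 1) → ℂ)} (f : U → ℂ)
    {x : Fin (r + 1) → ℂ} (h : x ∈ U) : ext0 U f x = f ⟨x, h⟩ := by
  simp [ext0, h]

theorem ext0_analytic {r : ℕ} {U : TopologicalSpace.Opens (Fin (r + 1) → ℂ)} {f : U → ℂ}
    {g : (Fin (r + 1) → ℂ) → ℂ} (hg : AnalyticOnNhd ℂ g U) (h : ∀ x : U, f x = g x) :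
    AnalyticOnNhd ℂ (ext0 U f) U :=
  hg.congr U.isOpen fun x hx => by rw [ext0_apply f hx, h]

/-- The algebra of holomorphic functions on the open set `U ⊆ ℂ^{r+1}`. -/
def Hol {r : ℕ} (U : TopologicalSpace.Opens (Fin (r + 1) → ℂ)) : Subalgebra ℂ (U → ℂ) where
  carrier := {f | AnalyticOnNhd ℂ (ext0 U f) U}
  mul_mem' {f g} hf hg := ext0_analytic (hf.mul hg) fun x => by
    simp [ext0_apply _ x.2]
  add_mem' {f g} hf hg := ext0_analytic (hf.add hg) fun x => by
    simp [ext0_apply _ x.2]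
  algebraMap_mem' a := ext0_analytic (g := fun _ => a) analyticOnNhd_const fun x => by simp

/-- The partial derivative `∂/∂λ_i` of holomorphic functions on `U`. -/
noncomputable def partialD {r : ℕ} (U : TopologicalSpace.Opens (Fin (r + 1) → ℂ))
    (i : Fin (r + 1)) : Derivation ℂ (Hol U) (Hol U) :=
  Derivation.mk'
    { toFun := fun f => ⟨fun x => fderiv ℂ (ext0 U f) x (Pi.single i 1),
        ext0_analytic (g := fun x => fderiv ℂ (ext0 U f) x (Pi.single i 1))
          ((ContinuousLinearMap.apply ℂ ℂ (Pi.single i 1 : Fin (r + 1) → ℂ)).comp_analyticOnNhd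
            (AnalyticOnNhd.fderiv f.2)) fun _ => rfl⟩
      map_add' := fun f g => by
        ext x
        have h : ext0 U (f + g : U → ℂ) = ext0 U f + ext0 U g := by
          funext y; by_cases hy : y ∈ U <;> simp [ext0, hy]
        have := fderiv_add (f.2 x x.2).differentiableAt (g.2 x x.2).differentiableAt
        simp [h, this]
      map_smul' := fun a f => by
        ext x
        have h : ext0 U (a • (f : U → ℂ)) = a • ext0 U f := by
          funext y; by_cases hy : y ∈ U <;> simp [ext0, hy]
        have := fderiv_const_smul (f.2 x x.2).differentiableAt a
        simp [h, this] }
    (fun f g => by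
      ext x
      have h : ext0 U ((f : U → ℂ) * (g : U → ℂ)) = ext0 U f * ext0 U g := by
        funext y; by_cases hy : y ∈ U <;> simp [ext0, hy]
      have := fderiv_mul (f.2 x x.2).differentiableAt (g.2 x x.2).differentiableAt
      simp [h, this, ext0_apply _ x.2])

/-- The coordinate function `λ_i` on `U`. -/
def coord {r : ℕ} (U : TopologicalSpace.Opens (Fin (r + 1) → ℂ)) (i : Fin (r + 1)) : Hol U :=
  ⟨fun x => x.1 i, ext0_analytic (g := fun x => x i)
    (fun _ _ => (ContinuousLinearMap.proj (R := ℂ) (φ := fun _ : Fin (r + 1) => ℂ) i).analyticAt _)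
    fun _ => rfl⟩

/-- The function `λ_r^{-1}` on `U`, when `λ_r` does not vanish on `U`. -/
noncomputable def coordInv {r : ℕ} (U : TopologicalSpace.Opens (Fin (r + 1) → ℂ))
    (hU : ∀ x ∈ U, x (Fin.last r) ≠ 0) : Hol U :=
  ⟨fun x => (x.1 (Fin.last r))⁻¹, ext0_analytic (g := fun x => (x (Fin.last r))⁻¹)
    (fun x hx => ((ContinuousLinearMap.proj (R := ℂ) (φ := fun _ : Fin (r + 1) => ℂ)
      (Fin.last r)).analyticAt x).inv (hU x hx))
    fun _ => rfl⟩

/-- The coordinate functions `λ_i`, indexed by natural numbers (`λ_i = 0` for `i > r`). -/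
def lamHol {r : ℕ} (U : TopologicalSpace.Opens (Fin (r + 1) → ℂ)) (i : ℕ) : Hol U :=
  if h : i < r + 1 then coord U ⟨i, h⟩ else 0

/-- The partial derivatives `∂/∂λ_p` for `1 ≤ p ≤ r`. -/
noncomputable def pdHol {r : ℕ} (U : TopologicalSpace.Opens (Fin (r + 1) → ℂ))
    (p : Finset.Icc 1 r) : Derivation ℂ (Hol U) (Hol U) :=
  partialD U ⟨p, Nat.lt_succ_of_le (Finset.mem_Icc.mp p.2).2⟩

/-! ### Polynomials in `λ_0, …, λ_r, λ_r^{-1}, β_r, Δ` -/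

/-- The variables `λ_0, …, λ_r`, `λ_r^{-1}`, `β_r`, `Δ`. -/
inductive ParamVar (r : ℕ) : Type
  | lam (i : Fin (r + 1))
  | lamInv
  | betaR
  | delta

/-- The values of the variables, as holomorphic functions on `U`. -/
noncomputable def varVal {r : ℕ} (U : TopologicalSpace.Opens (Fin (r + 1) → ℂ))
    (hU : ∀ x ∈ U, x (Fin.last r) ≠ 0) (Δ : ℂ) (B : Hol U) : ParamVar r → Hol U
  | .lam i => coord U i
  | .lamInv => coordInv U hU
  | .betaR => B
  | .delta => algebraMap ℂ (Hol U) Δ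

/-- The value of a polynomial in `λ_0, …, λ_r, λ_r^{-1}, β_r, Δ`. -/
noncomputable def polyVal {r : ℕ} (U : TopologicalSpace.Opens (Fin (r + 1) → ℂ))
    (hU : ∀ x ∈ U, x (Fin.last r) ≠ 0) (Δ : ℂ) (B : Hol U) (P : MvPolynomial (ParamVar r) ℂ) :
    Hol U :=
  MvPolynomial.aeval (varVal U hU Δ B) P

end IrrVertex

open IrrVertex

/-!
The proof realizes the irregular Verma module on a Fock space, where the commutation relation turns
into differential equations for polynomials.

*Free field realization.* On `ℂ[x_1, x_2, …]` the oscillators `a_k` form a Heisenberg algebra, and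
shifting `a_0, …, a_r` by scalars `μ_0, …, μ_r` gives Virasoro operators `vir` of central charge
`1 - 12 ρ²` for which `1` is an irregular vector with eigenvalues `ell`. If `μ_r` is invertible, the
leading term of `L_{-μ} 1` is `μ_r^{ℓ(μ)} x_μ`, so the Fock space is the irregular Verma module
(`toFock_bijective`). The momenta to use are `mom`: all `μ_i` are `λ_i`, except that `λ_0` is shifted
by `(-1)^{r+1} r β_r / λ_r`, since the prefactor `exp(β_r z^{-r})` contributes `(-1)^{r+1} r β_r` to
the eigenvalue `Λ_r` (`eigenvalue_eq`).

*Equations for the highest weight vector.* The relations for `L_n`, `n ≥ 0`, applied to `|Δ⟩` can be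
inverted (`hw_equations_iff`), and become `scrD n f = opT n f` for `f = Φ(z)|Δ⟩`, where
`scrD n = D_n + ell n`, and where `opT n` involves only the Virasoro operators and `z ∂_z`. For
`n ≥ r` the derivations `D_n` are absent. These equations, `opN k f = 0` with `n = r + k`, determine
the coefficients of `f` and the exponents of the prefactor recursively: the `opN k` satisfy relations
of the Witt algebra, so that each order of the equations is a closed system
`λ_r k ∂x/∂x_k + … = e_k`, `k ≥ 1`, which is solved by a Poincaré lemma (`exists_whit_eq`), and the
remaining scalar equation `k = 0` fixes either one exponent of the prefactor or one constant of
integration (`IsSol.exists_succ`). Hence there is one and only one formal solution with given `β_r`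
(`exists_formal_solution`, `formal_solution_unique`). The recursion works over every coefficient
ring, in particular over the ring of polynomials in `λ_0, …, λ_r, λ_r^{-1}, β_r, Δ`; therefore all
coefficients are polynomials (`exists_universal_solution`).

*The derivations.* For `n < r` the equations determine the action of the derivations on `|Λ⟩`,
because the matrix of the vector fields `D_0, …, D_{r-1}` is triangular with invertible diagonal.
On the Fock space `∂/∂λ_q + x_q / q` commutes with the Virasoro operators (`nab_vir`), provided that
the shift of `λ_0` does not depend on `λ_1, …, λ_r`, which is the condition on `β_r`. By the
uniqueness of the formal solution `f`, the operator induced by `D_n` agrees on `f` with `opT n`, up to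
multiplication operators (`covariant_eq_opT`). These are absorbed by the prefactor and by scalar
functions `s_q` in `∂/∂λ_q + x_q / q + s_q` (`exists_connection`).

*Existence.* The operators `L_n - scrL n` on Laurent series, where `scrL n` is the right-hand side
of the commutation relation, must satisfy the Virasoro relations; then the universal property of the
Verma module gives `Φ` (`nonempty_vertexOp_of_equiv`). The only obstruction is that the relations
`[scrD m, scrD n] = (n - m) scrD (m + n)` hold up to multiplication by a Laurent polynomial. This
Laurent polynomial kills `f`, since the `opT n` do satisfy such relations, and hence it vanishes
(`scrDlin_lie`).

*Necessity and uniqueness.* The coefficients of `z^{-i} |Λ⟩` in the equations of index `n < r` give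
`D_n β_r = r β_r δ_{n0}` (`D_exponent_eq`), which is equivalent to the homogeneity of `β_r`. This
comparison of coefficients requires that `|Λ⟩` is not a torsion vector
(`eq_zero_of_smul_irrVec_eq_zero`). The uniqueness of the formal solution determines `Φ(z)|Δ⟩`, and
thereby the derivations and the operator (`VertexOp.eq_of_w_eq`).
-/

namespace IrrVertex

/-! ### Commutators -/

section Commutators

variable {R : Type*} [Ring R]

theorem add_rlie (a b c : R) : ⁅a + b, c⁆ = ⁅a, c⁆ + ⁅b, c⁆ := by
  simp only [Ring.lie_def]; noncomm_ring

theorem rlie_add (a b c : R) : ⁅a, b + c⁆ = ⁅a, b⁆ + ⁅a, c⁆ := by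
  simp only [Ring.lie_def]; noncomm_ring

theorem sub_rlie (a b c : R) : ⁅a - b, c⁆ = ⁅a, c⁆ - ⁅b, c⁆ := by
  simp only [Ring.lie_def]; noncomm_ring

theorem rlie_sub (a b c : R) : ⁅a, b - c⁆ = ⁅a, b⁆ - ⁅a, c⁆ := by
  simp only [Ring.lie_def]; noncomm_ring

theorem rlie_skew (a b : R) : ⁅a, b⁆ = -⁅b, a⁆ := by
  simp only [Ring.lie_def]; noncomm_ring

theorem mul_rlie (a b c : R) : ⁅a * b, c⁆ = a * ⁅b, c⁆ + ⁅a, c⁆ * b := by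
  simp only [Ring.lie_def]; noncomm_ring

theorem rlie_jacobi (a b c : R) : ⁅⁅a, b⁆, c⁆ = ⁅a, ⁅b, c⁆⁆ - ⁅b, ⁅a, c⁆⁆ := by
  simp only [Ring.lie_def]; noncomm_ring

theorem sum_rlie {ι : Type*} (s : Finset ι) (f : ι → R) (c : R) :
    ⁅∑ i ∈ s, f i, c⁆ = ∑ i ∈ s, ⁅f i, c⁆ := by
  simp only [Ring.lie_def, Finset.sum_mul, Finset.mul_sum, Finset.sum_sub_distrib]

theorem rlie_sum {ι : Type*} (s : Finset ι) (f : ι → R) (c : R) :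
    ⁅c, ∑ i ∈ s, f i⁆ = ∑ i ∈ s, ⁅c, f i⁆ := by
  simp only [Ring.lie_def, Finset.sum_mul, Finset.mul_sum, Finset.sum_sub_distrib]

end Commutators

section CommutatorsEnd

variable {A : Type*} [CommRing A] {N : Type*} [AddCommGroup N] [Module A N] (t : A)
  (a b : Module.End A N)

theorem smul_rlie : ⁅t • a, b⁆ = t • ⁅a, b⁆ := by
  apply LinearMap.ext; intro p
  simp [Ring.lie_def, smul_sub]

theorem rlie_smul : ⁅a, t • b⁆ = t • ⁅a, b⁆ := by
  apply LinearMap.ext; intro p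
  simp [Ring.lie_def, smul_sub]

theorem smul_one_rlie : ⁅t • (1 : Module.End A N), b⁆ = 0 := by
  apply LinearMap.ext; intro p
  simp [Ring.lie_def]

theorem rlie_smul_one : ⁅b, t • (1 : Module.End A N)⁆ = 0 := by
  apply LinearMap.ext; intro p
  simp [Ring.lie_def]

end CommutatorsEnd

/-! ### The Heisenberg algebra on the Fock space -/

section Fock

variable (A : Type*) [CommRing A]

/-- The variable `x_k`, `k > 0`, of the Fock space, extended by `x_k = 0` to `k ≤ 0`. The
polynomial generator `X j` is `x_{j+1}`. -/
noncomputable def xvar (k : ℤ) : MvPolynomial ℕ A :=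
  if 0 < k then MvPolynomial.X (k - 1).toNat else 0

/-- The annihilation operator `k ∂/∂x_k` for `k > 0`, extended by `0` to `k ≤ 0`. -/
noncomputable def annih (k : ℤ) : Derivation A (MvPolynomial ℕ A) (MvPolynomial ℕ A) :=
  if 0 < k then k • MvPolynomial.pderiv (k - 1).toNat else 0

/-- The oscillators `a_k` of the Heisenberg algebra on the Fock space of momentum zero: `k ∂/∂x_k`
for `k > 0`, multiplication by `x_{-k}` for `k < 0`, and `a_0 = 0`. -/
noncomputable def osc (k : ℤ) : Module.End A (MvPolynomial ℕ A) :=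
  (annih A k : MvPolynomial ℕ A →ₗ[A] MvPolynomial ℕ A) + LinearMap.mulLeft A (xvar A (-k))

/-- The part of `L_n` that is bilinear in one creation and one annihilation operator:
the derivation `x_k ↦ k x_{k-n}`. -/
noncomputable def rot (n : ℤ) : Derivation A (MvPolynomial ℕ A) (MvPolynomial ℕ A) :=
  MvPolynomial.mkDerivation A fun j : ℕ => ((j : MvPolynomial ℕ A) + 1) * xvar A (j + 1 - n)

variable {A}

theorem xvar_of_nonpos {k : ℤ} (hk : k ≤ 0) : xvar A k = 0 := by
  simp [xvar, not_lt.2 hk]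

theorem xvar_natCast_succ (j : ℕ) : xvar A (j + 1) = MvPolynomial.X j := by
  have : (0 : ℤ) < j + 1 := by positivity
  simp [xvar, this]

theorem annih_of_nonpos {k : ℤ} (hk : k ≤ 0) : annih A k = 0 := by
  simp [annih, not_lt.2 hk]

theorem exists_nat_of_pos {k : ℤ} (hk : 0 < k) : ∃ j : ℕ, k = j + 1 :=
  ⟨(k - 1).toNat, by omega⟩

theorem annih_natCast_succ (j : ℕ) (p : MvPolynomial ℕ A) :
    annih A (j + 1) p = ((j : MvPolynomial ℕ A) + 1) * MvPolynomial.pderiv j p := by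
  have : (0 : ℤ) < j + 1 := by positivity
  simp [annih, this, Derivation.smul_apply]

theorem annih_xvar (m k : ℤ) :
    annih A m (xvar A k) = if m = k ∧ 0 < k then (k : MvPolynomial ℕ A) else 0 := by
  rcases le_or_gt m 0 with hm | hm
  · rw [annih_of_nonpos hm, if_neg (by omega)]; rfl
  rcases le_or_gt k 0 with hk | hk
  · rw [xvar_of_nonpos hk, if_neg (by omega), map_zero]
  obtain ⟨i, rfl⟩ := exists_nat_of_pos hm
  obtain ⟨j, rfl⟩ := exists_nat_of_pos hk
  rw [annih_natCast_succ, xvar_natCast_succ, MvPolynomial.pderiv_X]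
  by_cases h : i = j
  · subst h; simp [hm]
  · rw [Pi.single_eq_of_ne' h, if_neg (by omega), mul_zero]

theorem rot_xvar (n k : ℤ) :
    rot A n (xvar A k) = if 0 < k then (k : MvPolynomial ℕ A) * xvar A (k - n) else 0 := by
  rcases le_or_gt k 0 with hk | hk
  · rw [xvar_of_nonpos hk, if_neg (by omega), map_zero]
  obtain ⟨j, rfl⟩ := exists_nat_of_pos hk
  rw [xvar_natCast_succ, rot, MvPolynomial.mkDerivation_X, if_pos hk]
  simp

theorem lie_rot_annih (n m : ℤ) :
    ⁅rot A n, annih A m⁆ = if 0 < m then (-m) • annih A (n + m) else 0 := by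
  apply MvPolynomial.derivation_ext
  intro j
  rw [Derivation.commutator_apply, ← xvar_natCast_succ, annih_xvar, rot_xvar,
    if_pos (by omega : (0 : ℤ) < (j : ℤ) + 1)]
  have h1 : (rot A n) (if m = (j : ℤ) + 1 ∧ 0 < (j : ℤ) + 1 then
      (((j : ℤ) + 1 : ℤ) : MvPolynomial ℕ A) else 0) = 0 := by
    split_ifs
    · exact Derivation.map_intCast _ _
    · simp
  rw [h1, zero_sub, Derivation.leibniz, Derivation.map_intCast, smul_zero, add_zero, annih_xvar]
  by_cases hm : 0 < m
  · rw [if_pos hm, Derivation.smul_apply, annih_xvar]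
    by_cases h : n + m = j + 1
    · rw [if_pos ⟨by omega, by omega⟩, if_pos ⟨h, by omega⟩]
      have : (j : ℤ) + 1 - n = m := by omega
      rw [this, zsmul_eq_mul, smul_eq_mul]; push_cast; ring
    · rw [if_neg (by omega), if_neg (by omega)]; simp
  · rw [if_neg hm, if_neg (by omega)]; simp

theorem osc_apply (k : ℤ) (p : MvPolynomial ℕ A) :
    osc A k p = annih A k p + xvar A (-k) * p := rfl

theorem osc_zero : osc A 0 = 0 := by
  ext1; simp [osc, annih, xvar]

/-- The Heisenberg relations. -/
theorem lie_osc (j k : ℤ) :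
    ⁅osc A j, osc A k⁆ = if j + k = 0 then (j : Module.End A (MvPolynomial ℕ A)) else 0 := by
  have hc : ⁅annih A j, annih A k⁆ = 0 := by
    apply MvPolynomial.derivation_ext
    intro i
    have h0 : ∀ a b c : ℤ, annih A a (annih A b (xvar A c)) = 0 := by
      intro a b c
      rw [annih_xvar]
      split_ifs
      · exact Derivation.map_intCast _ _
      · simp
    rw [Derivation.commutator_apply, ← xvar_natCast_succ, h0, h0]; simp
  apply LinearMap.ext
  intro p
  have hp : annih A j (annih A k p) - annih A k (annih A j p) = 0 := by
    rw [← Derivation.commutator_apply, hc]; rfl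
  simp only [Ring.lie_def, LinearMap.sub_apply, Module.End.mul_apply, osc_apply, map_add,
    Derivation.leibniz, smul_eq_mul, annih_xvar]
  by_cases h : j + k = 0
  · obtain rfl : k = -j := by omega
    rw [if_pos h, Module.End.intCast_apply, zsmul_eq_mul]
    rcases lt_trichotomy j 0 with h1 | h1 | h1
    · rw [if_neg (by omega), if_pos (by omega)]
      push_cast
      linear_combination hp
    · subst h1; simp
    · rw [if_pos (by omega), if_neg (by omega)]
      push_cast
      linear_combination hp
  · rw [if_neg h, if_neg (by omega), if_neg (by omega), LinearMap.zero_apply]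
    linear_combination hp

theorem lie_rot_osc (n m : ℤ) :
    ⁅(rot A n : Module.End A (MvPolynomial ℕ A)), osc A m⁆ =
      (-m) • (osc A (n + m) - if m < 0 then (annih A (n + m) : Module.End A (MvPolynomial ℕ A))
        else LinearMap.mulLeft A (xvar A (-(n + m)))) := by
  apply LinearMap.ext
  intro p
  have hp : (rot A n) (annih A m p) - annih A m (rot A n p) =
      if 0 < m then -(m : MvPolynomial ℕ A) * annih A (n + m) p else 0 := by
    rw [← Derivation.commutator_apply, lie_rot_annih]
    split_ifs <;> simp
  simp only [Ring.lie_def, LinearMap.sub_apply, Module.End.mul_apply, osc_apply, map_add,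
    Derivation.leibniz, smul_eq_mul, rot_xvar, Derivation.coeFn_coe,
    zsmul_eq_mul, Module.End.intCast_apply, Int.cast_neg, neg_mul, LinearMap.neg_apply]
  rcases lt_trichotomy m 0 with h | h | h
  · rw [if_neg (by omega)] at hp
    rw [if_pos (by omega), if_pos h, show -(n + m) = -m - n by ring]
    rw [Derivation.coeFn_coe]
    linear_combination hp
  · subst h; simp at hp ⊢; linear_combination hp
  · rw [if_pos h] at hp
    rw [if_neg (by omega), if_neg (by omega), LinearMap.mulLeft_apply]
    linear_combination hp

variable [Algebra ℂ A]

variable (A) in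
/-- The quadratic part of `L_n` formed by two creation or two annihilation operators. -/
noncomputable def quad (n : ℤ) : Module.End A (MvPolynomial ℕ A) :=
  algebraMap ℂ A (1 / 2) • ∑ i ∈ Finset.Ioo (min n 0) (max n 0), osc A i * osc A (n - i)

variable (A) in
/-- The Virasoro operators `½ ∑ :a_i a_{n-i}: - ρ (n+1) a_n` on the Fock space of momentum zero. -/
noncomputable def vir0 (ρ : ℂ) (n : ℤ) : Module.End A (MvPolynomial ℕ A) :=
  (rot A n : Module.End A (MvPolynomial ℕ A)) + quad A n - algebraMap ℂ A (ρ * (n + 1)) • osc A n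

theorem lie_quad_osc (n m : ℤ) :
    ⁅quad A n, osc A m⁆ =
      if -m ∈ Finset.Ioo (min n 0) (max n 0) then (-m) • osc A (n + m) else 0 := by
  have key : ∀ i, ⁅osc A i * osc A (n - i), osc A m⁆ =
      (if i = n + m then (-m) • osc A (n + m) else 0) +
        if i = -m then (-m) • osc A (n + m) else 0 := by
    intro i
    rw [mul_rlie, lie_osc, lie_osc]
    congr 1
    · by_cases h : i = n + m
      · subst h
        rw [if_pos (by ring), if_pos rfl, show n - (n + m) = -m by ring, zsmul_eq_mul]
        exact (Int.cast_commute _ _).symm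
      · rw [if_neg (by omega), if_neg h, mul_zero]
    · by_cases h : i = -m
      · subst h
        rw [if_pos (by ring), if_pos rfl, sub_neg_eq_add, zsmul_eq_mul]
      · rw [if_neg (by omega), if_neg h, zero_mul]
  rw [quad, smul_rlie, sum_rlie, Finset.sum_congr rfl fun i _ => key i, Finset.sum_add_distrib,
    Finset.sum_ite_eq', Finset.sum_ite_eq']
  have : n + m ∈ Finset.Ioo (min n 0) (max n 0) ↔ -m ∈ Finset.Ioo (min n 0) (max n 0) := by
    simp only [Finset.mem_Ioo]; omega
  simp only [this]
  split_ifs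
  · rw [← two_smul A, smul_smul, ← map_ofNat (algebraMap ℂ A) 2, ← map_mul]
    norm_num
  · simp

/-- The oscillators are the modes of a field of weight one with background charge `ρ`. -/
theorem lie_vir0_osc (ρ : ℂ) (n m : ℤ) :
    ⁅vir0 A ρ n, osc A m⁆ =
      (-m) • osc A (n + m) - if n + m = 0 then algebraMap ℂ A (ρ * (n + 1) * n) • (1 : Module.End A _) else 0 := by
  rw [vir0, sub_rlie, add_rlie, lie_rot_osc, lie_quad_osc, smul_rlie, lie_osc]
  have h1 : algebraMap ℂ A (ρ * (n + 1)) • (if n + m = 0 then (n : Module.End A (MvPolynomial ℕ A)) else 0) =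
      if n + m = 0 then algebraMap ℂ A (ρ * (n + 1) * n) • (1 : Module.End A (MvPolynomial ℕ A)) else 0 := by
    split_ifs
    · rw [map_mul _ (ρ * (n + 1)) (n : ℂ), mul_smul, map_intCast, Int.cast_smul_eq_zsmul, zsmul_one]
    · simp
  rw [h1, ← sub_eq_zero]
  have ho : osc A (n + m) = (annih A (n + m) : Module.End A (MvPolynomial ℕ A)) +
      LinearMap.mulLeft A (xvar A (-(n + m))) := rfl
  have hx : ∀ k : ℤ, k ≤ 0 → LinearMap.mulLeft A (xvar A k) = 0 := fun k hk => by
    rw [xvar_of_nonpos hk]; ext1; simp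
  have ha : ∀ k : ℤ, k ≤ 0 → (annih A k : Module.End A (MvPolynomial ℕ A)) = 0 := fun k hk => by
    rw [annih_of_nonpos hk]; rfl
  simp only [Finset.mem_Ioo]
  by_cases h : m < 0
  · rw [if_pos h]
    by_cases h2 : 0 < n + m
    · rw [if_pos (by omega), ho, hx _ (by omega)]; module
    · rw [if_neg (by omega), ha _ (by omega)]; module
  · rw [if_neg h]
    rcases eq_or_ne m 0 with rfl | hm
    · simp
    by_cases h2 : n + m < 0
    · rw [if_pos (by omega), ho, ha _ (by omega)]; module
    · rw [if_neg (by omega), hx _ (by omega)]; module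

end Fock


/-! ### Schur's lemma -/

section Schur

variable {A : Type*} [CommRing A]

theorem osc_neg_succ (j : ℕ) (p : MvPolynomial ℕ A) :
    osc A (-(j + 1)) p = MvPolynomial.X j * p := by
  rw [osc_apply, annih_of_nonpos (by omega), neg_neg, xvar_natCast_succ]; simp

theorem osc_of_nonneg {k : ℤ} (hk : 0 ≤ k) (p : MvPolynomial ℕ A) :
    osc A k p = annih A k p := by
  rw [osc_apply, xvar_of_nonpos (by omega), zero_mul, add_zero]

variable [Algebra ℂ A]

theorem natCast_succ_mul_eq_zero (n : ℕ) {a : A} (h : ((n : A) + 1) * a = 0) : a = 0 := by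
  have h1 : algebraMap ℂ A ((n : ℂ) + 1)⁻¹ * ((n : A) + 1) = 1 := by
    rw [← map_natCast (algebraMap ℂ A) n, ← map_one (algebraMap ℂ A), ← map_add, ← map_mul,
      inv_mul_cancel₀ (Nat.cast_add_one_ne_zero n)]
  calc a = (algebraMap ℂ A ((n : ℂ) + 1)⁻¹ * ((n : A) + 1)) * a := by rw [h1, one_mul]
    _ = 0 := by rw [mul_assoc, h, mul_zero]

theorem eq_C_of_pderiv_eq_zero {p : MvPolynomial ℕ A} (h : ∀ j, MvPolynomial.pderiv j p = 0) :
    p = MvPolynomial.C (MvPolynomial.constantCoeff p) := by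
  ext s
  rw [MvPolynomial.coeff_C]
  split_ifs with hs
  · rw [← hs]; rfl
  · obtain ⟨j, hj⟩ : ∃ j, s j ≠ 0 := by
      by_contra! hc
      exact hs (Finsupp.ext fun j => (hc j).symm)
    have h1 := congrArg (MvPolynomial.coeff (s - Finsupp.single j 1)) (h j)
    have h2 : s - Finsupp.single j 1 + Finsupp.single j 1 = s := by
      ext i
      by_cases hi : i = j
      · subst hi; simp; omega
      · simp [Ne.symm hi]
    rw [MvPolynomial.coeff_pderiv, h2, MvPolynomial.coeff_zero, mul_comm] at h1
    exact natCast_succ_mul_eq_zero _ h1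

theorem eq_C_of_annih_eq_zero {p : MvPolynomial ℕ A} (h : ∀ k, annih A k p = 0) :
    p = MvPolynomial.C (MvPolynomial.constantCoeff p) := by
  refine eq_C_of_pderiv_eq_zero fun j => ?_
  have := h (j + 1)
  rw [annih_natCast_succ] at this
  ext s
  have h2 := congrArg (MvPolynomial.coeff s) this
  rw [← map_natCast (MvPolynomial.C (σ := ℕ) (R := A)), ← map_one MvPolynomial.C, ← map_add,
    MvPolynomial.coeff_C_mul] at h2
  exact natCast_succ_mul_eq_zero _ h2

/-- Schur's lemma for the Fock space. -/
theorem eq_smul_one_of_lie_osc {K : Module.End A (MvPolynomial ℕ A)}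
    (h : ∀ k, ⁅K, osc A k⁆ = 0) : K = MvPolynomial.constantCoeff (K 1) • 1 := by
  have hc : ∀ k p, K (osc A k p) = osc A k (K p) := fun k p => by
    have := congrArg (fun T : Module.End A (MvPolynomial ℕ A) => T p) (h k)
    simpa [Ring.lie_def, sub_eq_zero] using this
  have h1 : K 1 = MvPolynomial.C (MvPolynomial.constantCoeff (K 1)) := by
    apply eq_C_of_annih_eq_zero
    intro k
    rcases le_or_gt k 0 with hk | hk
    · rw [annih_of_nonpos hk]; rfl
    · rw [← osc_of_nonneg hk.le, ← hc, osc_of_nonneg hk.le, Derivation.map_one_eq_zero, map_zero]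
  apply LinearMap.ext
  intro p
  induction p using MvPolynomial.induction_on with
  | C a =>
    have : (MvPolynomial.C a : MvPolynomial ℕ A) = a • 1 := by
      rw [MvPolynomial.smul_eq_C_mul, mul_one]
    rw [this, map_smul, LinearMap.smul_apply, Module.End.one_apply, smul_comm]
    congr 1
    rw [MvPolynomial.smul_eq_C_mul, mul_one, ← h1]
  | add p q hp hq => rw [map_add, map_add, hp, hq]
  | mul_X p j hp =>
    rw [mul_comm, ← osc_neg_succ, hc, hp, LinearMap.smul_apply, LinearMap.smul_apply, map_smul]
    rfl

end Schur

/-! ### The Virasoro relations on the Fock space -/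

section Virasoro

variable {A : Type*} [CommRing A]

theorem constantCoeff_rot (n : ℤ) (p : MvPolynomial ℕ A) :
    MvPolynomial.constantCoeff (rot A n p) = 0 := by
  have hx : ∀ k, MvPolynomial.constantCoeff (xvar A k) = 0 := fun k => by
    unfold xvar; split_ifs <;> simp
  induction p using MvPolynomial.induction_on with
  | C a => simp [MvPolynomial.derivation_C]
  | add p q hp hq => rw [map_add, map_add, hp, hq, add_zero]
  | mul_X p j hp => simp [Derivation.leibniz, rot, MvPolynomial.mkDerivation_X, hx]

theorem constantCoeff_osc_of_neg {k : ℤ} (hk : k < 0) (p : MvPolynomial ℕ A) :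
    MvPolynomial.constantCoeff (osc A k p) = 0 := by
  obtain ⟨j, hj⟩ := exists_nat_of_pos (show 0 < -k by omega)
  have : osc A k p = MvPolynomial.X j * p := by
    rw [osc_apply, annih_of_nonpos hk.le, hj, xvar_natCast_succ]; simp
  simp [this]

theorem osc_one_of_nonneg {k : ℤ} (hk : 0 ≤ k) : osc A k 1 = 0 := by
  rw [osc_apply, xvar_of_nonpos (by omega)]; simp

theorem constantCoeff_osc_one (k : ℤ) : MvPolynomial.constantCoeff (osc A k 1) = 0 := by
  rcases le_or_gt 0 k with hk | hk
  · rw [osc_one_of_nonneg hk, map_zero]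
  · exact constantCoeff_osc_of_neg hk _

theorem sum_range_succ_mul_sub (M : ℕ) (K : ℤ) :
    6 * ∑ j ∈ Finset.range M, ((j : ℤ) + 1) * (K - (j + 1)) = M * (M + 1) * (3 * K - 2 * M - 1) := by
  induction M with
  | zero => simp
  | succ M ih => rw [Finset.sum_range_succ, mul_add, ih]; push_cast; ring

theorem sum_Ioo_neg (m : ℕ) :
    6 * ∑ i ∈ Finset.Ioo (-((m : ℤ) + 1)) 0, i * (-((m : ℤ) + 1) - i) =
      ((m : ℤ) + 1) ^ 3 - (m + 1) := by
  have : Finset.Ioo (-((m : ℤ) + 1)) 0 =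
      (Finset.range m).image fun j : ℕ => -((j : ℤ) + 1) := by
    ext i
    simp only [Finset.mem_Ioo, Finset.mem_image, Finset.mem_range]
    constructor
    · rintro ⟨h1, h2⟩
      exact ⟨(-i - 1).toNat, by omega, by omega⟩
    · rintro ⟨j, hj, rfl⟩
      omega
  rw [this, Finset.sum_image (fun a _ b _ h => by simpa using h)]
  have h2 := sum_range_succ_mul_sub m ((m : ℤ) + 1)
  have h3 : ∀ j : ℕ, -((j : ℤ) + 1) * (-((m : ℤ) + 1) - -((j : ℤ) + 1)) =
      ((j : ℤ) + 1) * ((m : ℤ) + 1 - (j + 1)) := fun j => by ring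
  rw [Finset.sum_congr rfl fun j _ => h3 j, h2]; ring

variable [Algebra ℂ A]

theorem vir0_one_of_nonneg (ρ : ℂ) {n : ℤ} (hn : 0 ≤ n) : vir0 A ρ n 1 = 0 := by
  have hq : quad A n 1 = 0 := by
    rw [quad, LinearMap.smul_apply, LinearMap.sum_apply, Finset.sum_eq_zero, smul_zero]
    intro i hi
    rw [Finset.mem_Ioo] at hi
    rw [Module.End.mul_apply, osc_one_of_nonneg (by omega), map_zero]
  rw [vir0, LinearMap.sub_apply, LinearMap.add_apply, hq, LinearMap.smul_apply,
    osc_one_of_nonneg hn, Derivation.coeFn_coe, Derivation.map_one_eq_zero]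
  simp

theorem constantCoeff_quad_of_nonpos {n : ℤ} (hn : n ≤ 0) (p : MvPolynomial ℕ A) :
    MvPolynomial.constantCoeff (quad A n p) = 0 := by
  rw [quad, LinearMap.smul_apply, LinearMap.sum_apply, MvPolynomial.constantCoeff_smul, map_sum,
    Finset.sum_eq_zero, smul_zero]
  intro i hi
  rw [Finset.mem_Ioo] at hi
  rw [Module.End.mul_apply]
  exact constantCoeff_osc_of_neg (by omega) _

theorem constantCoeff_vir0_of_nonpos (ρ : ℂ) {n : ℤ} (hn : n ≤ 0) (p : MvPolynomial ℕ A) :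
    MvPolynomial.constantCoeff (vir0 A ρ n p) = 0 := by
  rw [vir0, LinearMap.sub_apply, LinearMap.add_apply, map_sub, map_add, Derivation.coeFn_coe,
    constantCoeff_rot, constantCoeff_quad_of_nonpos hn, LinearMap.smul_apply,
    MvPolynomial.constantCoeff_smul]
  rcases hn.lt_or_eq with h | rfl
  · rw [constantCoeff_osc_of_neg h]; simp
  · simp [osc_zero]

/-- The vacuum expectation value of `L_m L_n`, from which the central charge is read off. -/
theorem constantCoeff_vir0_vir0_one (ρ : ℂ) {m n : ℤ} (hm : 0 < m) (hn : n < 0) :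
    MvPolynomial.constantCoeff (vir0 A ρ m (vir0 A ρ n 1)) =
      if m + n = 0 then algebraMap ℂ A (((m : ℂ) ^ 3 - m) / 12 * (1 - 12 * ρ ^ 2)) else 0 := by
  have hcomm : ∀ k p, vir0 A ρ m (osc A k p) = ⁅vir0 A ρ m, osc A k⁆ p +
      osc A k (vir0 A ρ m p) := fun k p => by simp [Ring.lie_def]
  have h2 : ∀ i, i < 0 → n - i < 0 →
      MvPolynomial.constantCoeff (vir0 A ρ m (osc A i (osc A (n - i) 1))) =
        if m + n = 0 then ((i * (n - i) : ℤ) : A) else 0 := by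
    intro i hi hni
    have h3 : osc A (m + i) (osc A (n - i) 1) = ⁅osc A (m + i), osc A (n - i)⁆ 1 +
        osc A (n - i) (osc A (m + i) 1) := by simp [Ring.lie_def]
    rw [hcomm, map_add, constantCoeff_osc_of_neg hi, add_zero, lie_vir0_osc, LinearMap.sub_apply,
      LinearMap.smul_apply, map_sub, map_zsmul, h3, map_add, constantCoeff_osc_of_neg hni,
      lie_osc]
    have h4 : MvPolynomial.constantCoeff ((if m + i = 0 then
        algebraMap ℂ A (ρ * (m + 1) * m) • (1 : Module.End A (MvPolynomial ℕ A)) else 0)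
        (osc A (n - i) 1)) = 0 := by
      split_ifs
      · rw [LinearMap.smul_apply, MvPolynomial.constantCoeff_smul, Module.End.one_apply,
          constantCoeff_osc_one, smul_zero]
      · simp
    rw [h4]
    by_cases h : m + n = 0
    · rw [if_pos h, if_pos (by omega), Module.End.intCast_apply]
      have : m + i = -(n - i) := by omega
      rw [this]; simp; ring
    · rw [if_neg h, if_neg (by omega)]; simp
  have h5 : MvPolynomial.constantCoeff (vir0 A ρ m (osc A n 1)) =
      if m + n = 0 then -algebraMap ℂ A (ρ * (m + 1) * m) else 0 := by
    rw [hcomm, vir0_one_of_nonneg ρ hm.le, map_zero, add_zero, lie_vir0_osc, LinearMap.sub_apply,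
      LinearMap.smul_apply, map_sub, map_zsmul, constantCoeff_osc_one]
    split_ifs
    · simp [MvPolynomial.constantCoeff_smul]
    · simp
  have h6 : vir0 A ρ n 1 = quad A n 1 - algebraMap ℂ A (ρ * (n + 1)) • osc A n 1 := by
    rw [vir0, LinearMap.sub_apply, LinearMap.add_apply, Derivation.coeFn_coe,
      Derivation.map_one_eq_zero, zero_add]; rfl
  rw [h6, map_sub, map_smul, map_sub, MvPolynomial.constantCoeff_smul, h5, quad,
    LinearMap.smul_apply, map_smul, MvPolynomial.constantCoeff_smul, LinearMap.sum_apply, map_sum,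
    map_sum, min_eq_left hn.le, max_eq_right hn.le]
  have h7 : ∀ i ∈ Finset.Ioo n 0, MvPolynomial.constantCoeff (vir0 A ρ m
      ((osc A i * osc A (n - i)) 1)) = if m + n = 0 then ((i * (n - i) : ℤ) : A) else 0 := by
    intro i hi
    rw [Finset.mem_Ioo] at hi
    exact h2 i hi.2 (by omega)
  rw [Finset.sum_congr rfl h7]
  split_ifs with h
  · obtain ⟨j, rfl⟩ := exists_nat_of_pos hm
    obtain rfl : n = -((j : ℤ) + 1) := by omega
    have h8 := congrArg (fun x : ℤ => (x : ℂ)) (sum_Ioo_neg j)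
    rw [← Int.cast_sum, ← map_intCast (algebraMap ℂ A), smul_eq_mul, smul_eq_mul, ← map_neg,
      ← map_mul, ← map_mul, ← map_sub]
    congr 1
    push_cast at h8 ⊢
    linear_combination (1 / 12) * h8
  · simp

theorem zsmul_rlie {R : Type*} [Ring R] (t : ℤ) (a b : R) : ⁅t • a, b⁆ = t • ⁅a, b⁆ := by
  simp only [Ring.lie_def, smul_mul_assoc, mul_smul_comm, smul_sub]

theorem rlie_zsmul {R : Type*} [Ring R] (t : ℤ) (a b : R) : ⁅a, t • b⁆ = t • ⁅a, b⁆ := by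
  simp only [Ring.lie_def, smul_mul_assoc, mul_smul_comm, smul_sub]

/-- The Virasoro relations. Both sides have the same commutators with all oscillators, so by Schur's
lemma they differ by a scalar, which is found from vacuum expectation values. -/
theorem lie_vir0 (ρ : ℂ) (m n : ℤ) :
    ⁅vir0 A ρ m, vir0 A ρ n⁆ = (m - n) • vir0 A ρ (m + n) +
      (if m + n = 0 then algebraMap ℂ A (((m : ℂ) ^ 3 - m) / 12 * (1 - 12 * ρ ^ 2)) else 0) •
        (1 : Module.End A (MvPolynomial ℕ A)) := by
  have hK : ∀ k, ⁅⁅vir0 A ρ m, vir0 A ρ n⁆ - (m - n) • vir0 A ρ (m + n), osc A k⁆ = 0 := by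
    intro k
    have hz : ∀ a b : ℤ, ⁅vir0 A ρ a, if b = 0 then
        algebraMap ℂ A (ρ * (n + 1) * n) • (1 : Module.End A (MvPolynomial ℕ A)) else 0⁆ = 0 := by
      intro a b
      split_ifs
      · exact rlie_smul_one _ _
      · simp [Ring.lie_def]
    have hz' : ∀ a b : ℤ, ⁅vir0 A ρ a, if b = 0 then
        algebraMap ℂ A (ρ * (m + 1) * m) • (1 : Module.End A (MvPolynomial ℕ A)) else 0⁆ = 0 := by
      intro a b
      split_ifs
      · exact rlie_smul_one _ _
      · simp [Ring.lie_def]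
    rw [sub_rlie, rlie_jacobi, zsmul_rlie, lie_vir0_osc, lie_vir0_osc, lie_vir0_osc, rlie_sub,
      rlie_sub, hz, hz', rlie_zsmul, rlie_zsmul, lie_vir0_osc, lie_vir0_osc,
      show m + (n + k) = m + n + k by ring, show n + (m + k) = m + n + k by ring]
    by_cases h : m + n + k = 0
    · obtain rfl : k = -(m + n) := by omega
      simp only [h, if_true]
      apply LinearMap.ext
      intro p
      simp only [LinearMap.sub_apply, LinearMap.neg_apply, LinearMap.smul_apply,
        Module.End.one_apply, LinearMap.zero_apply, osc_zero, smul_zero, zero_sub, sub_zero, map_mul, map_add, map_one,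
        map_intCast, Int.cast_add]
      module
    · simp only [h, if_false, sub_zero]
      module
  have h1 := eq_smul_one_of_lie_osc hK
  rw [sub_eq_iff_eq_add'] at h1
  rw [h1]
  congr 2
  rw [LinearMap.sub_apply, map_sub, LinearMap.smul_apply, map_zsmul]
  have h2 : MvPolynomial.constantCoeff (vir0 A ρ (m + n) 1) = 0 := by
    rcases le_or_gt 0 (m + n) with h | h
    · rw [vir0_one_of_nonneg ρ h, map_zero]
    · exact constantCoeff_vir0_of_nonpos ρ h.le _
  rw [h2, smul_zero, sub_zero, Ring.lie_def, LinearMap.sub_apply, map_sub, Module.End.mul_apply,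
    Module.End.mul_apply]
  rcases lt_trichotomy m 0 with hm | rfl | hm
  · rw [constantCoeff_vir0_of_nonpos ρ hm.le]
    rcases le_or_gt n 0 with hn | hn
    · rw [constantCoeff_vir0_of_nonpos ρ hn, if_neg (by omega), sub_zero]
    · rw [constantCoeff_vir0_vir0_one ρ hn hm, add_comm n m]
      split_ifs with h
      · obtain rfl : n = -m := by omega
        rw [zero_sub, ← map_neg]; congr 1; push_cast; ring
      · simp
  · rw [constantCoeff_vir0_of_nonpos ρ le_rfl, vir0_one_of_nonneg ρ le_rfl, map_zero, map_zero]
    simp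
  · rw [vir0_one_of_nonneg ρ hm.le, map_zero, map_zero, sub_zero]
    rcases le_or_gt 0 n with hn | hn
    · rw [vir0_one_of_nonneg ρ hn, map_zero, map_zero, if_neg (by omega)]
    · exact constantCoeff_vir0_vir0_one ρ hm hn

end Virasoro


/-! ### Shifted Virasoro operators -/

section Shift

variable {A : Type*} [CommRing A] [Algebra ℂ A] (ρ : ℂ) (r : ℕ) (lam : ℕ → A)

/-- The scalars `½ ∑_{i+j=n} λ_i λ_j - ρ (n+1) λ_n`, with `0 ≤ i, j ≤ r`. -/
noncomputable def ell (n : ℤ) : A :=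
  algebraMap ℂ A (1 / 2) * (∑ i ∈ Finset.range (r + 1), ∑ j ∈ Finset.range (r + 1),
    if (i + j : ℤ) = n then lam i * lam j else 0)
  - algebraMap ℂ A (ρ * (n + 1)) * ∑ i ∈ Finset.range (r + 1), if (i : ℤ) = n then lam i else 0

/-- The Virasoro operators on the Fock space on which `a_i`, `0 ≤ i ≤ r`, has been shifted by
the scalar `λ_i`. -/
noncomputable def vir (n : ℤ) : Module.End A (MvPolynomial ℕ A) :=
  vir0 A ρ n + ∑ i ∈ Finset.range (r + 1), lam i • osc A (n - i) + ell ρ r lam n • 1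

/-- Symmetrization in `i` and `j`, using `(m - i) + (m - j) = m - n` for `i + j = m + n`. -/
theorem sum_ite_mul_sub (m n : ℤ) :
    ∑ i ∈ Finset.range (r + 1), ∑ j ∈ Finset.range (r + 1),
      (if (i + j : ℤ) = m + n then lam i * lam j * ((m - i : ℤ) : A) else 0) =
    ((m - n : ℤ) : A) * (algebraMap ℂ A (1 / 2) * (∑ i ∈ Finset.range (r + 1),
      ∑ j ∈ Finset.range (r + 1), if (i + j : ℤ) = m + n then lam i * lam j else 0)) := by
  set S := ∑ i ∈ Finset.range (r + 1), ∑ j ∈ Finset.range (r + 1),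
      (if (i + j : ℤ) = m + n then lam i * lam j * ((m - i : ℤ) : A) else 0) with hS
  have h2 : S = ∑ i ∈ Finset.range (r + 1), ∑ j ∈ Finset.range (r + 1),
      (if (i + j : ℤ) = m + n then lam i * lam j * ((m - j : ℤ) : A) else 0) := by
    rw [hS, Finset.sum_comm]
    refine Finset.sum_congr rfl fun i _ => Finset.sum_congr rfl fun j _ => ?_
    rw [add_comm (j : ℤ) i, mul_comm (lam j)]
  have h3 : S + S = ((m - n : ℤ) : A) * ∑ i ∈ Finset.range (r + 1),
      ∑ j ∈ Finset.range (r + 1), if (i + j : ℤ) = m + n then lam i * lam j else 0 := by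
    nth_rewrite 2 [h2]
    rw [hS, ← Finset.sum_add_distrib, Finset.mul_sum]
    refine Finset.sum_congr rfl fun i _ => ?_
    rw [← Finset.sum_add_distrib, Finset.mul_sum]
    refine Finset.sum_congr rfl fun j _ => ?_
    split_ifs with h
    · have : ((m - n : ℤ) : A) = ((m - i : ℤ) : A) + ((m - j : ℤ) : A) := by
        rw [← Int.cast_add]; congr 1; omega
      rw [this]; ring
    · simp
  have h4 : algebraMap ℂ A (1 / 2) * 2 = 1 := by
    rw [← map_ofNat (algebraMap ℂ A) 2, ← map_mul]; norm_num
  linear_combination algebraMap ℂ A (1 / 2) * h3 - S * h4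

theorem lie_vir0_osc' (n m i : ℤ) :
    ⁅vir0 A ρ n, osc A (m - i)⁆ =
      (-(m - i)) • osc A (n + m - i) - (if i = n + m then algebraMap ℂ A (ρ * (n + 1) * n) else 0) •
        (1 : Module.End A (MvPolynomial ℕ A)) := by
  rw [lie_vir0_osc, show n + (m - i) = n + m - i by ring]
  congr 1
  by_cases h : i = n + m
  · rw [if_pos (by omega), if_pos h]
  · rw [if_neg (by omega), if_neg h]; apply LinearMap.ext; simp

/-- The shifted operators satisfy the Virasoro relations with central charge `1 - 12 ρ²`. -/
theorem lie_vir (m n : ℤ) :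
    ⁅vir ρ r lam m, vir ρ r lam n⁆ = (m - n) • vir ρ r lam (m + n) +
      (if m + n = 0 then algebraMap ℂ A (((m : ℂ) ^ 3 - m) / 12 * (1 - 12 * ρ ^ 2)) else 0) •
        (1 : Module.End A (MvPolynomial ℕ A)) := by
  have h1 : ∀ a b : ℤ, ⁅vir0 A ρ a, ∑ i ∈ Finset.range (r + 1), lam i • osc A (b - i)⁆ =
      ∑ i ∈ Finset.range (r + 1), (lam i • (-(b - i)) • osc A (a + b - i)) -
        (∑ i ∈ Finset.range (r + 1), if (i : ℤ) = a + b then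
          lam i * algebraMap ℂ A (ρ * (a + 1) * a) else 0) •
            (1 : Module.End A (MvPolynomial ℕ A)) := by
    intro a b
    rw [rlie_sum, Finset.sum_smul, ← Finset.sum_sub_distrib]
    refine Finset.sum_congr rfl fun i _ => ?_
    rw [rlie_smul, lie_vir0_osc', smul_sub]
    congr 1
    split_ifs
    · rw [mul_smul]
    · simp
  have h2 : ⁅∑ i ∈ Finset.range (r + 1), lam i • osc A (m - i),
      ∑ i ∈ Finset.range (r + 1), lam i • osc A (n - i)⁆ =
      (((m - n : ℤ) : A) * (algebraMap ℂ A (1 / 2) * (∑ i ∈ Finset.range (r + 1),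
      ∑ j ∈ Finset.range (r + 1), if (i + j : ℤ) = m + n then lam i * lam j else 0))) •
        (1 : Module.End A (MvPolynomial ℕ A)) := by
    rw [← sum_ite_mul_sub, sum_rlie, Finset.sum_smul]
    refine Finset.sum_congr rfl fun i _ => ?_
    rw [rlie_sum, Finset.sum_smul]
    refine Finset.sum_congr rfl fun j _ => ?_
    rw [smul_rlie, rlie_smul, lie_osc]
    by_cases h : (i + j : ℤ) = m + n
    · rw [if_pos (by omega), if_pos h]
      apply LinearMap.ext; intro p
      simp only [LinearMap.smul_apply, Module.End.intCast_apply, Module.End.one_apply, mul_smul,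
        Int.cast_smul_eq_zsmul]
    · rw [if_neg (by omega), if_neg h]; simp
  have h3 : ⁅∑ i ∈ Finset.range (r + 1), lam i • osc A (m - i), vir0 A ρ n⁆ =
      -(∑ i ∈ Finset.range (r + 1), (lam i • (-(m - i)) • osc A (m + n - i)) -
        (∑ i ∈ Finset.range (r + 1), if (i : ℤ) = m + n then
          lam i * algebraMap ℂ A (ρ * (n + 1) * n) else 0) •
            (1 : Module.End A (MvPolynomial ℕ A))) := by
    rw [rlie_skew, h1, add_comm n m]
  have h4 : ∑ i ∈ Finset.range (r + 1), (lam i • (-(n - i)) • osc A (m + n - i)) -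
      ∑ i ∈ Finset.range (r + 1), (lam i • (-(m - i)) • osc A (m + n - i)) =
      (m - n) • ∑ i ∈ Finset.range (r + 1), lam i • osc A (m + n - i) := by
    rw [← Finset.sum_sub_distrib, Finset.smul_sum]
    refine Finset.sum_congr rfl fun i _ => ?_
    module
  have h5 : (∑ i ∈ Finset.range (r + 1), if (i : ℤ) = m + n then
          lam i * algebraMap ℂ A (ρ * (m + 1) * m) else 0) -
      (∑ i ∈ Finset.range (r + 1), if (i : ℤ) = m + n then
          lam i * algebraMap ℂ A (ρ * (n + 1) * n) else 0) =
      ((m - n : ℤ) : A) * (algebraMap ℂ A (ρ * ((m + n : ℤ) + 1)) *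
        ∑ i ∈ Finset.range (r + 1), if (i : ℤ) = m + n then lam i else 0) := by
    rw [← Finset.sum_sub_distrib, Finset.mul_sum, Finset.mul_sum]
    refine Finset.sum_congr rfl fun i _ => ?_
    split_ifs with h
    · rw [← map_intCast (algebraMap ℂ A), ← mul_assoc, ← map_mul, mul_comm _ (lam i), ← mul_sub,
        ← map_sub]
      congr 2; push_cast; ring
    · simp
  rw [vir, vir, add_rlie, add_rlie, rlie_add, rlie_add, rlie_add, rlie_add, rlie_smul_one,
    rlie_smul_one, smul_one_rlie, lie_vir0, h1, h2, h3, vir]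
  rw [sub_eq_iff_eq_add] at h4 h5
  rw [h4, h5, ell]
  apply LinearMap.ext; intro p
  simp only [LinearMap.add_apply, LinearMap.sub_apply, LinearMap.neg_apply, LinearMap.smul_apply,
    Module.End.one_apply, LinearMap.sum_apply, LinearMap.zero_apply]
  module

theorem ell_eq_zero {n : ℤ} (hn : 2 * r < n) : ell ρ r lam n = 0 := by
  rw [ell, Finset.sum_eq_zero, Finset.sum_eq_zero]
  · simp
  · intro i hi
    rw [Finset.mem_range] at hi
    rw [if_neg (by omega)]
  · intro i hi
    refine Finset.sum_eq_zero fun j hj => ?_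
    rw [Finset.mem_range] at hi hj
    rw [if_neg (by omega)]

/-- The constant `1` is an irregular vector. -/
theorem vir_one {n : ℤ} (hn : r ≤ n) : vir ρ r lam n 1 = ell ρ r lam n • 1 := by
  rw [vir, LinearMap.add_apply, LinearMap.add_apply, vir0_one_of_nonneg ρ (by omega),
    LinearMap.sum_apply, Finset.sum_eq_zero]
  · simp
  · intro i hi
    rw [Finset.mem_range] at hi
    rw [LinearMap.smul_apply, osc_one_of_nonneg (by omega), smul_zero]

end Shift


/-! ### The weight filtration -/

section Filtration

variable {A : Type*} [CommRing A]

/-- The weight of a monomial, where the variable `X j = x_{j+1}` has weight `j + 1`. -/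
noncomputable def wt : (ℕ →₀ ℕ) →+ ℕ := Finsupp.weight fun j : ℕ => j + 1

theorem wt_single (j n : ℕ) : wt (Finsupp.single j n) = n * (j + 1) := by
  simp [wt, Finsupp.weight_single]

variable (A) in
/-- The polynomials of weighted degree at most `d`. -/
def fil (d : ℤ) : Submodule A (MvPolynomial ℕ A) where
  carrier := {p | ∀ s, d < wt s → p.coeff s = 0}
  add_mem' {p q} hp hq s hs := by rw [MvPolynomial.coeff_add, hp s hs, hq s hs, add_zero]
  zero_mem' _ _ := MvPolynomial.coeff_zero _
  smul_mem' a p hp s hs := by rw [MvPolynomial.coeff_smul, hp s hs, smul_zero]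

theorem fil_mono {d e : ℤ} (h : d ≤ e) : fil A d ≤ fil A e :=
  fun _ hp s hs => hp s (h.trans_lt hs)

theorem monomial_mem_fil {d : ℤ} {s : ℕ →₀ ℕ} (a : A) (h : (wt s : ℤ) ≤ d) :
    MvPolynomial.monomial s a ∈ fil A d := by
  intro t ht
  rw [MvPolynomial.coeff_monomial, if_neg]
  rintro rfl
  omega

theorem C_mem_fil (a : A) {d : ℤ} (hd : 0 ≤ d) : MvPolynomial.C a ∈ fil A d :=
  monomial_mem_fil a (by simpa using hd)

theorem one_mem_fil {d : ℤ} (hd : 0 ≤ d) : (1 : MvPolynomial ℕ A) ∈ fil A d :=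
  C_mem_fil 1 hd

theorem eq_zero_of_mem_fil_neg {d : ℤ} (hd : d < 0) {p : MvPolynomial ℕ A} (hp : p ∈ fil A d) :
    p = 0 := by
  ext s
  exact hp s (by omega)

theorem eq_C_of_mem_fil_zero {p : MvPolynomial ℕ A} (hp : p ∈ fil A 0) :
    p = MvPolynomial.C (MvPolynomial.constantCoeff p) := by
  ext s
  rw [MvPolynomial.coeff_C]
  split_ifs with hs
  · rw [← hs]; rfl
  · refine hp s ?_
    obtain ⟨j, hj⟩ : ∃ j, s j ≠ 0 := by
      by_contra! hc
      exact hs (Finsupp.ext fun j => (hc j).symm)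
    have := Finsupp.le_weight (fun j : ℕ => j + 1) (s := j) (by simp) s
    have h2 : 0 < wt s := lt_of_lt_of_le (Nat.pos_of_ne_zero hj) this
    exact_mod_cast h2

theorem exists_mem_fil (p : MvPolynomial ℕ A) : ∃ N : ℕ, p ∈ fil A N := by
  refine ⟨p.support.sup wt, fun s hs => ?_⟩
  by_contra h
  have := Finset.le_sup (f := wt) (MvPolynomial.mem_support_iff.2 h)
  omega

theorem mul_mem_fil {d e : ℤ} {p q : MvPolynomial ℕ A} (hp : p ∈ fil A d) (hq : q ∈ fil A e) :
    p * q ∈ fil A (d + e) := by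
  classical
  intro s hs
  rw [MvPolynomial.coeff_mul]
  refine Finset.sum_eq_zero fun x hx => ?_
  rw [Finset.HasAntidiagonal.mem_antidiagonal] at hx
  rw [← hx, map_add] at hs
  rcases lt_or_ge d (wt x.1) with h | h
  · rw [hp _ h, zero_mul]
  · rw [hq _ (by push_cast at hs; omega), mul_zero]

theorem xvar_mem_fil {k d : ℤ} (h : k ≤ d) : xvar A k ∈ fil A d := by
  rcases le_or_gt k 0 with hk | hk
  · rw [xvar_of_nonpos hk]; exact zero_mem _
  · obtain ⟨j, rfl⟩ := exists_nat_of_pos hk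
    rw [xvar_natCast_succ]
    exact monomial_mem_fil 1 (by rw [wt_single]; push_cast; omega)

/-- `P` raises the weighted degree by at most `e`. -/
def HasDeg (P : Module.End A (MvPolynomial ℕ A)) (e : ℤ) : Prop :=
  ∀ d p, p ∈ fil A d → P p ∈ fil A (d + e)

theorem HasDeg.of_monomial {P : Module.End A (MvPolynomial ℕ A)} {e : ℤ}
    (h : ∀ s a, P (MvPolynomial.monomial s a) ∈ fil A (wt s + e)) : HasDeg P e := by
  intro d p hp
  rw [MvPolynomial.as_sum p, map_sum]
  refine Submodule.sum_mem _ fun s hs => fil_mono ?_ (h s _)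
  by_contra hc
  exact MvPolynomial.mem_support_iff.1 hs (hp s (by omega))

theorem HasDeg.mono {P : Module.End A (MvPolynomial ℕ A)} {d e : ℤ} (h : HasDeg P d)
    (hde : d ≤ e) : HasDeg P e := fun k p hp => fil_mono (by omega) (h k p hp)

theorem HasDeg.add {P Q : Module.End A (MvPolynomial ℕ A)} {e : ℤ} (hP : HasDeg P e)
    (hQ : HasDeg Q e) : HasDeg (P + Q) e := fun d p hp => add_mem (hP d p hp) (hQ d p hp)

theorem HasDeg.sub {P Q : Module.End A (MvPolynomial ℕ A)} {e : ℤ} (hP : HasDeg P e)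
    (hQ : HasDeg Q e) : HasDeg (P - Q) e := fun d p hp => sub_mem (hP d p hp) (hQ d p hp)

theorem HasDeg.smul {P : Module.End A (MvPolynomial ℕ A)} {e : ℤ} (hP : HasDeg P e) (a : A) :
    HasDeg (a • P) e := fun d p hp => Submodule.smul_mem _ a (hP d p hp)

theorem HasDeg.sum {ι : Type*} {s : Finset ι} {P : ι → Module.End A (MvPolynomial ℕ A)} {e : ℤ}
    (h : ∀ i ∈ s, HasDeg (P i) e) : HasDeg (∑ i ∈ s, P i) e := fun d p hp => by
  rw [LinearMap.sum_apply]
  exact Submodule.sum_mem _ fun i hi => h i hi d p hp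

theorem HasDeg.mul {P Q : Module.End A (MvPolynomial ℕ A)} {d e : ℤ} (hP : HasDeg P d)
    (hQ : HasDeg Q e) : HasDeg (P * Q) (d + e) := fun k p hp => by
  have := hP _ _ (hQ k p hp)
  rwa [add_assoc, add_comm e d] at this

theorem HasDeg.smul_one (a : A) {e : ℤ} (he : 0 ≤ e) :
    HasDeg (a • (1 : Module.End A (MvPolynomial ℕ A))) e :=
  fun d p hp => fil_mono (by omega) (Submodule.smul_mem _ a hp)

theorem HasDeg.mulLeft {q : MvPolynomial ℕ A} {e : ℤ} (hq : q ∈ fil A e) :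
    HasDeg (LinearMap.mulLeft A q) e := fun d p hp => by
  rw [add_comm]
  exact mul_mem_fil hq hp

theorem HasDeg.derivation {D : Derivation A (MvPolynomial ℕ A) (MvPolynomial ℕ A)} {e : ℤ}
    (h : ∀ j : ℕ, D (MvPolynomial.X j) ∈ fil A (j + 1 + e)) :
    HasDeg (D : Module.End A (MvPolynomial ℕ A)) e := by
  refine HasDeg.of_monomial fun s a => ?_
  have hD : D = MvPolynomial.mkDerivation A fun j => D (MvPolynomial.X j) :=
    MvPolynomial.derivation_ext fun i => by rw [MvPolynomial.mkDerivation_X]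
  rw [Derivation.coeFn_coe, hD, MvPolynomial.mkDerivation_monomial]
  refine Submodule.smul_mem _ _ (Submodule.sum_mem _ fun j hj => ?_)
  have h1 : wt (s - Finsupp.single j 1) + (j + 1) = wt s := by
    have h2 : s - Finsupp.single j 1 + Finsupp.single j 1 = s :=
      tsub_add_cancel_of_le (Finsupp.single_le_iff.2
        (Nat.pos_of_ne_zero (Finsupp.mem_support_iff.1 hj)))
    have h3 := congrArg wt h2
    rwa [map_add, wt_single, one_mul] at h3
  have h2 := mul_mem_fil (monomial_mem_fil (d := wt (s - Finsupp.single j 1)) ((s j : A)) le_rfl)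
    (h j)
  refine fil_mono ?_ h2
  push_cast [← h1]; omega

theorem annih_hasDeg (k : ℤ) : HasDeg (annih A k : Module.End A (MvPolynomial ℕ A)) (-k) := by
  refine HasDeg.derivation fun j => ?_
  rw [← xvar_natCast_succ, annih_xvar]
  split_ifs with h
  · rw [← map_intCast (MvPolynomial.C (σ := ℕ) (R := A))]
    exact C_mem_fil _ (by omega)
  · exact zero_mem _

theorem rot_hasDeg (n : ℤ) : HasDeg (rot A n : Module.End A (MvPolynomial ℕ A)) (-n) := by
  refine HasDeg.derivation fun j => ?_
  rw [← xvar_natCast_succ, rot_xvar]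
  split_ifs with h
  · rw [← zero_add ((j : ℤ) + 1 + -n), ← map_intCast (MvPolynomial.C (σ := ℕ) (R := A))]
    exact mul_mem_fil (C_mem_fil _ le_rfl) (xvar_mem_fil (by omega))
  · exact zero_mem _

theorem osc_hasDeg (k : ℤ) : HasDeg (osc A k) (-k) :=
  (annih_hasDeg k).add (HasDeg.mulLeft (xvar_mem_fil le_rfl))

/-- The derivation `rot 0` is the Euler operator of the weighted grading. -/
theorem rot_zero_sub_smul_mem {d : ℤ} {p : MvPolynomial ℕ A} (hp : p ∈ fil A d) :
    rot A 0 p - d • p ∈ fil A (d - 1) := by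
  have h1 : ∀ (s : ℕ →₀ ℕ) (a : A), rot A 0 (MvPolynomial.monomial s a) =
      (wt s : ℤ) • MvPolynomial.monomial s a := by
    intro s a
    induction s using Finsupp.induction generalizing a with
    | zero => simp [MvPolynomial.derivation_C, ← MvPolynomial.C_apply]
    | single_add j n s hj hn ih =>
      have h2 : MvPolynomial.monomial (Finsupp.single j n + s) a =
          MvPolynomial.X j ^ n * MvPolynomial.monomial s a := by
        rw [MvPolynomial.X_pow_eq_monomial, MvPolynomial.monomial_mul, one_mul]
      rw [h2, Derivation.leibniz, ih, Derivation.leibniz_pow, ← xvar_natCast_succ, rot_xvar,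
        if_pos (by omega), map_add, wt_single]
      obtain ⟨n, rfl⟩ := Nat.exists_eq_succ_of_ne_zero hn
      simp only [zsmul_eq_mul, nsmul_eq_mul, smul_eq_mul, sub_zero, Nat.succ_eq_add_one,
        add_tsub_cancel_right]
      push_cast
      ring
  intro s hs
  have h2 : ∀ q : MvPolynomial ℕ A, (rot A 0 q).coeff s = (wt s : A) * q.coeff s := by
    intro q
    induction q using MvPolynomial.induction_on' with
    | monomial t a =>
      rw [h1, zsmul_eq_mul, ← map_intCast (MvPolynomial.C (σ := ℕ) (R := A)),
        MvPolynomial.coeff_C_mul, MvPolynomial.coeff_monomial]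
      split_ifs with h
      · rw [h]; simp
      · simp
    | add p q hp hq => rw [map_add, MvPolynomial.coeff_add, hp, hq, MvPolynomial.coeff_add, mul_add]
  rw [MvPolynomial.coeff_sub, h2, zsmul_eq_mul, ← map_intCast (MvPolynomial.C (σ := ℕ) (R := A)),
    MvPolynomial.coeff_C_mul]
  by_cases h : (wt s : ℤ) = d
  · rw [← h]; simp
  · rw [hp s (by omega)]; simp

theorem derivation_sum_apply {R S ι : Type*} [CommRing R] [CommRing S] [Algebra R S] (t : Finset ι)
    (D : ι → Derivation R S S) (p : S) : (∑ i ∈ t, D i) p = ∑ i ∈ t, D i p := by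
  have := congrFun (map_sum (Derivation.coeFnAddMonoidHom (R := R) (A := S) (M := S)) D t) p
  rw [Finset.sum_apply] at this
  exact this

theorem rot_zero_eq_sum {N : ℕ} {p : MvPolynomial ℕ A} (hp : p ∈ fil A N) :
    rot A 0 p = ∑ j ∈ Finset.range N, MvPolynomial.X j * annih A (j + 1) p := by
  have h1 : rot A 0 p = (∑ j ∈ Finset.range N,
      (MvPolynomial.X j : MvPolynomial ℕ A) • annih A ((j : ℤ) + 1)) p := by
    refine MvPolynomial.derivation_eq_of_forall_mem_vars fun i hi => ?_
    obtain ⟨s, hs, his⟩ := (MvPolynomial.mem_vars_iff_mem_support i).1 hi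
    have hi' : i < N := by
      by_contra hc
      refine MvPolynomial.mem_support_iff.1 hs (hp s ?_)
      have h3 := Finsupp.le_weight_of_ne_zero (w := fun j : ℕ => j + 1) (fun _ => Nat.zero_le _)
        (Finsupp.mem_support_iff.1 his)
      have h4 : i + 1 ≤ wt s := h3
      omega
    rw [← xvar_natCast_succ, rot_xvar, if_pos (by omega), sub_zero, derivation_sum_apply,
      Finset.sum_eq_single i]
    · rw [Derivation.smul_apply, annih_xvar, if_pos ⟨rfl, by omega⟩, xvar_natCast_succ, smul_eq_mul,
        mul_comm]
    · intro j _ hj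
      rw [Derivation.smul_apply, annih_xvar, if_neg (by omega), smul_zero]
    · intro h; exact absurd (Finset.mem_range.2 hi') h
  rw [h1, derivation_sum_apply]
  rfl

end Filtration


/-! ### Irregular vectors and the Poincaré lemma -/

section Whittaker

variable {A : Type*} [CommRing A]

variable [Algebra ℂ A]

theorem mem_fil_of_smul_mem {d e : ℤ} (he : 0 < e) {p : MvPolynomial ℕ A}
    (h : e • p ∈ fil A d) : p ∈ fil A d := by
  obtain ⟨n, rfl⟩ := exists_nat_of_pos he
  intro s hs
  have h1 := h s hs
  rw [zsmul_eq_mul, ← map_intCast (MvPolynomial.C (σ := ℕ) (R := A)),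
    MvPolynomial.coeff_C_mul] at h1
  push_cast at h1
  exact natCast_succ_mul_eq_zero n h1

/-- By Euler's identity, the top weight component of a polynomial is determined by its
partial derivatives. -/
theorem mem_fil_sub_one_of_annih {N : ℕ} (hN : 0 < N) {p : MvPolynomial ℕ A} (hp : p ∈ fil A N)
    (h : ∀ j : ℕ, annih A (j + 1) p ∈ fil A (N - (j + 1) - 1)) : p ∈ fil A (N - 1) := by
  refine mem_fil_of_smul_mem (e := N) (by omega) ?_
  have h1 : rot A 0 p ∈ fil A (N - 1) := by
    rw [rot_zero_eq_sum hp]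
    refine Submodule.sum_mem _ fun j _ => ?_
    rw [← xvar_natCast_succ]
    have := mul_mem_fil (xvar_mem_fil (A := A) (le_refl ((j : ℤ) + 1))) (h j)
    refine fil_mono ?_ this
    omega
  have h2 := sub_mem h1 (rot_zero_sub_smul_mem hp)
  rwa [sub_sub_cancel] at h2

theorem quad_hasDeg (n : ℤ) : HasDeg (quad A n) (-n) := by
  refine HasDeg.smul (HasDeg.sum fun i _ => ?_) _
  exact ((osc_hasDeg i).mul (osc_hasDeg (n - i))).mono (by omega)

theorem vir0_hasDeg (ρ : ℂ) (n : ℤ) : HasDeg (vir0 A ρ n) (-n) :=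
  ((rot_hasDeg n).add (quad_hasDeg n)).sub ((osc_hasDeg n).smul _)

variable (ρ : ℂ) (r : ℕ) (lam : ℕ → A)

/-- Up to operators of lower degree, `L_n` acts as `Λ_n + λ_r a_{n-r}`. -/
theorem vir_sub_hasDeg (hr : 1 ≤ r) (n : ℤ) :
    HasDeg (vir ρ r lam n - ell ρ r lam n • 1 - lam r • osc A (n - r)) (r - n - 1) := by
  have h : vir ρ r lam n - ell ρ r lam n • 1 - lam r • osc A (n - r) =
      vir0 A ρ n + ∑ i ∈ Finset.range r, lam i • osc A (n - i) := by
    rw [vir, Finset.sum_range_succ]; abel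
  rw [h]
  refine ((vir0_hasDeg ρ n).mono (by omega)).add (HasDeg.sum fun i hi => ?_)
  rw [Finset.mem_range] at hi
  exact ((osc_hasDeg _).smul _).mono (by omega)

theorem vir_hasDeg (hr : 1 ≤ r) {n e : ℤ} (h1 : r - n ≤ e) (h2 : 0 ≤ e ∨ 2 * r < n) :
    HasDeg (vir ρ r lam n) e := by
  have h : vir ρ r lam n = (vir ρ r lam n - ell ρ r lam n • 1 - lam r • osc A (n - r)) +
      lam r • osc A (n - r) + ell ρ r lam n • 1 := by abel
  rw [h]
  refine (((vir_sub_hasDeg ρ r lam hr n).mono (by omega)).add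
    (((osc_hasDeg _).smul _).mono (by omega))).add ?_
  rcases h2 with h2 | h2
  · exact HasDeg.smul_one _ h2
  · rw [ell_eq_zero ρ r lam h2]
    intro d p _
    simp

/-- The operators `L_{r+k} - Λ_{r+k}`, `k ≥ 0`, which annihilate the irregular vector. -/
noncomputable def whit (k : ℕ) : Module.End A (MvPolynomial ℕ A) :=
  vir ρ r lam (r + k) - ell ρ r lam (r + k) • 1

theorem whit_sub_hasDeg (hr : 1 ≤ r) (k : ℕ) :
    HasDeg (whit ρ r lam k - lam r • (annih A k : Module.End A (MvPolynomial ℕ A))) (-k - 1) := by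
  have h : (annih A k : Module.End A (MvPolynomial ℕ A)) = osc A ((r : ℤ) + k - r) := by
    apply LinearMap.ext; intro p
    rw [add_sub_cancel_left, osc_of_nonneg (by omega)]; rfl
  rw [h, whit]
  exact (vir_sub_hasDeg ρ r lam hr _).mono (by omega)

theorem whit_hasDeg (hr : 1 ≤ r) (k : ℕ) : HasDeg (whit ρ r lam k) (-k) := by
  have h : whit ρ r lam k = (whit ρ r lam k - lam r • (annih A k : Module.End A _)) +
      lam r • (annih A k : Module.End A _) := by abel
  rw [h]
  exact ((whit_sub_hasDeg ρ r lam hr k).mono (by omega)).add ((annih_hasDeg _).smul _)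

theorem whit_one (k : ℕ) : whit ρ r lam k 1 = 0 := by
  rw [whit, LinearMap.sub_apply, vir_one ρ r lam (by omega)]
  simp

/-- The operators `L_{r+k} - Λ_{r+k}` form a Lie algebra: the scalars do not enter the commutators,
as `Λ_{2r+k+l} = 0` unless `k = l = 0`. -/
theorem lie_whit (hr : 1 ≤ r) (k l : ℕ) :
    ⁅whit ρ r lam k, whit ρ r lam l⁆ = ((k : ℤ) - l) • whit ρ r lam (r + k + l) := by
  rw [whit, whit, sub_rlie, rlie_sub, rlie_smul_one, smul_one_rlie, lie_vir, if_neg (by omega),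
    whit]
  have h1 : (r : ℤ) + k + (r + l) = r + (r + k + l : ℕ) := by push_cast; ring
  have h2 : ((k : ℤ) - l) • ell ρ r lam (r + (r + k + l : ℕ)) = 0 := by
    by_cases h : k = l
    · subst h; simp
    · rw [ell_eq_zero ρ r lam (by push_cast; omega), smul_zero]
  rw [← h1] at h2 ⊢
  apply LinearMap.ext; intro p
  simp only [LinearMap.sub_apply, LinearMap.smul_apply,
    Module.End.one_apply, zero_smul, sub_zero, add_zero]
  rw [smul_sub, ← smul_assoc ((k : ℤ) - l), h2, zero_smul, sub_zero]
  congr 1; omega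

variable {lamInv : A} (hlam : lam r * lamInv = 1)
include hlam

/-- The irregular vectors in the Fock space are the constants. -/
theorem eq_C_of_whit_eq_zero (hr : 1 ≤ r) {p : MvPolynomial ℕ A}
    (h : ∀ k : ℕ, whit ρ r lam (k + 1) p = 0) :
    p = MvPolynomial.C (MvPolynomial.constantCoeff p) := by
  obtain ⟨N, hN⟩ := exists_mem_fil p
  induction N with
  | zero => exact eq_C_of_mem_fil_zero (by simpa using hN)
  | succ N ih =>
    refine ih ?_
    have := mem_fil_sub_one_of_annih (Nat.succ_pos N) hN ?_
    · simpa using this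
    intro j
    have h1 := whit_sub_hasDeg ρ r lam hr (j + 1) _ p hN
    rw [LinearMap.sub_apply, h j, zero_sub, LinearMap.smul_apply, neg_mem_iff] at h1
    have h2 := Submodule.smul_mem _ lamInv h1
    rw [smul_smul, mul_comm, hlam, one_smul] at h2
    refine fil_mono ?_ h2
    push_cast; omega

/-- Poincaré lemma: the graded pieces of the equations `(L_{r+k} - Λ_{r+k}) x = e_k` are
`λ_r k ∂x/∂x_k = e_k`, whose integrability is the cocycle condition. -/
theorem exists_whit_eq_succ (hr : 1 ≤ r) (N : ℕ) (e : ℕ → MvPolynomial ℕ A)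
    (hdeg : ∀ k : ℕ, e (k + 1) ∈ fil A (N - (k + 1)))
    (hcoc : ∀ k l : ℕ, whit ρ r lam (k + 1) (e (l + 1)) - whit ρ r lam (l + 1) (e (k + 1)) =
      ((k : ℤ) - l) • e (r + k + l + 1 + 1)) :
    ∃ x ∈ fil A N, ∀ k : ℕ, whit ρ r lam (k + 1) x = e (k + 1) := by
  induction N generalizing e with
  | zero =>
    refine ⟨0, zero_mem _, fun k => ?_⟩
    rw [map_zero, eq_zero_of_mem_fil_neg _ (hdeg k)]
    push_cast; omega
  | succ N ih =>
    -- Euler's formula for a primitive of the closed form given by the leading terms of the `e k`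
    set y : MvPolynomial ℕ A := (algebraMap ℂ A ((N : ℂ) + 1)⁻¹ * lamInv) •
      ∑ j ∈ Finset.range (N + 1), MvPolynomial.X j * e (j + 1) with hy
    have hyN : y ∈ fil A (N + 1 : ℕ) := by
      refine Submodule.smul_mem _ _ (Submodule.sum_mem _ fun j _ => ?_)
      rw [← xvar_natCast_succ]
      refine fil_mono ?_ (mul_mem_fil (xvar_mem_fil (le_refl ((j : ℤ) + 1))) (hdeg j))
      push_cast; omega
    have hcl : ∀ j k : ℕ, annih A (j + 1) (e (k + 1)) - annih A (k + 1) (e (j + 1)) ∈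
        fil A (N - j - k - 2) := by
      intro j k
      have h1 := whit_sub_hasDeg ρ r lam hr (j + 1) _ _ (hdeg k)
      have h2 := whit_sub_hasDeg ρ r lam hr (k + 1) _ _ (hdeg j)
      have h3 : ((j : ℤ) - k) • e (r + j + k + 1 + 1) ∈
          fil A (N - j - k - 2) :=
        zsmul_mem (fil_mono (by push_cast; omega) (hdeg _)) _
      rw [← hcoc] at h3
      rw [LinearMap.sub_apply] at h1 h2
      have h4 := sub_mem (sub_mem h3 (fil_mono (by push_cast; omega) h1))
        (neg_mem (fil_mono (by push_cast; omega) h2) :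
          -(_ : MvPolynomial ℕ A) ∈ fil A ((N : ℤ) - j - k - 2))
      have h5 := Submodule.smul_mem _ lamInv h4
      convert h5 using 1
      simp only [LinearMap.smul_apply, Derivation.coeFn_coe]
      have h6 : ∀ q : MvPolynomial ℕ A, q = lamInv • lam r • q := fun q => by
        rw [smul_smul, mul_comm, hlam, one_smul]
      rw [h6 (annih A (j + 1) (e (k + 1)) - annih A (k + 1) (e (j + 1)))]
      push_cast
      module
    have hann : ∀ k : ℕ, lam r • annih A (k + 1) y - e (k + 1) ∈ fil A (N - (k + 1)) := by
      intro k
      have h1 : annih A (k + 1) (∑ j ∈ Finset.range (N + 1), MvPolynomial.X j * e (j + 1)) -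
          ((N : ℤ) + 1) • e (k + 1) ∈ fil A (N - (k + 1)) := by
        have h2 : ∑ j ∈ Finset.range (N + 1), annih A (k + 1) (MvPolynomial.X j) * e (j + 1) =
            ((k : ℤ) + 1) • e (k + 1) := by
          by_cases hk : k ≤ N
          · rw [Finset.sum_eq_single k]
            · rw [← xvar_natCast_succ, annih_xvar, if_pos ⟨rfl, by omega⟩, zsmul_eq_mul]
            · intro j _ hj
              rw [← xvar_natCast_succ, annih_xvar, if_neg (by omega), zero_mul]
            · intro h; exact absurd (Finset.mem_range.2 (by omega)) h
          · rw [eq_zero_of_mem_fil_neg _ (hdeg k), smul_zero]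
            · refine Finset.sum_eq_zero fun j hj => ?_
              rw [Finset.mem_range] at hj
              rw [← xvar_natCast_succ, annih_xvar, if_neg (by omega), zero_mul]
            · push_cast; omega
        have h3 := rot_zero_eq_sum (fil_mono (by push_cast; omega) (hdeg k) :
          e (k + 1) ∈ fil A (N + 1 : ℕ))
        have h4 := rot_zero_sub_smul_mem (hdeg k)
        have h5 : ∑ j ∈ Finset.range (N + 1), MvPolynomial.X j *
            (annih A (j + 1) (e (k + 1)) - annih A (k + 1) (e (j + 1))) ∈
              fil A (N - (k + 1)) := by
          refine Submodule.sum_mem _ fun j _ => ?_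
          rw [← xvar_natCast_succ]
          refine fil_mono ?_ (mul_mem_fil (xvar_mem_fil (le_refl ((j : ℤ) + 1))) (hcl j k))
          omega
        have h6 := sub_mem (fil_mono (by push_cast; omega) h4 :
          _ ∈ fil A ((N : ℤ) - (k + 1))) h5
        convert h6 using 1
        have h7 : annih A (k + 1) (∑ j ∈ Finset.range (N + 1), MvPolynomial.X j * e (j + 1)) =
            ((k : ℤ) + 1) • e (k + 1) + ∑ j ∈ Finset.range (N + 1), MvPolynomial.X j *
              annih A (k + 1) (e (j + 1)) := by
          rw [← h2, map_sum, ← Finset.sum_add_distrib]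
          refine Finset.sum_congr rfl fun j _ => ?_
          rw [Derivation.leibniz, smul_eq_mul, smul_eq_mul]; ring
        simp only [mul_sub, Finset.sum_sub_distrib]
        rw [h7, ← h3]
        simp only [zsmul_eq_mul]
        push_cast; ring
      have h2 := Submodule.smul_mem _ (algebraMap ℂ A ((N : ℂ) + 1)⁻¹) h1
      convert h2 using 1
      have h3 : algebraMap ℂ A ((N : ℂ) + 1)⁻¹ • ((N : ℤ) + 1) • e (k + 1) = e (k + 1) := by
        rw [← Int.cast_smul_eq_zsmul A, smul_smul, ← map_intCast (algebraMap ℂ A), ← map_mul]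
        rw [Int.cast_add, Int.cast_natCast, Int.cast_one,
          inv_mul_cancel₀ (Nat.cast_add_one_ne_zero N), map_one, one_smul]
      rw [smul_sub, h3, hy, Derivation.map_smul, smul_smul]
      congr 2
      linear_combination algebraMap ℂ A ((N : ℂ) + 1)⁻¹ * hlam
    have hdeg' : ∀ k : ℕ, e (k + 1) - whit ρ r lam (k + 1) y ∈ fil A (N - (k + 1)) := by
      intro k
      have h1 := whit_sub_hasDeg ρ r lam hr (k + 1) _ _ hyN
      rw [LinearMap.sub_apply, LinearMap.smul_apply, Derivation.coeFn_coe] at h1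
      have h3 := neg_mem (add_mem (fil_mono (by push_cast; omega) h1) (hann k))
      convert h3 using 1
      push_cast
      abel
    have hcoc' : ∀ k l : ℕ, whit ρ r lam (k + 1) (e (l + 1) - whit ρ r lam (l + 1) y) -
        whit ρ r lam (l + 1) (e (k + 1) - whit ρ r lam (k + 1) y) =
        ((k : ℤ) - l) • (e (r + k + l + 1 + 1) - whit ρ r lam (r + k + l + 1 + 1) y) := by
      intro k l
      have h1 := congrArg (fun T : Module.End A (MvPolynomial ℕ A) => T y)
        (lie_whit ρ r lam hr (k + 1) (l + 1))
      simp only [Ring.lie_def, LinearMap.sub_apply, Module.End.mul_apply,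
        LinearMap.smul_apply] at h1
      rw [map_sub, map_sub, smul_sub, ← hcoc]
      have h2 : ((k : ℤ) - l) • whit ρ r lam (r + k + l + 1 + 1) y =
          (((k + 1 : ℕ) : ℤ) - (l + 1 : ℕ)) • whit ρ r lam (r + (k + 1) + (l + 1)) y := by
        rw [show r + (k + 1) + (l + 1) = r + k + l + 1 + 1 by ring]
        congr 1; push_cast; ring
      rw [h2, ← h1]
      abel
    obtain ⟨x, hx, hxe⟩ := ih (fun k => e k - whit ρ r lam k y) hdeg' hcoc'
    refine ⟨x + y, add_mem (fil_mono (by omega) hx) hyN, fun k => ?_⟩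
    rw [map_add, hxe, sub_add_cancel]

/-- The equations `(L_{r+k} - Λ_{r+k}) x = e_k`, `k ≥ 0`, have a single scalar obstruction,
which sits in the equation `k = 0`. -/
theorem exists_whit_eq (hr : 1 ≤ r) (N : ℕ) (e : ℕ → MvPolynomial ℕ A)
    (hdeg : ∀ k : ℕ, e k ∈ fil A (N - k))
    (hcoc : ∀ k l : ℕ, whit ρ r lam k (e l) - whit ρ r lam l (e k) =
      ((k : ℤ) - l) • e (r + k + l)) :
    ∃ x ∈ fil A N, ∃ u : A, whit ρ r lam 0 x = e 0 + MvPolynomial.C u ∧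
      ∀ k : ℕ, whit ρ r lam (k + 1) x = e (k + 1) := by
  obtain ⟨x, hx, hxe⟩ := exists_whit_eq_succ ρ r lam hlam hr N e
    (fun k => by simpa using hdeg (k + 1))
    (fun k l => by
      rw [hcoc, show r + (k + 1) + (l + 1) = r + k + l + 1 + 1 by ring]
      congr 1; push_cast; ring)
  refine ⟨x, hx, MvPolynomial.constantCoeff (whit ρ r lam 0 x - e 0), ?_, hxe⟩
  rw [← eq_C_of_whit_eq_zero ρ r lam hlam hr, add_sub_cancel]
  intro k
  have h1 := congrArg (fun T : Module.End A (MvPolynomial ℕ A) => T x)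
    (lie_whit ρ r lam hr (k + 1) 0)
  simp only [Ring.lie_def, LinearMap.sub_apply, Module.End.mul_apply, LinearMap.smul_apply] at h1
  have h2 := hcoc (k + 1) 0
  rw [hxe k, show r + (k + 1) + 0 = r + k + 1 by ring, hxe (r + k)] at h1
  rw [show r + (k + 1) + 0 = r + k + 1 by ring] at h2
  rw [← h1, sub_left_inj] at h2
  rw [map_sub, h2, sub_self]

end Whittaker


/-! ### Representations and the universal property -/

section Representations

variable {A : Type*} [CommRing A] [Algebra ℂ A] {c : ℂ} {N : Type*} [AddCommGroup N] [Module A N]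

/-- The operators `ℓ n` on `N` satisfy the relations of the Virasoro algebra at central
charge `c`. -/
def IsVir (c : ℂ) (ℓ : ℤ → Module.End A N) : Prop :=
  ∀ m n, ℓ m * ℓ n - ℓ n * ℓ m = (m - n) • ℓ (m + n) +
    (if m + n = 0 then algebraMap ℂ A (((m : ℂ) ^ 3 - m) / 12 * c) else 0) • 1

/-- The representation defined by operators satisfying the Virasoro relations. -/
noncomputable def virRep {ℓ : ℤ → Module.End A N} (h : IsVir c ℓ) : Vir A c →ₐ[A] Module.End A N :=
  RingQuot.liftAlgHom A ⟨FreeAlgebra.lift A ℓ, by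
    rintro _ _ ⟨m, n⟩
    simp only [map_sub, map_mul, map_add, FreeAlgebra.lift_ι_apply, map_zsmul]
    rw [h m n]
    congr 1
    split_ifs
    · rw [← map_mul (algebraMap A (FreeAlgebra A ℤ)), ← map_mul (algebraMap ℂ A),
        AlgHom.commutes, Algebra.algebraMap_eq_smul_one (A := Module.End A N)]
    · simp⟩

theorem virRep_L {ℓ : ℤ → Module.End A N} (h : IsVir c ℓ) (n : ℤ) : virRep h (L A c n) = ℓ n := by
  simp [virRep, L]

/-- A map out of an irregular Verma module is given by a vector satisfying the defining equations
of the irregular vector. -/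
noncomputable def irrLift {ℓ : ℤ → Module.End A N} (h : IsVir c ℓ) {r : ℕ} {Λ : ℕ → A} (w : N)
    (hw : ∀ n : ℕ, r ≤ n → ℓ n w = Λ n • w) : IrrVerma A c r Λ →ₗ[A] N :=
  (Submodule.liftQ ((irrIdeal A c r Λ).restrictScalars A)
    ((LinearMap.applyₗ w).comp (virRep h).toLinearMap) (by
      intro x hx
      rw [Submodule.restrictScalars_mem] at hx
      change virRep h x w = 0
      induction hx using Submodule.span_induction with
      | mem x hx =>
        obtain ⟨n, hn, rfl⟩ := hx
        rw [map_sub, AlgHom.commutes, virRep_L, LinearMap.sub_apply, hw n hn,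
          Module.algebraMap_end_apply, sub_self]
      | zero => simp
      | add x y _ _ hx hy => rw [map_add, LinearMap.add_apply, hx, hy, add_zero]
      | smul a x _ hx => rw [smul_eq_mul, map_mul, Module.End.mul_apply, hx, map_zero])).comp
    (Submodule.Quotient.restrictScalarsEquiv A (irrIdeal A c r Λ)).symm.toLinearMap

section

variable {ℓ : ℤ → Module.End A N} (h : IsVir c ℓ) {r : ℕ} {Λ : ℕ → A} (w : N)
    (hw : ∀ n : ℕ, r ≤ n → ℓ n w = Λ n • w)

theorem irrLift_mk (u : Vir A c) : irrLift h w hw (Submodule.Quotient.mk u) = virRep h u w := rfl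

theorem irrLift_irrVec : irrLift h w hw (irrVec A c r Λ) = w := by
  rw [irrVec, irrLift_mk, map_one]; rfl

theorem irrLift_smul (u : Vir A c) (x : IrrVerma A c r Λ) :
    irrLift h w hw (u • x) = virRep h u (irrLift h w hw x) := by
  obtain ⟨y, rfl⟩ := Submodule.Quotient.mk_surjective _ x
  rw [← Submodule.Quotient.mk_smul, irrLift_mk, irrLift_mk, smul_eq_mul, map_mul]; rfl

theorem irrLift_L (n : ℤ) (x : IrrVerma A c r Λ) :
    irrLift h w hw (L A c n • x) = ℓ n (irrLift h w hw x) := by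
  rw [irrLift_smul, virRep_L]

end

theorem irrVerma_induction {r : ℕ} {Λ : ℕ → A} (p : Submodule A (IrrVerma A c r Λ))
    (h1 : irrVec A c r Λ ∈ p) (h2 : ∀ (n : ℤ), ∀ x ∈ p, L A c n • x ∈ p)
    (x : IrrVerma A c r Λ) : x ∈ p := by
  have key : ∀ u : FreeAlgebra A ℤ, ∀ x ∈ p, RingQuot.mkAlgHom A (VirRel A c) u • x ∈ p := by
    intro u
    induction u using FreeAlgebra.induction with
    | grade0 a =>
      intro x hx
      rw [AlgHom.commutes, algebraMap_smul]
      exact p.smul_mem a hx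
    | grade1 n => exact h2 n
    | mul a b ha hb =>
      intro x hx
      rw [map_mul, mul_smul]
      exact ha _ (hb x hx)
    | add a b ha hb =>
      intro x hx
      rw [map_add, add_smul]
      exact add_mem (ha x hx) (hb x hx)
  obtain ⟨y, rfl⟩ := Submodule.Quotient.mk_surjective _ x
  obtain ⟨u, rfl⟩ := RingQuot.mkAlgHom_surjective A (VirRel A c) y
  have := key u _ h1
  rwa [irrVec, ← Submodule.Quotient.mk_smul, smul_eq_mul, mul_one] at this

theorem L_smul_irrVec {r : ℕ} {Λ : ℕ → A} {n : ℕ} (hn : r ≤ n) :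
    L A c n • irrVec A c r Λ = Λ n • irrVec A c r Λ := by
  have h1 : L A c n • irrVec A c r Λ = Submodule.Quotient.mk (L A c n) := by
    rw [irrVec, ← Submodule.Quotient.mk_smul, smul_eq_mul, mul_one]
  have h2 : Λ n • irrVec A c r Λ = Submodule.Quotient.mk (algebraMap A (Vir A c) (Λ n)) := by
    rw [Algebra.algebraMap_eq_smul_one]; rfl
  rw [h1, h2, Submodule.Quotient.eq]
  exact Submodule.subset_span ⟨n, hn, rfl⟩

theorem L_mul_L (m n : ℤ) : L A c m * L A c n = L A c n * L A c m + (m - n) • L A c (m + n) +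
    (if m + n = 0 then algebraMap A (Vir A c) (algebraMap ℂ A (((m : ℂ) ^ 3 - m) / 12 * c))
      else 0) := by
  have := RingQuot.mkAlgHom_rel A (VirRel.comm (A := A) (c := c) m n)
  rw [map_sub, map_mul, map_mul, map_add, map_zsmul, sub_eq_iff_eq_add] at this
  rw [L, L, this, L]
  have h2 : RingQuot.mkAlgHom A (VirRel A c) (if m + n = 0 then
      algebraMap A (FreeAlgebra A ℤ) (algebraMap ℂ A (((m : ℂ) ^ 3 - m) / 12 * c)) else 0) =
      if m + n = 0 then algebraMap A (Vir A c) (algebraMap ℂ A (((m : ℂ) ^ 3 - m) / 12 * c))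
      else 0 := by
    split_ifs
    · rw [AlgHom.commutes]
    · simp
  rw [h2]; abel

end Representations

/-! ### Spanning vectors of the irregular Verma module -/

section Spanning

variable {A : Type*} [CommRing A] [Algebra ℂ A] {c : ℂ} {r : ℕ} {Λ : ℕ → A}

variable (A c r) in
/-- The product `L_{-μ}` for a multiset `μ` of natural numbers. -/
noncomputable def Lmon (t : Multiset ℕ) : Vir A c :=
  ((t.sort (· ≥ ·)).map fun i : ℕ => L A c ((r : ℤ) - (i : ℤ))).prod

theorem Lmon_cons {a : ℕ} {t : Multiset ℕ} (h : ∀ b ∈ t, a ≥ b) :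
    Lmon A c r (a ::ₘ t) = L A c (r - a) * Lmon A c r t := by
  rw [Lmon, Multiset.sort_cons a t (r := (· ≥ ·)) h, List.map_cons, List.prod_cons, Lmon]

variable (A c r Λ) in
/-- The span of the vectors `L_{-μ}|Λ⟩` with `|μ| ≤ d`. -/
noncomputable def monSpan (d : ℕ) : Submodule A (IrrVerma A c r Λ) :=
  Submodule.span A {x | ∃ t : Multiset ℕ, (∀ i ∈ t, 0 < i) ∧ t.sum ≤ d ∧
    x = Lmon A c r t • irrVec A c r Λ}

theorem monSpan_mono {d e : ℕ} (h : d ≤ e) : monSpan A c r Λ d ≤ monSpan A c r Λ e :=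
  Submodule.span_mono fun _ ⟨t, h1, h2, h3⟩ => ⟨t, h1, h2.trans h, h3⟩

/-- Reordering of products of the `L_n` does not increase the degree, where `L_n` counts with
degree `r - n` for `n ≤ r`, and with degree `0` for `n ≥ r`. -/
theorem L_smul_mem_monSpan (d : ℕ) : ∀ (n : ℤ), ∀ x ∈ monSpan A c r Λ d,
    L A c n • x ∈ monSpan A c r Λ (d + ((r : ℤ) - n).toNat) := by
  induction d using Nat.strong_induction_on with
  | _ d ih =>
  intro n x hx
  induction hx using Submodule.span_induction with
  | zero => rw [smul_zero]; exact zero_mem _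
  | add x y _ _ hx hy => rw [smul_add]; exact add_mem hx hy
  | smul a x _ hx => rw [smul_comm]; exact Submodule.smul_mem _ a hx
  | mem x hx =>
    obtain ⟨t, ht, htd, rfl⟩ := hx
    by_cases ht0 : t = 0
    · subst ht0
      have h1 : Lmon A c r 0 = 1 := by simp [Lmon]
      rw [h1, one_smul]
      by_cases hn : (r : ℤ) ≤ n
      · obtain ⟨k, rfl⟩ := Int.eq_ofNat_of_zero_le (show 0 ≤ n by omega)
        rw [L_smul_irrVec (by omega)]
        refine Submodule.smul_mem _ _ (Submodule.subset_span ⟨0, by simp, by simp, ?_⟩)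
        rw [h1, one_smul]
      · refine Submodule.subset_span ⟨{((r : ℤ) - n).toNat}, ?_, ?_, ?_⟩
        · intro i hi
          rw [Multiset.mem_singleton] at hi
          omega
        · simp
        · rw [← Multiset.cons_zero, Lmon_cons (by simp), h1, mul_one]
          congr 2; omega
    · have hl : t.sort (· ≥ ·) ≠ [] := by
        intro h
        have h2 := Multiset.sort_eq t (· ≥ ·)
        rw [h] at h2
        exact ht0 h2.symm
      obtain ⟨a, l, hal⟩ := List.exists_cons_of_ne_nil hl
      have hta : t = a ::ₘ (l : Multiset ℕ) := by
        rw [← Multiset.sort_eq t (· ≥ ·), hal]; rfl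
      have hle : ∀ b ∈ (l : Multiset ℕ), a ≥ b := by
        have := Multiset.pairwise_sort t (· ≥ ·)
        rw [hal, List.pairwise_cons] at this
        exact this.1
      have hap : 0 < a := ht a (by rw [hta]; simp)
      have hsum : a + (l : Multiset ℕ).sum ≤ d := by rwa [hta, Multiset.sum_cons] at htd
      -- `L_n` is either the first factor of an ordered product, or it is commuted past `L_{r-a}`
      by_cases hna : (a : ℤ) ≤ r - n
      · refine Submodule.subset_span ⟨((r : ℤ) - n).toNat ::ₘ t, ?_, ?_, ?_⟩
        · intro i hi
          rw [Multiset.mem_cons] at hi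
          rcases hi with rfl | hi
          · omega
          · exact ht i hi
        · rw [Multiset.sum_cons]; omega
        · rw [Lmon_cons, mul_smul]
          · congr 2; omega
          · intro b hb
            rw [hta, Multiset.mem_cons] at hb
            rcases hb with rfl | hb
            · omega
            · have := hle b hb; omega
      · set y := Lmon A c r (l : Multiset ℕ) • irrVec A c r Λ with hy
        have hyd : y ∈ monSpan A c r Λ (d - a) :=
          Submodule.subset_span ⟨l, fun i hi => ht i (by rw [hta]; simp [Multiset.mem_coe.1 hi]),
            by omega, rfl⟩
        have hLt : Lmon A c r t • irrVec A c r Λ = L A c (r - a) • y := by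
          conv_lhs => rw [hta]
          rw [Lmon_cons hle, mul_smul]
        rw [hLt, ← mul_smul, L_mul_L, add_smul, add_smul, mul_smul]
        refine add_mem (add_mem ?_ ?_) ?_
        · have h1 := ih (d - a) (by omega) n y hyd
          have h2 := ih _ (by omega) (r - a) _ h1
          exact monSpan_mono (by omega) h2
        · rw [smul_assoc]
          refine zsmul_mem ?_ _
          exact monSpan_mono (by omega) (ih (d - a) (by omega) (n + (r - a)) y hyd)
        · split_ifs
          · rw [algebraMap_smul]
            exact Submodule.smul_mem _ _ (monSpan_mono (by omega) hyd)
          · rw [zero_smul]; exact zero_mem _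

/-- The vectors `L_{-μ}|Λ⟩` span the irregular Verma module. -/
theorem span_Lmon (x : IrrVerma A c r Λ) :
    x ∈ Submodule.span A {x | ∃ t : Multiset ℕ, (∀ i ∈ t, 0 < i) ∧
      x = Lmon A c r t • irrVec A c r Λ} := by
  have hle : ∀ d, monSpan A c r Λ d ≤ Submodule.span A {x | ∃ t : Multiset ℕ, (∀ i ∈ t, 0 < i) ∧
      x = Lmon A c r t • irrVec A c r Λ} := fun d =>
    Submodule.span_mono fun _ ⟨t, h1, _, h3⟩ => ⟨t, h1, h3⟩
  have h0 : irrVec A c r Λ ∈ monSpan A c r Λ 0 :=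
    Submodule.subset_span ⟨0, by simp, by simp, by simp [Lmon]⟩
  refine irrVerma_induction _ (hle 0 h0) ?_ x
  intro n x hx
  induction hx using Submodule.span_induction with
  | zero => rw [smul_zero]; exact zero_mem _
  | add x y _ _ hx hy => rw [smul_add]; exact add_mem hx hy
  | smul a x _ hx => rw [smul_comm]; exact Submodule.smul_mem _ a hx
  | mem x hx =>
    obtain ⟨t, ht, rfl⟩ := hx
    exact hle _ (L_smul_mem_monSpan t.sum n _ (Submodule.subset_span ⟨t, ht, le_rfl, rfl⟩))

end Spanning


/-! ### Monomials and partitions -/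

section Scale

variable {A : Type*} [CommRing A]

/-- The partition with `s j` parts equal to `j + 1`, for the exponent `s` of a monomial. -/
noncomputable def expParts (s : ℕ →₀ ℕ) : Multiset ℕ := (Finsupp.toMultiset s).map (· + 1)

theorem expParts_pos (s : ℕ →₀ ℕ) : ∀ i ∈ expParts s, 0 < i := by
  intro i hi
  rw [expParts, Multiset.mem_map] at hi
  obtain ⟨j, _, rfl⟩ := hi
  omega

theorem expParts_add (s t : ℕ →₀ ℕ) : expParts (s + t) = expParts s + expParts t := by
  simp [expParts]

theorem expParts_single (j n : ℕ) :
    expParts (Finsupp.single j n) = Multiset.replicate n (j + 1) := by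
  simp [expParts, Finsupp.toMultiset_single, Multiset.nsmul_singleton]

theorem expParts_sum (s : ℕ →₀ ℕ) : (expParts s).sum = wt s := by
  induction s using Finsupp.induction with
  | zero => simp [expParts]
  | single_add j n s _ _ ih =>
    rw [expParts_add, Multiset.sum_add, ih, expParts_single, map_add, wt_single,
      Multiset.sum_replicate, smul_eq_mul]

theorem exists_expParts {t : Multiset ℕ} (ht : ∀ i ∈ t, 0 < i) : ∃ s, expParts s = t := by
  refine ⟨Multiset.toFinsupp (t.map (· - 1)), ?_⟩
  rw [expParts, Multiset.toFinsupp_toMultiset, Multiset.map_map]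
  conv_rhs => rw [← Multiset.map_id t]
  refine Multiset.map_congr rfl fun i hi => ?_
  have := ht i hi
  simp; omega

theorem prod_xvar_expParts (s : ℕ →₀ ℕ) :
    ((expParts s).map fun i : ℕ => xvar A i).prod = MvPolynomial.monomial s 1 := by
  induction s using Finsupp.induction with
  | zero => simp [expParts]
  | single_add j n s _ _ ih =>
    rw [expParts_add, Multiset.map_add, Multiset.prod_add, ih, expParts_single,
      Multiset.map_replicate, Multiset.prod_replicate, Nat.cast_succ, xvar_natCast_succ,
      MvPolynomial.X_pow_eq_monomial, MvPolynomial.monomial_mul, one_mul]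

theorem monomial_eq_smul_basisMonomials (s : ℕ →₀ ℕ) (a : A) :
    (MvPolynomial.monomial s a : MvPolynomial ℕ A) = a • MvPolynomial.basisMonomials ℕ A s := by
  rw [MvPolynomial.coe_basisMonomials, MvPolynomial.smul_monomial, smul_eq_mul, mul_one]

/-- The linear map rescaling each monomial `x_μ` by `t^{ℓ(μ)}`. -/
noncomputable def scaleMap (t : A) : Module.End A (MvPolynomial ℕ A) :=
  (MvPolynomial.basisMonomials ℕ A).constr A fun s =>
    MvPolynomial.monomial s (t ^ (expParts s).card)

theorem scaleMap_monomial (t : A) (s : ℕ →₀ ℕ) (a : A) :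
    scaleMap t (MvPolynomial.monomial s a) =
      MvPolynomial.monomial s (a * t ^ (expParts s).card) := by
  rw [monomial_eq_smul_basisMonomials, map_smul, scaleMap, Module.Basis.constr_basis, MvPolynomial.smul_monomial, smul_eq_mul]

theorem scaleMap_hasDeg (t : A) : HasDeg (scaleMap t) 0 := by
  refine HasDeg.of_monomial fun s a => ?_
  rw [scaleMap_monomial]
  exact monomial_mem_fil _ (by simp)

theorem scaleMap_scaleMap {t u : A} (h : t * u = 1) (p : MvPolynomial ℕ A) :
    scaleMap t (scaleMap u p) = p := by
  induction p using MvPolynomial.induction_on' with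
  | monomial s a =>
    rw [scaleMap_monomial, scaleMap_monomial, mul_assoc, ← mul_pow, mul_comm u, h, one_pow, mul_one]
  | add p q hp hq => rw [map_add, map_add, hp, hq]

end Scale

/-! ### The Fock space as an irregular Verma module -/

section FockIso

variable {A : Type*} [CommRing A] [Algebra ℂ A] (ρ : ℂ) (r : ℕ) (lam : ℕ → A)

theorem isVir_vir : IsVir (1 - 12 * ρ ^ 2) (vir ρ r lam) := fun m n => lie_vir ρ r lam m n

/-- The vector `L_{-μ} · 1` of the Fock space. -/
noncomputable def fockMon (t : Multiset ℕ) : MvPolynomial ℕ A :=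
  virRep (isVir_vir ρ r lam) (Lmon A (1 - 12 * ρ ^ 2) r t) 1

theorem vir_creation_hasDeg (hr : 1 ≤ r) {i : ℕ} (hi : 0 < i) :
    HasDeg (vir ρ r lam (r - i) - lam r • LinearMap.mulLeft A (xvar A i)) (i - 1) := by
  have h : vir ρ r lam (r - i) - lam r • LinearMap.mulLeft A (xvar A i) =
      (vir ρ r lam (r - i) - ell ρ r lam (r - i) • 1 - lam r • osc A (r - i - r)) +
        ell ρ r lam (r - i) • 1 := by
    have h2 : osc A ((r : ℤ) - i - r) = LinearMap.mulLeft A (xvar A i) := by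
      apply LinearMap.ext; intro p
      rw [osc_apply, annih_of_nonpos (by omega), show -((r : ℤ) - i - r) = i by ring]; simp
    rw [h2]; abel
  rw [h]
  exact ((vir_sub_hasDeg ρ r lam hr _).mono (by omega)).add (HasDeg.smul_one _ (by omega))

/-- Each `L_{r-i}` multiplies leading terms by `λ_r x_i`. -/
theorem listProd_leading (hr : 1 ≤ r) (l : List ℕ) (hl : ∀ i ∈ l, 0 < i) :
    (l.map fun i : ℕ => xvar A i).prod ∈ fil A l.sum ∧
    (l.map fun i : ℕ => vir ρ r lam (r - i)).prod 1 -
      lam r ^ l.length • (l.map fun i : ℕ => xvar A i).prod ∈ fil A (l.sum - 1) := by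
  induction l with
  | nil => simpa using one_mem_fil le_rfl
  | cons a l ih =>
    obtain ⟨ih1, ih2⟩ := ih fun i hi => hl i (List.mem_cons_of_mem _ hi)
    have ha : 0 < a := hl a (by simp)
    constructor
    · rw [List.map_cons, List.prod_cons, List.sum_cons]
      rw [Nat.cast_add]
      exact mul_mem_fil (xvar_mem_fil le_rfl) ih1
    · rw [List.map_cons, List.map_cons, List.prod_cons, List.prod_cons, List.sum_cons,
        List.length_cons, Module.End.mul_apply]
      set v := (l.map fun i : ℕ => vir ρ r lam (r - i)).prod 1
      set w := (l.map fun i : ℕ => xvar A i).prod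
      have hv : v ∈ fil A l.sum := by
        have := add_mem (fil_mono (by omega) ih2 : _ ∈ fil A (l.sum : ℤ))
          (Submodule.smul_mem _ (lam r ^ l.length) ih1)
        rwa [sub_add_cancel] at this
      have h1 := vir_creation_hasDeg ρ r lam hr ha _ _ hv
      have h2 := Submodule.smul_mem _ (lam r) (mul_mem_fil (xvar_mem_fil (A := A) (le_refl (a : ℤ)))
        ih2)
      have h3 := add_mem (fil_mono (by rw [Nat.cast_add]; omega) h1 : _ ∈ fil A (((a + l.sum : ℕ) : ℤ) - 1))
        (fil_mono (by rw [Nat.cast_add]; omega) h2)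
      convert h3 using 1
      simp only [LinearMap.sub_apply, LinearMap.smul_apply, LinearMap.mulLeft_apply, mul_sub,
        mul_smul_comm, pow_succ']
      module

/-- `L_{-μ} · 1` has leading term `λ_r^{ℓ(μ)} x_μ`. -/
theorem fockMon_leading (hr : 1 ≤ r) (s : ℕ →₀ ℕ) :
    fockMon ρ r lam (expParts s) -
      MvPolynomial.monomial s (lam r ^ (expParts s).card) ∈ fil A (wt s - 1) := by
  have h := (listProd_leading ρ r lam hr ((expParts s).sort (· ≥ ·)) fun i hi =>
    expParts_pos s i ((Multiset.mem_sort _).1 hi)).2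
  have h1 : ((expParts s).sort (· ≥ ·)).sum = wt s := by
    rw [← Multiset.sum_coe, Multiset.sort_eq, expParts_sum]
  have h2 : (((expParts s).sort (· ≥ ·)).map fun i : ℕ => xvar A i).prod =
      MvPolynomial.monomial s 1 := by
    rw [← Multiset.prod_coe, ← Multiset.map_coe, Multiset.sort_eq, prod_xvar_expParts]
  rw [h1, h2, Multiset.length_sort, MvPolynomial.smul_monomial, smul_eq_mul, mul_one] at h
  convert h using 2
  rw [fockMon, Lmon, map_list_prod, List.map_map]
  congr 3
  funext i
  simp [virRep_L]

/-- The linear map `x_μ ↦ L_{-μ} · 1` on the Fock space. -/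
noncomputable def monMap : Module.End A (MvPolynomial ℕ A) :=
  (MvPolynomial.basisMonomials ℕ A).constr A fun s => fockMon ρ r lam (expParts s)

theorem monMap_monomial (s : ℕ →₀ ℕ) (a : A) :
    monMap ρ r lam (MvPolynomial.monomial s a) = a • fockMon ρ r lam (expParts s) := by
  rw [monomial_eq_smul_basisMonomials, map_smul, monMap, Module.Basis.constr_basis]

theorem monMap_sub_scaleMap_hasDeg (hr : 1 ≤ r) :
    HasDeg (monMap ρ r lam - scaleMap (lam r)) (-1) := by
  refine HasDeg.of_monomial fun s a => ?_
  rw [LinearMap.sub_apply, monMap_monomial, scaleMap_monomial]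
  have := Submodule.smul_mem _ a (fockMon_leading ρ r lam hr s)
  rwa [smul_sub, MvPolynomial.smul_monomial, smul_eq_mul, sub_eq_add_neg] at this

variable {lamInv : A} (hlam : lam r * lamInv = 1)
include hlam

theorem monMap_injective (hr : 1 ≤ r) : Function.Injective (monMap ρ r lam) := by
  rw [injective_iff_map_eq_zero]
  intro p hp
  have key : ∀ N : ℕ, p ∈ fil A ((N : ℤ) - 1) → p = 0 := by
    intro N
    induction N with
    | zero => exact fun h => eq_zero_of_mem_fil_neg (by norm_num) h
    | succ N ih =>
      intro h
      refine ih ?_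
      have h1 := monMap_sub_scaleMap_hasDeg ρ r lam hr _ _ h
      rw [LinearMap.sub_apply, hp, zero_sub, neg_mem_iff] at h1
      have h2 := scaleMap_hasDeg lamInv _ _ h1
      rw [scaleMap_scaleMap (by rw [mul_comm, hlam])] at h2
      exact fil_mono (by push_cast; omega) h2
  obtain ⟨N, hN⟩ := exists_mem_fil p
  exact key (N + 1) (by simpa using hN)

theorem exists_monMap_eq (hr : 1 ≤ r) (N : ℕ) (p : MvPolynomial ℕ A) (hp : p ∈ fil A N) :
    ∃ q ∈ fil A N, monMap ρ r lam q = p := by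
  have key : ∀ M : ℕ, ∀ p ∈ fil A ((M : ℤ) - 1), ∃ q ∈ fil A ((M : ℤ) - 1),
      monMap ρ r lam q = p := by
    intro M
    induction M with
    | zero =>
      intro p hp
      exact ⟨0, zero_mem _, by rw [map_zero, eq_zero_of_mem_fil_neg (by norm_num) hp]⟩
    | succ M ih =>
      intro p hp
      have h1 := scaleMap_hasDeg lamInv _ _ hp
      rw [add_zero] at h1
      have h2 := monMap_sub_scaleMap_hasDeg ρ r lam hr _ _ h1
      rw [LinearMap.sub_apply, scaleMap_scaleMap hlam] at h2
      obtain ⟨q, hq, hqe⟩ := ih _ (fil_mono (by push_cast; omega) (neg_mem h2))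
      refine ⟨q + scaleMap lamInv p, add_mem (fil_mono (by push_cast; omega) hq) h1, ?_⟩
      rw [map_add, hqe]; abel
  have := key (N + 1) p (by simpa using hp)
  simpa using this

/-- Every polynomial of degree at most `N` is a combination of the vectors `L_{-μ} · 1` with
`|μ| ≤ N`. -/
theorem exists_partition_sum (hr : 1 ≤ r) (N : ℕ) (p : MvPolynomial ℕ A) (hp : p ∈ fil A N) :
    ∃ a : (k : ℕ) → Nat.Partition k → A, p = ∑ k ∈ Finset.range (N + 1), ∑ μ : Nat.Partition k,
      a k μ • virRep (isVir_vir ρ r lam) (Lneg A (1 - 12 * ρ ^ 2) r μ) 1 := by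
  obtain ⟨q, hq, rfl⟩ := exists_monMap_eq ρ r lam hlam hr N p hp
  let g : (Σ k : Fin (N + 1), Nat.Partition k) → MvPolynomial ℕ A := fun x =>
    virRep (isVir_vir ρ r lam) (Lneg A (1 - 12 * ρ ^ 2) r x.2) 1
  have hmem : monMap ρ r lam q ∈ Submodule.span A (Set.range g) := by
    rw [MvPolynomial.as_sum q, map_sum]
    refine Submodule.sum_mem _ fun s hs => ?_
    rw [monMap_monomial]
    refine Submodule.smul_mem _ _ (Submodule.subset_span ?_)
    have hw : wt s < N + 1 := by
      by_contra hc
      exact MvPolynomial.mem_support_iff.1 hs (hq s (by omega))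
    exact ⟨⟨⟨wt s, hw⟩, ⟨expParts s, fun {i} hi => expParts_pos s i hi, expParts_sum s⟩⟩, rfl⟩
  rw [Submodule.mem_span_range_iff_exists_fun] at hmem
  obtain ⟨a, ha⟩ := hmem
  refine ⟨fun k μ => if h : k < N + 1 then a ⟨⟨k, h⟩, μ⟩ else 0, ?_⟩
  rw [← ha, Fintype.sum_sigma, Finset.sum_range]
  refine Finset.sum_congr rfl fun k _ => Finset.sum_congr rfl fun μ _ => ?_
  simp only [k.2, dif_pos]
  rfl

omit hlam

variable {Λ : ℕ → A} (hΛ : ∀ n : ℕ, r ≤ n → ell ρ r lam n = Λ n)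

/-- The map from the irregular Verma module to the Fock space, with `|Λ⟩ ↦ 1`. -/
noncomputable def toFock : IrrVerma A (1 - 12 * ρ ^ 2) r Λ →ₗ[A] MvPolynomial ℕ A :=
  irrLift (isVir_vir ρ r lam) 1 fun n hn => by rw [vir_one ρ r lam (by omega), hΛ n hn]

include hlam in
/-- The irregular Verma module is a Fock space: the spanning vectors `L_{-μ}|Λ⟩` are mapped to a
basis. -/
theorem toFock_bijective (hr : 1 ≤ r) : Function.Bijective (toFock ρ r lam hΛ) := by
  let j : MvPolynomial ℕ A →ₗ[A] IrrVerma A (1 - 12 * ρ ^ 2) r Λ :=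
    (MvPolynomial.basisMonomials ℕ A).constr A fun s =>
      Lmon A (1 - 12 * ρ ^ 2) r (expParts s) • irrVec A (1 - 12 * ρ ^ 2) r Λ
  have hj : ∀ s, j (MvPolynomial.monomial s 1) =
      Lmon A (1 - 12 * ρ ^ 2) r (expParts s) • irrVec A (1 - 12 * ρ ^ 2) r Λ := fun s => by
    rw [monomial_eq_smul_basisMonomials, map_smul, Module.Basis.constr_basis]
    exact one_smul A (Lmon A (1 - 12 * ρ ^ 2) r (expParts s) • irrVec A (1 - 12 * ρ ^ 2) r Λ)
  have hcomp : ∀ p, toFock ρ r lam hΛ (j p) = monMap ρ r lam p := by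
    intro p
    have : (toFock ρ r lam hΛ).comp j = monMap ρ r lam := by
      refine (MvPolynomial.basisMonomials ℕ A).ext fun s => ?_
      rw [MvPolynomial.coe_basisMonomials, LinearMap.comp_apply, hj, monMap_monomial, one_smul,
        toFock, irrLift_smul, irrLift_irrVec, fockMon]
    exact LinearMap.congr_fun this p
  have hsurj : Function.Surjective j := by
    intro x
    have hx := span_Lmon x
    have hle : Submodule.span A {x | ∃ t : Multiset ℕ, (∀ i ∈ t, 0 < i) ∧
        x = Lmon A (1 - 12 * ρ ^ 2) r t • irrVec A (1 - 12 * ρ ^ 2) r Λ} ≤ LinearMap.range j := by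
      rw [Submodule.span_le]
      rintro _ ⟨t, ht, rfl⟩
      obtain ⟨s, rfl⟩ := exists_expParts ht
      exact ⟨_, hj s⟩
    exact hle hx
  constructor
  · intro x y hxy
    obtain ⟨p, rfl⟩ := hsurj x
    obtain ⟨q, rfl⟩ := hsurj y
    rw [hcomp, hcomp] at hxy
    rw [monMap_injective ρ r lam hlam hr hxy]
  · intro p
    obtain ⟨N, hN⟩ := exists_mem_fil p
    obtain ⟨q, _, hq⟩ := exists_monMap_eq ρ r lam hlam hr N p hN
    exact ⟨j q, by rw [hcomp, hq]⟩

end FockIso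

/-! ### The irregular vector is not a torsion vector -/

section Torsion

variable {A : Type*} [CommRing A] [Algebra ℂ A]

open TensorProduct in
/-- Central charges add up in tensor products of representations. -/
theorem IsVir.tensor {c₁ c₂ : ℂ} {N₁ N₂ : Type*} [AddCommGroup N₁] [Module A N₁]
    [AddCommGroup N₂] [Module A N₂] {ℓ₁ : ℤ → Module.End A N₁} {ℓ₂ : ℤ → Module.End A N₂}
    (h₁ : IsVir c₁ ℓ₁) (h₂ : IsVir c₂ ℓ₂) :
    IsVir (N := N₁ ⊗[A] N₂) (c₁ + c₂) fun n => (ℓ₁ n).rTensor N₂ + (ℓ₂ n).lTensor N₁ := by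
  intro m n
  ext x y
  have e₁ := LinearMap.congr_fun (h₁ m n) x
  have e₂ := LinearMap.congr_fun (h₂ m n) y
  simp only [LinearMap.sub_apply, LinearMap.add_apply, LinearMap.smul_apply, Module.End.mul_apply,
    Module.End.one_apply, sub_eq_iff_eq_add, ← Int.cast_smul_eq_zsmul A] at e₁ e₂
  simp only [TensorProduct.AlgebraTensorModule.curry_apply, LinearMap.restrictScalars_self,
    TensorProduct.curry_apply, LinearMap.sub_apply, LinearMap.add_apply, LinearMap.smul_apply,
    Module.End.mul_apply, Module.End.one_apply, LinearMap.rTensor_tmul, LinearMap.lTensor_tmul,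
    map_add, e₁, e₂, add_tmul, tmul_add, ← smul_tmul', tmul_smul, ← Int.cast_smul_eq_zsmul A]
  split_ifs
  · simp only [mul_add, map_add]
    module
  · module

/-- The polarization `½ ∑_{i+j=n} (p_i q_j + q_i p_j)` with `p_i = δ_{ir}`. -/
theorem sum_ite_add_eq (r : ℕ) (q : ℕ → A) (n : ℕ) (hn : r ≤ n) :
    algebraMap ℂ A (1 / 2) * ∑ i ∈ Finset.range (r + 1), ∑ j ∈ Finset.range (r + 1),
      (if (i + j : ℤ) = n then (if i = r then 1 else 0) * q j + q i * (if j = r then 1 else 0)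
        else 0) = if n ≤ 2 * r then q (n - r) else 0 := by
  have e1 : ∀ i j : ℕ, (if (i + j : ℤ) = n then
      (if i = r then 1 else 0) * q j + q i * (if j = r then 1 else 0) else 0) =
      (if i = r then if j = n - r then q j else 0 else 0) +
      (if j = r then if i = n - r then q i else 0 else 0) := by
    intro i j
    by_cases h1 : i = r <;> by_cases h2 : j = r <;> by_cases h3 : (i + j : ℤ) = n <;>
      by_cases h4 : j = n - r <;> by_cases h5 : i = n - r <;> simp [h1, h2, h3, h4, h5] <;>
      grind
  simp only [e1, Finset.sum_add_distrib, Finset.sum_ite_eq', Finset.mem_range]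
  have h2 : algebraMap ℂ A (1 / 2) * 2 = 1 := by
    rw [← map_ofNat (algebraMap ℂ A) 2, ← map_mul]; norm_num
  rw [Finset.sum_comm]
  have e2 : ∀ j : ℕ, ∑ x ∈ Finset.range (r + 1), (if x = r then if j = n - r then q j else 0 else 0) =
      if j = n - r then q j else 0 := fun j => by
    rw [Finset.sum_ite_eq', if_pos (by simp)]
  simp only [e2, Finset.sum_ite_eq', Finset.mem_range, if_pos (Nat.lt_succ_self r)]
  by_cases h : n ≤ 2 * r
  · rw [if_pos h, if_pos (by omega)]
    linear_combination q (n - r) * h2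
  · rw [if_neg h, if_neg (by omega)]; simp

open TensorProduct in
/-- The irregular vector is not a torsion vector, for arbitrary eigenvalues `Λ_r, …, Λ_{2r}`. A single
Fock space over `A` realizes these only if certain quadratic equations can be solved in `A`. In the
tensor product of two Fock spaces the quadratic form of the momenta is hyperbolic over `ℂ`, and all
eigenvalues occur. -/
theorem eq_zero_of_smul_irrVec_eq_zero (ρ : ℂ) (r : ℕ) (hr : 1 ≤ r) (Λ : ℕ → A)
    (hΛ : ∀ n, 2 * r < n → Λ n = 0) {a : A}
    (ha : a • irrVec A (1 - 12 * ρ ^ 2) r Λ = 0) : a = 0 := by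
  -- the second factor has central charge `1 - 12 ρ₂² = 0`
  obtain ⟨ρ₂, h₂⟩ := IsAlgClosed.exists_pow_nat_eq (1 / 12 : ℂ) (n := 2) (by norm_num)
  obtain ⟨k, hk⟩ := IsAlgClosed.exists_pow_nat_eq (-1 : ℂ) (n := 2) (by norm_num)
  let I := algebraMap ℂ A k
  have hI : I * I = -1 := by rw [← map_mul, ← pow_two, hk]; simp
  let half := algebraMap ℂ A (1 / 2)
  let p : ℕ → A := fun i => if i = r then 1 else 0
  let q : ℕ → A := fun i => if i = 0 then Λ r + algebraMap ℂ A (ρ * (r + 1)) * (1 + half * Λ (2 * r))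
    + algebraMap ℂ A (ρ₂ * (r + 1)) * (I * (1 - half * Λ (2 * r))) else Λ (r + i)
  let lam₁ : ℕ → A := fun i => p i + half * q i
  let lam₂ : ℕ → A := fun i => I * (p i - half * q i)
  have h2 : half * 2 = 1 := by
    rw [← map_ofNat (algebraMap ℂ A) 2, ← map_mul]; norm_num
  -- with `λ¹ = p + q/2`, `λ² = I (p - q/2)`, `I² = -1`, the sum of the quadratic forms is
  -- `½ ∑ (p_i q_j + q_i p_j)`, which is `q_{n-r}` for `p_i = δ_{ir}`; the linear terms are absorbed
  -- in `q_0`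
  have hell : ∀ n : ℕ, r ≤ n → ell ρ r lam₁ n + ell ρ₂ r lam₂ n = Λ n := by
    intro n hn
    have hq : algebraMap ℂ A (1 / 2) * ((∑ i ∈ Finset.range (r + 1), ∑ j ∈ Finset.range (r + 1),
        if (i + j : ℤ) = n then lam₁ i * lam₁ j else 0) + ∑ i ∈ Finset.range (r + 1),
        ∑ j ∈ Finset.range (r + 1), if (i + j : ℤ) = n then lam₂ i * lam₂ j else 0) =
        if n ≤ 2 * r then q (n - r) else 0 := by
      rw [← sum_ite_add_eq r q n hn, ← Finset.sum_add_distrib]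
      congr 1
      refine Finset.sum_congr rfl fun i _ => ?_
      rw [← Finset.sum_add_distrib]
      refine Finset.sum_congr rfl fun j _ => ?_
      by_cases h : (i + j : ℤ) = n
      · simp only [if_pos h]
        change (p i + half * q i) * (p j + half * q j) +
          I * (p i - half * q i) * (I * (p j - half * q j)) = p i * q j + q i * p j
        linear_combination (p i - half * q i) * (p j - half * q j) * hI +
          (p i * q j + q i * p j) * h2
      · simp only [if_neg h, add_zero]
    have hl : ∀ f : ℕ → A, (∑ i ∈ Finset.range (r + 1), if (i : ℤ) = n then f i else 0) =
        if n = r then f r else 0 := by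
      intro f
      simp only [Nat.cast_inj, Finset.sum_ite_eq', Finset.mem_range]
      by_cases h : n = r
      · simp [h]
      · rw [if_neg (by omega), if_neg h]
    rw [ell, ell, hl, hl]
    rcases eq_or_ne n r with rfl | hne
    · rw [if_pos (by omega), Nat.sub_self] at hq
      have h3 : q 0 = Λ n + algebraMap ℂ A (ρ * (n + 1)) * lam₁ n
          + algebraMap ℂ A (ρ₂ * (n + 1)) * lam₂ n := by
        change q 0 = Λ n + algebraMap ℂ A (ρ * (n + 1)) * (p n + half * q n)
          + algebraMap ℂ A (ρ₂ * (n + 1)) * (I * (p n - half * q n))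
        have : q n = Λ (2 * n) := by simp only [q]; rw [if_neg (by omega), two_mul]
        rw [this]
        simp [p, q]
      simp only [if_true, Int.cast_natCast]
      linear_combination hq + h3
    · rw [if_neg hne, if_neg hne]
      have h4 : (if n ≤ 2 * r then q (n - r) else 0) = Λ n := by
        split_ifs with h
        · simp only [q]; rw [if_neg (by omega), Nat.add_sub_cancel' hn]
        · rw [hΛ n (by omega)]
      linear_combination hq + h4
  have ht := (isVir_vir ρ r lam₁).tensor (isVir_vir ρ₂ r lam₂)
  rw [show (1 - 12 * ρ ^ 2 + (1 - 12 * ρ₂ ^ 2) : ℂ) = 1 - 12 * ρ ^ 2 by rw [h₂]; ring] at ht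
  have h1 : ∀ n : ℕ, r ≤ n → ((vir ρ r lam₁ n).rTensor (MvPolynomial ℕ A) +
      (vir ρ₂ r lam₂ n).lTensor (MvPolynomial ℕ A)) (1 ⊗ₜ[A] 1) = Λ n • (1 ⊗ₜ[A] 1) := by
    intro n hn
    rw [LinearMap.add_apply, LinearMap.rTensor_tmul, LinearMap.lTensor_tmul,
      vir_one _ _ _ (by omega), vir_one _ _ _ (by omega), ← TensorProduct.smul_tmul',
      TensorProduct.tmul_smul, ← add_smul, hell n hn]
  have h5 := congrArg (irrLift ht (1 ⊗ₜ[A] 1) h1) ha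
  rw [map_smul, map_zero, irrLift_irrVec] at h5
  -- the constant terms separate `a` from `0`
  let χ : MvPolynomial ℕ A →ₗ[A] A := (MvPolynomial.aeval fun _ => (0 : A)).toLinearMap
  have h6 := congrArg (fun t => TensorProduct.lid A A (TensorProduct.map χ χ t)) h5
  simpa [χ] using h6

end Torsion


/-! ### Binomial identities -/

section Binomial

theorem succ_mul_choose (m : ℤ) (k : ℕ) :
    ((k : ℤ) + 1) * Ring.choose (m + 1) (k + 1) = (m + 1) * Ring.choose m k := by
  have h := Ring.choose_smul_choose (m + 1) (n := k + 1) (k := 1) (by omega)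
  simpa using h

theorem sub_mul_choose (m : ℤ) (k : ℕ) :
    (m - k) * Ring.choose (m + 1) (k + 1) = (m + 1) * Ring.choose m (k + 1) := by
  have h := succ_mul_choose m k
  have h2 := Ring.choose_succ_succ m k
  linear_combination -h + (m + 1) * h2

theorem sum_succ_mul_choose (m n : ℤ) (k : ℕ) :
    ∑ x ∈ Finset.HasAntidiagonal.antidiagonal k,
      ((x.1 : ℤ) + 1) * (Ring.choose (m + 1) (x.1 + 1) * Ring.choose (n + 1) (x.2 + 1)) =
      (m + 1) * (Ring.choose (m + n + 1) (k + 1) - Ring.choose m (k + 1)) := by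
  have h := Ring.add_choose_eq (k + 1) (Commute.all m (n + 1))
  rw [Finset.Nat.antidiagonal_succ', Finset.sum_cons, Finset.sum_map] at h
  rw [add_assoc, h, mul_comm (m + 1)]
  simp only [Ring.choose_zero_right, mul_one, add_sub_cancel_left, Finset.sum_mul]
  refine Finset.sum_congr rfl fun x _ => ?_
  rw [← mul_assoc, succ_mul_choose]
  simp only [Function.Embedding.prodMap, Function.Embedding.coeFn_mk, Prod.map_fst, Prod.map_snd,
    Function.Embedding.refl_apply, Nat.succ_eq_add_one]
  ring

/-- The comparison of coefficients by which the fields `∑_k binom(n+1,k+1) z^{n-k} X_k - z^{n+1} ∂_z`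
form a Witt algebra. -/
theorem sum_sub_mul_choose (m n : ℤ) (k : ℕ) :
    ∑ x ∈ Finset.HasAntidiagonal.antidiagonal k,
      ((x.1 : ℤ) - x.2) * (Ring.choose (m + 1) (x.1 + 1) * Ring.choose (n + 1) (x.2 + 1)) +
      (m - k) * Ring.choose (m + 1) (k + 1) - (n - k) * Ring.choose (n + 1) (k + 1) =
      (m - n) * Ring.choose (m + n + 1) (k + 1) := by
  have h1 := sum_succ_mul_choose m n k
  have h2 := sum_succ_mul_choose n m k
  rw [← Finset.Nat.sum_antidiagonal_swap] at h2
  have h3 : ∑ x ∈ Finset.HasAntidiagonal.antidiagonal k,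
      ((x.1 : ℤ) - x.2) * (Ring.choose (m + 1) (x.1 + 1) * Ring.choose (n + 1) (x.2 + 1)) =
      (m + 1) * (Ring.choose (m + n + 1) (k + 1) - Ring.choose m (k + 1)) -
      (n + 1) * (Ring.choose (m + n + 1) (k + 1) - Ring.choose n (k + 1)) := by
    rw [← h1, add_comm m n, ← h2, ← Finset.sum_sub_distrib]
    refine Finset.sum_congr rfl fun x _ => ?_
    simp only [Prod.fst_swap, Prod.snd_swap]
    ring
  rw [h3, sub_mul_choose, sub_mul_choose]
  ring

end Binomial

/-! ### Witt algebras of vector fields -/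

section VectorFields

variable {R : Type*} [Ring R]

/-- For `Z k = z^k` (or `(-z)^k`), `Θ = z ∂_z` and operators `X i`, the operator
`∑_{i<K} binom(n+1,i+1) z^{n-i} X i - z^{n+1} ∂_z`. -/
def vect (Z : ℤ → R) (Θ : R) (X : ℕ → R) (K : ℕ) (n : ℤ) : R :=
  ∑ i ∈ Finset.range K, Ring.choose (n + 1) (i + 1) • (Z (n - i) * X i) - Z n * Θ

variable {Z : ℤ → R} {Θ : R} {X : ℕ → R}

theorem vect_eq_of_le {K K' : ℕ} (n : ℤ) (h : K ≤ K')
    (h0 : ∀ i, K ≤ i → i < K' → Ring.choose (n + 1) (i + 1) = 0 ∨ X i = 0) :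
    vect Z Θ X K n = vect Z Θ X K' n := by
  rw [vect, vect]
  congr 1
  refine Finset.sum_subset (Finset.range_mono h) fun i hi hi' => ?_
  rw [Finset.mem_range] at hi hi'
  rcases h0 i (by omega) hi with h | h <;> simp [h]

theorem sum_range_range_add {M : Type*} [AddCommMonoid M] (K : ℕ) (g : ℕ → ℕ → M)
    (hg : ∀ i j, K ≤ i + j → g i j = 0) :
    ∑ i ∈ Finset.range K, ∑ j ∈ Finset.range K, g i j =
      ∑ k ∈ Finset.range K, ∑ x ∈ Finset.HasAntidiagonal.antidiagonal k, g x.1 x.2 := by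
  rw [← Finset.sum_product', Finset.sum_sigma']
  symm
  refine Finset.sum_bij_ne_zero (fun x _ _ => x.2) ?_ ?_ ?_ ?_
  · rintro ⟨k, i, j⟩ h _
    simp only [Finset.mem_sigma, Finset.mem_range, Finset.HasAntidiagonal.mem_antidiagonal] at h
    simp only [Finset.mem_product, Finset.mem_range]; omega
  · rintro ⟨k, i, j⟩ h _ ⟨k', i', j'⟩ h' _ he
    simp only [Finset.mem_sigma, Finset.mem_range, Finset.HasAntidiagonal.mem_antidiagonal] at h h'
    simp only [Prod.mk.injEq] at he
    obtain ⟨rfl, rfl⟩ := he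
    obtain ⟨_, rfl⟩ := h
    obtain ⟨_, rfl⟩ := h'
    rfl
  · rintro ⟨i, j⟩ h hne
    refine ⟨⟨i + j, i, j⟩, ?_, hne, rfl⟩
    simp only [Finset.mem_sigma, Finset.mem_range, Finset.HasAntidiagonal.mem_antidiagonal, and_true]
    by_contra hc
    exact hne (hg i j (by omega))
  · intro x _ _; rfl

/-- If the `X i` satisfy the relations `[X i, X j] = (i - j) X (i + j)` and commute with `z` and
`z ∂_z`, then the operators `vect n` satisfy the relations of the Witt algebra. -/
theorem lie_vect (hZ : ∀ a b, Z a * Z b = Z (a + b)) (hΘ : ∀ a : ℤ, Θ * Z a = Z a * Θ + a • Z a)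
    (hXZ : ∀ i a, X i * Z a = Z a * X i) (hXΘ : ∀ i, X i * Θ = Θ * X i)
    (hX : ∀ i j : ℕ, ⁅X i, X j⁆ = ((i : ℤ) - j) • X (i + j)) (K : ℕ) (m n : ℤ)
    (hK : ∀ i j, K ≤ i + j → Ring.choose (m + 1) (i + 1) = 0 ∨ Ring.choose (n + 1) (j + 1) = 0 ∨
      X (i + j) = 0) :
    ⁅vect Z Θ X K m, vect Z Θ X K n⁆ = (m - n) • vect Z Θ X K (m + n) := by
  have e1 : ∀ i j : ℕ, ⁅Z (m - i) * X i, Z (n - j) * X j⁆ =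
      ((i : ℤ) - j) • (Z (m + n - (i + j : ℕ)) * X (i + j)) := by
    intro i j
    have h1 := hX i j
    rw [Ring.lie_def] at h1 ⊢
    rw [mul_assoc, ← mul_assoc (X i), hXZ, mul_assoc (Z (n - j)), ← mul_assoc (Z (m - i)), hZ,
      mul_assoc (Z (n - j)) (X j), ← mul_assoc (X j), hXZ, mul_assoc (Z (m - i)),
      ← mul_assoc (Z (n - j)), hZ, show n - j + (m - i) = m - i + (n - j) by ring, ← mul_sub, h1,
      mul_smul_comm]
    congr 3; push_cast; ring
  have e2 : ∀ (a b : ℤ) (i : ℕ), ⁅Z a * X i, Z b * Θ⁆ = (-a) • (Z (a + b) * X i) := by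
    intro a b i
    rw [Ring.lie_def, mul_assoc, ← mul_assoc (X i), hXZ, mul_assoc (Z b), hXΘ,
      ← mul_assoc (Z a), hZ, mul_assoc (Z b), ← mul_assoc Θ, hΘ, add_mul, mul_add, mul_assoc (Z a),
      ← mul_assoc (Z b) (Z a), hZ, smul_mul_assoc, mul_smul_comm, ← mul_assoc (Z b) (Z a), hZ,
      add_comm b a, neg_smul]
    abel
  have e3 : ⁅Z m * Θ, Z n * Θ⁆ = (n - m) • (Z (m + n) * Θ) := by
    rw [Ring.lie_def, mul_assoc, ← mul_assoc Θ, hΘ, mul_assoc (Z n), ← mul_assoc Θ (Z m), hΘ]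
    simp only [add_mul, mul_add, smul_mul_assoc, mul_smul_comm, ← mul_assoc, hZ, sub_smul,
      add_comm n m]
    abel
  have e4 : ∀ k : ℕ, ∑ x ∈ Finset.HasAntidiagonal.antidiagonal k, (Ring.choose (m + 1) (x.1 + 1) *
      Ring.choose (n + 1) (x.2 + 1) * ((x.1 : ℤ) - x.2)) • (Z (m + n - (x.1 + x.2 : ℕ)) * X (x.1 + x.2)) =
      ((m - n) * Ring.choose (m + n + 1) (k + 1) - (m - k) * Ring.choose (m + 1) (k + 1)
        + (n - k) * Ring.choose (n + 1) (k + 1)) • (Z (m + n - k) * X k) := by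
    intro k
    have h := sum_sub_mul_choose m n k
    rw [← h, show ∀ a b c : ℤ, a + b - c - b + c = a by intros; ring, Finset.sum_smul]
    refine Finset.sum_congr rfl fun x hx => ?_
    rw [Finset.HasAntidiagonal.mem_antidiagonal.1 hx]
    congr 1; ring
  have e5 : ⁅∑ i ∈ Finset.range K, Ring.choose (m + 1) (i + 1) • (Z (m - i) * X i),
      ∑ j ∈ Finset.range K, Ring.choose (n + 1) (j + 1) • (Z (n - j) * X j)⁆ =
      ∑ k ∈ Finset.range K, ((m - n) * Ring.choose (m + n + 1) (k + 1)
        - (m - k) * Ring.choose (m + 1) (k + 1)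
        + (n - k) * Ring.choose (n + 1) (k + 1)) • (Z (m + n - k) * X k) := by
    rw [sum_rlie, ← Finset.sum_congr rfl fun k _ => e4 k, ← sum_range_range_add K (fun i j =>
      (Ring.choose (m + 1) (i + 1) * Ring.choose (n + 1) (j + 1) * ((i : ℤ) - j)) •
        (Z (m + n - (i + j : ℕ)) * X (i + j)))]
    · refine Finset.sum_congr rfl fun i _ => ?_
      rw [rlie_sum]
      refine Finset.sum_congr rfl fun j _ => ?_
      rw [zsmul_rlie, rlie_zsmul, e1, smul_smul, smul_smul, mul_assoc]
    · intro i j h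
      rcases hK i j h with h | h | h <;> simp [h]
  have e6 : ∀ m n : ℤ, ⁅∑ i ∈ Finset.range K, Ring.choose (m + 1) (i + 1) • (Z (m - i) * X i),
      Z n * Θ⁆ = ∑ k ∈ Finset.range K, (-((m - k) * Ring.choose (m + 1) (k + 1))) •
        (Z (m + n - k) * X k) := by
    intro m n
    rw [sum_rlie]
    refine Finset.sum_congr rfl fun i _ => ?_
    rw [zsmul_rlie, e2, smul_smul, sub_add_eq_add_sub]
    congr 1; ring
  rw [vect, vect, sub_rlie, rlie_sub, rlie_sub, e5, e6, e3, rlie_skew (Z m * Θ), e6, vect, smul_sub,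
    Finset.smul_sum, add_comm n m, ← sub_eq_zero]
  simp only [smul_smul, add_smul, sub_smul, neg_smul, Finset.sum_add_distrib,
    Finset.sum_sub_distrib, Finset.sum_neg_distrib, sub_mul]
  abel

end VectorFields

/-! ### Formal series -/

section Sequences

variable {k : Type*} [CommRing k] {N : Type*} [AddCommGroup N] [Module k N]

variable (k N) in
/-- Multiplication by `z^j` on formal series with coefficients in `N`. -/
def shift (j : ℤ) : Module.End k (ℤ → N) where
  toFun f m := f (m - j)
  map_add' _ _ := rfl
  map_smul' _ _ := rfl

theorem shift_apply (j : ℤ) (f : ℤ → N) (m : ℤ) : shift k N j f m = f (m - j) := rfl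

theorem shift_mul (i j : ℤ) : shift k N i * shift k N j = shift k N (i + j) := by
  apply LinearMap.ext; intro f; funext m
  simp only [Module.End.mul_apply, shift_apply]
  congr 1; ring

theorem shift_zero (f : ℤ → N) : shift k N 0 f = f := by
  funext m; rw [shift_apply, sub_zero]

variable (k N) in
/-- The operator `z ∂_z`. -/
def euler : Module.End k (ℤ → N) where
  toFun f m := m • f m
  map_add' _ _ := by funext m; simp
  map_smul' t f := by funext m; exact smul_comm m t (f m)

theorem euler_apply (f : ℤ → N) (m : ℤ) : euler k N f m = m • f m := rfl

theorem euler_mul_shift (a : ℤ) :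
    euler k N * shift k N a = shift k N a * euler k N + a • shift k N a := by
  apply LinearMap.ext; intro f; funext m
  simp only [Module.End.mul_apply, shift_apply, euler_apply, LinearMap.add_apply,
    LinearMap.smul_apply, Pi.add_apply, Pi.smul_apply, ← add_smul, sub_add_cancel]

/-- The coefficientwise action of an operator. -/
def coef (ℓ : Module.End k N) : Module.End k (ℤ → N) := ℓ.compLeft ℤ

theorem coef_apply (ℓ : Module.End k N) (f : ℤ → N) (m : ℤ) : coef ℓ f m = ℓ (f m) := rfl

theorem coef_mul_shift (ℓ : Module.End k N) (a : ℤ) :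
    coef ℓ * shift k N a = shift k N a * coef ℓ := rfl

theorem coef_mul_euler (ℓ : Module.End k N) : coef ℓ * euler k N = euler k N * coef ℓ := by
  apply LinearMap.ext; intro f; funext m
  simp only [Module.End.mul_apply, coef_apply, euler_apply, map_zsmul]

theorem coef_rlie (ℓ ℓ' : Module.End k N) : ⁅coef ℓ, coef ℓ'⁆ = coef ⁅ℓ, ℓ'⁆ := rfl

theorem coef_zsmul (t : ℤ) (ℓ : Module.End k N) : coef (t • ℓ) = t • coef ℓ := rfl

end Sequences

section Sign

variable (A : Type*) [CommRing A]

/-- The sign `(-1)^k`, for an integer `k`. -/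
def sgn (k : ℤ) : A := ((k.negOnePow : ℤ) : A)

theorem sgn_add (j k : ℤ) : sgn A (j + k) = sgn A j * sgn A k := by
  simp [sgn, Int.negOnePow_add]

theorem sgn_zero : sgn A 0 = 1 := by simp [sgn]

theorem sgn_mul_self (k : ℤ) : sgn A k * sgn A k = 1 := by
  rw [← sgn_add, sgn, Int.negOnePow_even _ ⟨k, rfl⟩]; simp

end Sign

/-! ### The highest weight equations -/

section HighestWeight

section Theta

variable {A : Type*} [CommRing A] (r : ℕ) (γ : ℕ → A)

/-- The operator `z ∂_z` on series with the prefactor `z^{γ_0} exp(- ∑_s γ_s z^{-s} / s)`. -/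
def thetaOp (N : Type*) [AddCommGroup N] [Module A N] : Module.End A (ℤ → N) :=
  euler A N + ∑ s ∈ Finset.range (r + 1), γ s • shift A N (-s)

theorem thetaOp_apply {N : Type*} [AddCommGroup N] [Module A N] (f : ℤ → N) (m : ℤ) :
    thetaOp r γ N f m = m • f m + ∑ s ∈ Finset.range (r + 1), γ s • f (m + s) := by
  simp [thetaOp, euler_apply, shift_apply, LinearMap.sum_apply]

theorem thetaOp_mul_shift {N : Type*} [AddCommGroup N] [Module A N] (a : ℤ) :
    thetaOp r γ N * shift A N a = shift A N a * thetaOp r γ N + a • shift A N a := by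
  simp only [thetaOp, add_mul, mul_add, euler_mul_shift, Finset.sum_mul, Finset.mul_sum,
    smul_mul_assoc, mul_smul_comm, shift_mul, add_comm a]
  abel

theorem coef_mul_thetaOp {N : Type*} [AddCommGroup N] [Module A N] (ℓ : Module.End A N) :
    coef ℓ * thetaOp r γ N = thetaOp r γ N * coef ℓ := by
  simp only [thetaOp, add_mul, mul_add, coef_mul_euler, Finset.sum_mul, Finset.mul_sum,
    smul_mul_assoc, mul_smul_comm, coef_mul_shift]

end Theta

variable {A : Type*} [CommRing A] [Algebra ℂ A] (ρ : ℂ) (r : ℕ) (mu : ℕ → A) (γ : ℕ → A) (Δ : A)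

/-- The operator `∑_{i≤n} binom(n+1,i+1) (-z)^{n-i} (L_i - Δ δ_{i0}) - (-z)^n z ∂_z`, for `n ≥ 0`. It
results from solving the equations of index `0, …, n` for the highest weight vector for the action
of the derivations in the parameters. -/
noncomputable def opT (n : ℕ) : Module.End A (ℤ → MvPolynomial ℕ A) :=
  vect (fun j => sgn A j • shift A _ j) (thetaOp r γ _)
    (fun i => coef (vir ρ r mu i - (if i = 0 then Δ else 0) • 1)) (n + 1) n

theorem choose_eq_zero_of_le {n i : ℕ} (h : n < i) :
    Ring.choose ((n : ℤ) + 1) (i + 1) = 0 := by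
  have := Ring.choose_natCast (R := ℤ) (n + 1) (i + 1)
  rw [Nat.choose_eq_zero_of_lt (by omega)] at this
  simpa using this

theorem choose_self (n : ℕ) : Ring.choose ((n : ℤ) + 1) (n + 1) = 1 := by
  have := Ring.choose_natCast (R := ℤ) (n + 1) (n + 1)
  simpa using this

theorem lie_opT (m n : ℕ) :
    ⁅opT ρ r mu γ Δ m, opT ρ r mu γ Δ n⁆ = ((m : ℤ) - n) • opT ρ r mu γ Δ (m + n) := by
  have h : ∀ n' ≤ m + n, opT ρ r mu γ Δ n' = vect (fun j => sgn A j • shift A _ j) (thetaOp r γ _)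
      (fun i => coef (vir ρ r mu i - (if i = 0 then Δ else 0) • 1)) (m + n + 1) n' :=
    fun n' hn' => vect_eq_of_le _ (by omega) fun i hi _ => Or.inl (choose_eq_zero_of_le (by omega))
  rw [h m (by omega), h n (by omega), h (m + n) le_rfl, lie_vect, Nat.cast_add]
  · intro a b
    rw [smul_mul_smul_comm, shift_mul, sgn_add]
  · intro a
    rw [mul_smul_comm, thetaOp_mul_shift, smul_mul_assoc, smul_add, smul_comm]
  · intro i a
    rw [mul_smul_comm, coef_mul_shift, smul_mul_assoc]
  · intro i; exact coef_mul_thetaOp ..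
  · intro i j
    rw [coef_rlie, ← coef_zsmul]
    congr 1
    rw [rlie_sub, sub_rlie, sub_rlie, smul_one_rlie, smul_one_rlie, rlie_smul_one, lie_vir]
    -- no central term, as `i` and `j` are not negative
    have h0 : (if (i : ℤ) + j = 0 then
        algebraMap ℂ A ((((i : ℤ) : ℂ) ^ 3 - (i : ℤ)) / 12 * (1 - 12 * ρ ^ 2)) else 0) = 0 := by
      split_ifs with h
      · rw [show i = 0 by omega]; simp
      · rfl
    rw [h0, zero_smul, add_zero, sub_zero, sub_zero, smul_sub, Nat.cast_add]
    split_ifs with h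
    · rw [show i = 0 by omega, show j = 0 by omega]; simp
    · simp
  · intro i j h
    by_cases hi : m < i
    · exact Or.inl (choose_eq_zero_of_le hi)
    · exact Or.inr (Or.inl (choose_eq_zero_of_le (by omega)))

theorem opT_apply (n : ℕ) (f : ℤ → MvPolynomial ℕ A) (M : ℤ) :
    opT ρ r mu γ Δ n f M = vir ρ r mu n (f M) - (if n = 0 then Δ else 0) • f M +
      ∑ i ∈ Finset.range n, (sgn A (n - i) * (Ring.choose ((n : ℤ) + 1) (i + 1) : ℤ)) •
        (vir ρ r mu i (f (M - (n - i))) - (if i = 0 then Δ else 0) • f (M - (n - i))) -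
      sgn A n • (((M - n : ℤ) : A) • f (M - n) +
        ∑ s ∈ Finset.range (r + 1), γ s • f (M - n + s)) := by
  rw [opT, vect, Finset.sum_range_succ, choose_self]
  simp only [LinearMap.sub_apply, LinearMap.add_apply, LinearMap.sum_apply, Module.End.mul_apply,
    LinearMap.smul_apply, Pi.sub_apply, Pi.add_apply, Finset.sum_apply, Pi.smul_apply, shift_apply,
    coef_apply, thetaOp_apply, sub_self, sgn_zero, one_smul, sub_zero, Module.End.one_apply,
    ← Int.cast_smul_eq_zsmul A, smul_smul, mul_comm]
  rw [Int.cast_one, one_smul, add_comm (Finset.sum _ _)]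

/-- The operators whose vanishing on `f` expresses the equations of index `r + k` for the highest
weight vector. With the momenta `mom` the scalar that is subtracted is the eigenvalue that belongs to
the momenta `λ_i`, as `γ_r = -r β_r`. -/
noncomputable def opN (k : ℕ) : Module.End A (ℤ → MvPolynomial ℕ A) :=
  opT ρ r mu γ Δ (r + k) - (ell ρ r mu (r + k) - if k = 0 then sgn A r * γ r else 0) • 1

variable {r} (hr : 1 ≤ r)
include hr

/-- The scalars in `opN k` do not enter the commutators, which makes the equations `opN k f = 0`
compatible. -/
theorem lie_opN (k l : ℕ) :
    ⁅opN ρ r mu γ Δ k, opN ρ r mu γ Δ l⁆ = ((k : ℤ) - l) • opN ρ r mu γ Δ (r + k + l) := by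
  rw [opN, opN, opN, rlie_sub, sub_rlie, sub_rlie, smul_one_rlie, smul_one_rlie, rlie_smul_one,
    lie_opT]
  by_cases h : k = l
  · subst h; simp
  · rw [ell_eq_zero _ _ _ (by omega), if_neg (by omega),
      show r + k + (r + l) = r + (r + k + l) by ring]
    simp

/-- The operator `opN k` acts on the coefficient of `z^M` by `whit k`, and all other terms involve
coefficients of lower order. -/
theorem opN_apply (k : ℕ) (f : ℤ → MvPolynomial ℕ A) (M : ℤ) :
    opN ρ r mu γ Δ k f M = whit ρ r mu k (f M) +
      (∑ i ∈ Finset.range (r + k), (sgn A ((r + k : ℕ) - i) *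
          (Ring.choose (((r + k : ℕ) : ℤ) + 1) (i + 1) : ℤ)) •
        (vir ρ r mu i (f (M - ((r + k : ℕ) - i))) -
          (if i = 0 then Δ else 0) • f (M - ((r + k : ℕ) - i))) -
      sgn A (r + k : ℕ) • (((M - (r + k : ℕ) : ℤ) : A) • f (M - (r + k : ℕ)) +
        ∑ s ∈ Finset.range r, γ s • f (M - (r + k : ℕ) + s) +
        if k = 0 then 0 else γ r • f (M - k))) := by
  rw [opN, LinearMap.sub_apply, Pi.sub_apply, opT_apply, if_neg (by omega), Finset.sum_range_succ,
    whit]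
  simp only [LinearMap.sub_apply, LinearMap.smul_apply, Module.End.one_apply, Pi.smul_apply,
    Nat.cast_add]
  rcases eq_or_ne k 0 with rfl | hk
  · simp only [if_true, Nat.cast_zero, add_zero, sub_add_cancel]
    module
  · simp only [if_neg hk, show M - ((r : ℤ) + k) + r = M - k by ring]
    module

theorem opN_apply_of_eq_zero (k : ℕ) {f : ℤ → MvPolynomial ℕ A} {M : ℤ} (hf : ∀ j < M, f j = 0) :
    opN ρ r mu γ Δ k f M = whit ρ r mu k (f M) := by
  rw [opN_apply ρ mu γ Δ hr, add_eq_left, Finset.sum_eq_zero, Finset.sum_eq_zero, hf _ (by omega)]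
  · by_cases hk : k = 0
    · simp [hk]
    · rw [if_neg hk, hf _ (by omega)]; simp
  · intro s hs
    rw [Finset.mem_range] at hs
    rw [hf _ (by omega), smul_zero]
  · intro i hi
    rw [Finset.mem_range] at hi
    rw [hf _ (by omega)]; simp

theorem opN_eq_zero_of_eq_zero (k : ℕ) {f : ℤ → MvPolynomial ℕ A} {M : ℤ} (hf : ∀ j < M, f j = 0) :
    ∀ j < M, opN ρ r mu γ Δ k f j = 0 := by
  intro j hj
  rw [opN_apply_of_eq_zero ρ mu γ Δ hr k fun i hi => hf i (by omega), hf j hj, map_zero]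

omit hr in
/-- Multiplication by `z^j` commutes with `opN k` up to the term from `z ∂_z`. -/
theorem opN_shift (k : ℕ) (j : ℤ) (f : ℤ → MvPolynomial ℕ A) :
    opN ρ r mu γ Δ k (shift A _ j f) = shift A _ j (opN ρ r mu γ Δ k f) -
      ((j : A) * sgn A (r + k : ℕ)) • shift A _ (j + (r + k : ℕ)) f := by
  funext M
  rw [opN, LinearMap.sub_apply, LinearMap.sub_apply, Pi.sub_apply, opT_apply]
  simp only [Pi.sub_apply, map_sub, shift_apply, opT_apply, Pi.smul_apply, LinearMap.smul_apply,
    Module.End.one_apply, sub_right_comm _ _ j, sub_add_eq_add_sub, sub_add_eq_sub_sub]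
  push_cast
  module

omit hr in
theorem opN_sub_opN {γ' : ℕ → A} (h : γ' r = γ r) (k : ℕ) (f : ℤ → MvPolynomial ℕ A) :
    opN ρ r mu γ' Δ k f = opN ρ r mu γ Δ k f - sgn A (r + k : ℕ) •
      ∑ s ∈ Finset.range r, (γ' s - γ s) • shift A _ ((r + k : ℕ) - s) f := by
  funext M
  simp only [opN, LinearMap.sub_apply, Pi.sub_apply, opT_apply, h, Finset.sum_range_succ,
    Pi.smul_apply, Finset.sum_apply, shift_apply, sub_smul, Finset.sum_sub_distrib]
  simp only [show ∀ s : ℕ, M - (((r + k : ℕ) : ℤ) - s) = M - (r + k : ℕ) + s by intros; ring]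
  module

end HighestWeight

/-! ### Existence of the formal solution -/

section Existence

variable {A : Type*} [CommRing A] [Algebra ℂ A] (ρ : ℂ) {r : ℕ} (mu : ℕ → A) (γ : ℕ → A) (Δ : A)

theorem vir_sub_smul_mem_fil (hr : 1 ≤ r) {f : ℤ → MvPolynomial ℕ A}
    (hf : ∀ j : ℤ, f j ∈ fil A ((r + 1) * j)) (k : ℕ) (M : ℤ) {i : ℕ} (hi : i < r + k) :
    vir ρ r mu i (f (M - ((r + k : ℕ) - i))) - (if i = 0 then Δ else 0) •
      f (M - ((r + k : ℕ) - i)) ∈ fil A ((r + 1) * M - k) := by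
  obtain ⟨t, ht⟩ : ∃ t : ℕ, r + k = i + 1 + t := ⟨r + k - i - 1, by omega⟩
  have hm : ((r : ℤ) + 1) * (M - ((r + k : ℕ) - i)) = (r + 1) * M - (r + 1 + r * t + t) := by
    rw [ht]; push_cast; ring
  have hd := hf (M - ((r + k : ℕ) - i))
  have hrt : (0 : ℤ) ≤ r * t := by positivity
  rw [hm] at hd
  generalize f (M - ((r + k : ℕ) - i)) = p at *
  generalize (r : ℤ) * t = P at *
  generalize ((r : ℤ) + 1) * M = Q at *
  refine sub_mem ?_ ?_
  · rcases le_or_gt i r with h | h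
    · have h1 := vir_hasDeg ρ r mu hr (n := i) (e := r - i) le_rfl (Or.inl (by omega)) _ _ hd
      exact fil_mono (by omega) h1
    rcases le_or_gt i (2 * r) with h2 | h2
    · have h1 := vir_hasDeg ρ r mu hr (n := i) (e := 0) (by omega) (Or.inl le_rfl) _ _ hd
      exact fil_mono (by omega) h1
    · have h1 := vir_hasDeg ρ r mu hr (n := i) (e := r - i) le_rfl (Or.inr (by omega)) _ _ hd
      exact fil_mono (by omega) h1
  · split_ifs with h0
    · exact Submodule.smul_mem _ _ (fil_mono (by omega) hd)
    · rw [zero_smul]; exact zero_mem _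

/-- If the coefficient of `z^j` has weighted degree at most `(r + 1) j`, then the coefficient of `z^M`
in `opN k f` has degree at most `(r + 1) M - k`. -/
theorem opN_mem_fil (hr : 1 ≤ r) {f : ℤ → MvPolynomial ℕ A}
    (hf : ∀ j : ℤ, f j ∈ fil A ((r + 1) * j)) (k : ℕ) (M : ℤ) :
    opN ρ r mu γ Δ k f M ∈ fil A ((r + 1) * M - k) := by
  have hf' : ∀ i : ℤ, (r + 1) * i ≤ (r + 1) * M - k → f i ∈ fil A ((r + 1) * M - k) :=
    fun i h => fil_mono h (hf i)
  have hrk : (0 : ℤ) ≤ r * k := by positivity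
  have hrr : (0 : ℤ) ≤ r * r := by positivity
  have h1 : whit ρ r mu k (f M) ∈ fil A ((r + 1) * M - k) := whit_hasDeg ρ r mu hr k _ _ (hf M)
  have h2 : f (M - (r + k : ℕ)) ∈ fil A ((r + 1) * M - k) := hf' _ (by push_cast; linarith)
  have h3 : ∀ s ∈ Finset.range r, γ s • f (M - (r + k : ℕ) + s) ∈ fil A ((r + 1) * M - k) := by
    intro s hs
    rw [Finset.mem_range] at hs
    refine Submodule.smul_mem _ _ (hf' _ ?_)
    obtain ⟨t, ht⟩ : ∃ t : ℕ, r = s + 1 + t := ⟨r - s - 1, by omega⟩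
    have hrt : (0 : ℤ) ≤ r * t := by positivity
    have : (s : ℤ) = r - 1 - t := by omega
    rw [this]
    push_cast
    linarith
  have h4 : (if k = 0 then 0 else γ r • f (M - k)) ∈ fil A ((r + 1) * M - k) := by
    split_ifs with h
    · exact zero_mem _
    · exact Submodule.smul_mem _ _ (hf' _ (by linarith))
  rw [opN_apply ρ mu γ Δ hr]
  exact add_mem h1 (sub_mem (sum_mem fun i hi => Submodule.smul_mem _ _
    (vir_sub_smul_mem_fil ρ mu Δ hr hf k M (Finset.mem_range.1 hi)))
    (Submodule.smul_mem _ _ (add_mem (add_mem (Submodule.smul_mem _ _ h2) (sum_mem h3)) h4)))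

omit [Algebra ℂ A] in
theorem fil_neg_eq_zero (hr : 1 ≤ r) {f : ℤ → MvPolynomial ℕ A}
    (hf : ∀ j : ℤ, f j ∈ fil A ((r + 1) * j)) {j : ℤ} (hj : j < 0) : f j = 0 :=
  eq_zero_of_mem_fil_neg (by nlinarith) (hf j)

theorem opN_congr {γ γ' : ℕ → A} (h : ∀ s ≤ r, γ s = γ' s) (k : ℕ) :
    opN ρ r mu γ Δ k = opN ρ r mu γ' Δ k := by
  have : thetaOp r γ (MvPolynomial ℕ A) = thetaOp r γ' (MvPolynomial ℕ A) := by
    rw [thetaOp, thetaOp]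
    congr 1
    refine Finset.sum_congr rfl fun s hs => ?_
    rw [h s (by simpa [Nat.lt_succ_iff] using hs)]
  rw [opN, opN, opT, opT, this, h r le_rfl]

/-- Solutions of the highest weight equations modulo `z^M`. -/
structure IsSol (M : ℕ) (γ : ℕ → A) (f : ℤ → MvPolynomial ℕ A) : Prop where
  zero : f 0 = 1
  mem : ∀ j : ℤ, f j ∈ fil A ((r + 1) * j)
  eq : ∀ k : ℕ, ∀ j < (M : ℤ), opN ρ r mu γ Δ k f j = 0

theorem isSol_one (hr : 1 ≤ r) : IsSol ρ mu Δ 1 γ (r := r) (Pi.single 0 1) where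
  zero := by simp
  mem j := by
    rcases eq_or_ne j 0 with rfl | h
    · simpa using one_mem_fil le_rfl
    · rw [Pi.single_eq_of_ne h]; exact zero_mem _
  eq k j hj := by
    have h0 : ∀ i : ℤ, i < j → (Pi.single 0 1 : ℤ → MvPolynomial ℕ A) i = 0 := fun i hi =>
      Pi.single_eq_of_ne (by omega) _
    rw [opN_apply_of_eq_zero ρ mu γ Δ hr k h0]
    rcases eq_or_ne j 0 with rfl | h
    · rw [Pi.single_eq_same, whit_one ρ r mu]
    · rw [Pi.single_eq_of_ne h, map_zero]

variable {lamInv : A} (hlam : mu r * lamInv = 1)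
include hlam

/-- One order of the recursion. Solving for the coefficient of `z^M` leaves a constant in the equation
of index `r`, which is removed by a change of `γ_{r-M}` if `M ≤ r`, and of the coefficient of
`z^{M-r}` if `M > r`. -/
theorem IsSol.exists_succ (hr : 1 ≤ r) {M : ℕ} (hM : 1 ≤ M) {γ : ℕ → A}
    {f : ℤ → MvPolynomial ℕ A} (h : IsSol ρ mu Δ (r := r) M γ f) :
    ∃ γ' f', IsSol ρ mu Δ (r := r) (M + 1) γ' f' ∧ (∀ s, s + M ≠ r → γ' s = γ s) ∧
      ∀ j : ℤ, j < M - r → f' j = f j := by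
  have hdeg : ∀ k : ℕ, -opN ρ r mu γ Δ k f M ∈ fil A (((r + 1) * M : ℕ) - k) := fun k => by
    have := neg_mem (opN_mem_fil ρ mu γ Δ hr h.mem k M)
    push_cast; exact this
  have hcoc : ∀ k l : ℕ, whit ρ r mu k (-opN ρ r mu γ Δ l f M) -
      whit ρ r mu l (-opN ρ r mu γ Δ k f M) = ((k : ℤ) - l) • (-opN ρ r mu γ Δ (r + k + l) f M) := by
    intro k l
    have h1 := congrFun (LinearMap.congr_fun (lie_opN ρ mu γ Δ hr k l) f) M
    rw [Ring.lie_def, LinearMap.sub_apply, Pi.sub_apply, Module.End.mul_apply,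
      Module.End.mul_apply, opN_apply_of_eq_zero ρ mu γ Δ hr k (h.eq l),
      opN_apply_of_eq_zero ρ mu γ Δ hr l (h.eq k), LinearMap.smul_apply, Pi.smul_apply] at h1
    rw [map_neg, map_neg, smul_neg, ← h1]; abel
  obtain ⟨x, hx, u, hu0, hu⟩ := exists_whit_eq ρ r mu hlam hr ((r + 1) * M)
    (fun k => -opN ρ r mu γ Δ k f M) hdeg hcoc
  -- the coefficient `x` of `z^M` solves the equations up to the constant `u`
  set f₁ : ℤ → MvPolynomial ℕ A := f + Pi.single (M : ℤ) x with hf₁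
  have hmem₁ : ∀ j : ℤ, f₁ j ∈ fil A ((r + 1) * j) := by
    intro j
    refine add_mem (h.mem j) ?_
    rcases eq_or_ne j M with rfl | hj
    · rw [Pi.single_eq_same]; exact_mod_cast hx
    · rw [Pi.single_eq_of_ne hj]; exact zero_mem _
  have hlt : ∀ j : ℤ, j < M → (Pi.single (M : ℤ) x : ℤ → MvPolynomial ℕ A) j = 0 := fun j hj =>
    Pi.single_eq_of_ne hj.ne _
  have heq₁ : ∀ k : ℕ, ∀ j < (M : ℤ), opN ρ r mu γ Δ k f₁ j = 0 := fun k j hj => by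
    rw [hf₁, map_add, Pi.add_apply, h.eq k j hj, opN_eq_zero_of_eq_zero ρ mu γ Δ hr k hlt j hj,
      add_zero]
  have hM₁ : ∀ k : ℕ, opN ρ r mu γ Δ k f₁ M = if k = 0 then MvPolynomial.C u else 0 := fun k => by
    rw [hf₁, map_add, Pi.add_apply, opN_apply_of_eq_zero ρ mu γ Δ hr k hlt, Pi.single_eq_same]
    cases k with
    | zero => rw [hu0]; simp
    | succ k => rw [hu]; simp
  have hz₁ : f₁ 0 = 1 := by rw [hf₁, Pi.add_apply, h.zero, hlt 0 (by omega), add_zero]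
  have hneg : ∀ j < 0, f₁ j = 0 := fun j hj => fil_neg_eq_zero hr hmem₁ hj
  have hCu : MvPolynomial.C u = u • (1 : MvPolynomial ℕ A) := by
    rw [MvPolynomial.smul_eq_C_mul, mul_one]
  rcases le_or_gt M r with hMr | hMr
  · -- the constant is removed by adjusting `γ_{r-M}`
    refine ⟨Function.update γ (r - M) (γ (r - M) + sgn A r * u), f₁, ⟨hz₁, hmem₁, ?_⟩, ?_, ?_⟩
    · intro k j hj
      rw [opN_sub_opN ρ mu γ Δ (by rw [Function.update_of_ne (by omega)]),
        Finset.sum_eq_single_of_mem (r - M) (Finset.mem_range.2 (by omega)), Function.update_self,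
        add_sub_cancel_left]
      · rw [Pi.sub_apply, Pi.smul_apply, Pi.smul_apply, shift_apply, Nat.cast_sub hMr]
        rcases lt_or_ge j M with h2 | h2
        · rw [heq₁ k j h2, hneg _ (by push_cast; omega)]; simp
        · obtain rfl : j = M := by push_cast at hj; omega
          rw [hM₁]
          by_cases hk : k = 0
          · subst hk
            rw [if_pos rfl, show (M : ℤ) - ((r + 0 : ℕ) - (r - M)) = 0 by push_cast; ring, hz₁, hCu,
              smul_smul, ← mul_assoc, add_zero, sgn_mul_self, one_mul, sub_self]
          · rw [if_neg hk, hneg _ (by push_cast; omega)]; simp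
      · intro s _ hs
        rw [Function.update_of_ne hs, sub_self, zero_smul]
    · intro s hs
      exact Function.update_of_ne (by omega) _ _
    · intro j hj
      rw [hf₁, Pi.add_apply, hlt j (by omega), add_zero]
  · -- the constant is removed by adding a multiple of `z^{M-r} f`
    set t : ℕ := M - r with ht
    set a : A := algebraMap ℂ A (1 / t) * (sgn A r * u) with ha
    have hta : (t : A) * a = sgn A r * u := by
      rw [ha, ← mul_assoc, ← map_natCast (algebraMap ℂ A), ← map_mul, mul_one_div_cancel, map_one,
        one_mul]
      exact Nat.cast_ne_zero.2 (by omega)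
    have hs : ∀ j : ℤ, j < t → shift A _ (t : ℤ) f₁ j = 0 := fun j hj => hneg _ (by omega)
    refine ⟨γ, f₁ + a • shift A _ (t : ℤ) f₁, ⟨?_, ?_, ?_⟩, fun _ _ => rfl, ?_⟩
    · rw [Pi.add_apply, Pi.smul_apply, hs 0 (by omega), smul_zero, add_zero, hz₁]
    · intro j
      refine add_mem (hmem₁ j) (Submodule.smul_mem _ _ (fil_mono ?_ (hmem₁ (j - t))))
      nlinarith [(by positivity : (0 : ℤ) ≤ r * t)]
    · intro k j hj
      rw [map_add, map_smul, opN_shift, Pi.add_apply, Pi.smul_apply, Pi.sub_apply, Pi.smul_apply,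
        shift_apply, shift_apply, heq₁ k (j - t) (by push_cast at hj; omega), zero_sub]
      rcases lt_or_ge j M with h2 | h2
      · rw [heq₁ k j h2, hneg _ (by push_cast; omega)]; simp
      · obtain rfl : j = M := by push_cast at hj; omega
        rw [hM₁]
        by_cases hk : k = 0
        · subst hk
          rw [if_pos rfl, show (M : ℤ) - (t + (r + 0 : ℕ)) = 0 by push_cast; omega, hz₁, hCu,
            smul_neg, smul_smul, add_zero, Int.cast_natCast,
            show a * (t * sgn A r) = t * a * sgn A r by ring, hta,
            show sgn A r * u * sgn A r = sgn A r * sgn A r * u by ring, sgn_mul_self, one_mul,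
            add_neg_cancel]
        · rw [if_neg hk, hneg _ (by push_cast; omega)]; simp
    · intro j hj
      rw [Pi.add_apply, Pi.smul_apply, hs j (by omega), smul_zero, add_zero, hf₁, Pi.add_apply,
        hlt j (by omega), add_zero]

/-- A formal solution of the highest weight equations with prescribed `γ_r`. -/
theorem exists_formal_solution (hr : 1 ≤ r) (g : A) :
    ∃ (γ : ℕ → A) (f : ℤ → MvPolynomial ℕ A), γ r = g ∧ f 0 = 1 ∧
      (∀ j : ℤ, f j ∈ fil A ((r + 1) * j)) ∧ ∀ k : ℕ, opN ρ r mu γ Δ k f = 0 := by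
  have hstep : ∀ (M : ℕ) (p : (ℕ → A) × (ℤ → MvPolynomial ℕ A)), ∃ p' : (ℕ → A) × (ℤ → MvPolynomial ℕ A),
      IsSol ρ mu Δ (r := r) (M + 1) p.1 p.2 → IsSol ρ mu Δ (r := r) (M + 2) p'.1 p'.2 ∧
        (∀ s, s + (M + 1) ≠ r → p'.1 s = p.1 s) ∧ ∀ j : ℤ, j < (M + 1 : ℕ) - r → p'.2 j = p.2 j := by
    intro M p
    by_cases h : IsSol ρ mu Δ (r := r) (M + 1) p.1 p.2
    · obtain ⟨γ', f', h'⟩ := h.exists_succ ρ mu Δ hlam hr (by omega)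
      exact ⟨(γ', f'), fun _ => h'⟩
    · exact ⟨p, fun h' => absurd h' h⟩
  choose step hs using hstep
  -- `γ_s` is final after `r - s` steps, and the coefficient of `z^j` after `j + r` steps
  let seq : ℕ → (ℕ → A) × (ℤ → MvPolynomial ℕ A) := fun M =>
    Nat.rec (fun _ => g, Pi.single 0 1) step M
  have hsol : ∀ M, IsSol ρ mu Δ (r := r) (M + 1) (seq M).1 (seq M).2 := by
    intro M
    induction M with
    | zero => exact isSol_one ρ mu _ Δ hr
    | succ M ih => exact (hs M _ ih).1
  have hγ : ∀ M s, r ≤ s + M → (seq M).1 s = (seq (r - s)).1 s := by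
    intro M s h
    induction M with
    | zero => rw [show r - s = 0 by omega]
    | succ M ih =>
      rcases eq_or_ne (s + (M + 1)) r with h' | h'
      · rw [show r - s = M + 1 by omega]
      · exact ((hs M _ (hsol M)).2.1 s h').trans (ih (by omega))
  have hf : ∀ (M : ℕ) (j : ℤ), j + r ≤ M → (seq M).2 j = (seq (j + r).toNat).2 j := by
    intro M j h
    induction M with
    | zero => rw [show (j + r).toNat = 0 by omega]
    | succ M ih =>
      rcases eq_or_ne (j + r) (M + 1 : ℕ) with h' | h'
      · rw [h', Int.toNat_natCast]
      · exact ((hs M _ (hsol M)).2.2 j (by omega)).trans (ih (by omega))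
  refine ⟨fun s => (seq (r - s)).1 s, fun j => (seq (j + r).toNat).2 j, ?_, ?_, fun j => ?_,
    fun k => ?_⟩
  · simp [seq]
  · exact (hsol _).zero
  · exact (hsol _).mem j
  · funext j
    set M : ℕ := (j + r).toNat + r with hM
    have h1 := (hsol M).eq k j (by omega)
    have e1 : opN ρ r mu (fun s => (seq (r - s)).1 s) Δ k = opN ρ r mu (seq M).1 Δ k :=
      opN_congr ρ mu Δ (fun s _ => (hγ M s (by omega)).symm) k
    have h2 := opN_eq_zero_of_eq_zero ρ mu (seq M).1 Δ hr k (M := j + 1)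
      (f := (fun j : ℤ => (seq (j + r).toNat).2 j) - (seq M).2) (fun i hi => by
        rw [Pi.sub_apply, hf M i (by omega), sub_self]) j (by omega)
    rw [map_sub, Pi.sub_apply, h1, sub_zero] at h2
    rw [e1, h2]; rfl

end Existence

/-! ### Uniqueness of the formal solution -/

section Uniqueness

variable {A : Type*} [CommRing A] [Algebra ℂ A] (ρ : ℂ) {r : ℕ} (mu : ℕ → A) (γ : ℕ → A) (Δ : A)

omit [Algebra ℂ A] in
/-- If `∑ c_j z^j f` vanishes to order `K`, where `f = 1 + O(z)`, then so does `∑ c_j z^j`. -/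
theorem coeff_eq_zero_of_sum_shift {f : ℤ → MvPolynomial ℕ A} (hneg : ∀ j < 0, f j = 0)
    (h0 : f 0 = 1) (c : ℤ → A) (B M K : ℤ)
    (h : ∀ m < K, ∑ j ∈ Finset.Ico B M, c j • f (m - j) = 0) :
    ∀ j, B ≤ j → j < M → j < K → c j = 0 := by
  have key : ∀ n : ℕ, ∀ j, j < B + n → B ≤ j → j < M → j < K → c j = 0 := by
    intro n
    induction n with
    | zero => intro j h1 h2; omega
    | succ n ih =>
      intro j h1 h2 h3 h4
      rcases lt_or_ge j (B + n) with h5 | h5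
      · exact ih j h5 h2 h3 h4
      have := h j h4
      rw [Finset.sum_eq_single_of_mem j (Finset.mem_Ico.2 ⟨h2, h3⟩), sub_self, h0] at this
      · have h6 := congrArg MvPolynomial.constantCoeff this
        simpa [MvPolynomial.smul_eq_C_mul] using h6
      · intro i hi hij
        rw [Finset.mem_Ico] at hi
        rcases lt_or_gt_of_ne hij with h6 | h6
        · rw [ih i (by push_cast at h1; omega) hi.1 hi.2 (by omega), zero_smul]
        · rw [hneg _ (by omega), smul_zero]
  intro j h1
  exact key (j - B + 1).toNat j (by omega) h1

variable {lamInv : A} (hlam : mu r * lamInv = 1)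
include hlam

section

variable {f : ℤ → MvPolynomial ℕ A} (hneg : ∀ j < 0, f j = 0) (h0 : f 0 = 1)
  (hf : ∀ k, opN ρ r mu γ Δ k f = 0)
include hneg h0 hf

/-- A solution `h` of the inhomogeneous equations is, order by order, a combination `∑ a_i z^i f`. The
equations then say that `(ψ + ∑ i a_i z^i) f` vanishes to the order considered. -/
theorem exists_sum_shift (hr : 1 ≤ r) {h : ℤ → MvPolynomial ℕ A} {B : ℤ} (hB : ∀ j < B, h j = 0)
    {ψ : A} (hh : ∀ k : ℕ, opN ρ r mu γ Δ k h = (sgn A (r + k : ℕ) * ψ) • shift A _ (r + k : ℕ) f)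
    (n : ℕ) : ∃ a : ℤ → A, (∀ j < B + n, h j = ∑ i ∈ Finset.Ico B (B + n), a i • f (j - i)) ∧
      ∀ j < B + n - r, ψ • f j + ∑ i ∈ Finset.Ico B (B + n), ((i : A) * a i) • f (j - i) = 0 := by
  have part : ∀ (n : ℕ) (a : ℤ → A),
      (∀ j < B + n, h j = ∑ i ∈ Finset.Ico B (B + n), a i • f (j - i)) →
      (∀ j < B + n - r, ψ • f j + ∑ i ∈ Finset.Ico B (B + n), ((i : A) * a i) • f (j - i) = 0) ∧
      ∀ k : ℕ, whit ρ r mu (k + 1)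
        (h (B + n) - ∑ i ∈ Finset.Ico B (B + n), a i • f (B + n - i)) = 0 := by
    intro n a ha
    -- the lowest coefficient of the difference is an irregular vector, hence a constant
    set G : ℤ → MvPolynomial ℕ A := h - ∑ i ∈ Finset.Ico B (B + n), a i • shift A _ i f with hG
    have hGa : ∀ j, G j = h j - ∑ i ∈ Finset.Ico B (B + n), a i • f (j - i) := fun j => by
      simp [hG, Finset.sum_apply, shift_apply]
    have hG0 : ∀ j < B + n, G j = 0 := fun j hj => by rw [hGa, ha j hj, sub_self]
    have hN : ∀ (k : ℕ) (j : ℤ), opN ρ r mu γ Δ k G (j + (r + k : ℕ)) = sgn A (r + k : ℕ) •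
        (ψ • f j + ∑ i ∈ Finset.Ico B (B + n), ((i : A) * a i) • f (j - i)) := by
      intro k j
      rw [hG, map_sub, hh, map_sum]
      simp only [map_smul, opN_shift, hf, map_zero, zero_sub, Pi.sub_apply, Pi.smul_apply,
        Finset.sum_apply, Pi.neg_apply, shift_apply, add_sub_cancel_right, smul_neg,
        Finset.sum_neg_distrib, sub_neg_eq_add, smul_add, Finset.smul_sum, smul_smul]
      congr 1
      refine Finset.sum_congr rfl fun i _ => ?_
      congr 1
      · ring
      · congr 1; ring
    have hE : ∀ j < B + n - r,
        ψ • f j + ∑ i ∈ Finset.Ico B (B + n), ((i : A) * a i) • f (j - i) = 0 := by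
      intro j hj
      have h1 := opN_eq_zero_of_eq_zero ρ mu γ Δ hr 0 hG0 (j + (r + 0 : ℕ)) (by push_cast; omega)
      rw [hN] at h1
      have h2 := congrArg (fun x => sgn A (r + 0 : ℕ) • x) h1
      simpa only [smul_smul, sgn_mul_self, one_smul, smul_zero] using h2
    refine ⟨hE, fun k => ?_⟩
    rw [← hGa, ← opN_apply_of_eq_zero ρ mu γ Δ hr _ hG0,
      show B + n = B + n - (r + (k + 1) : ℕ) + (r + (k + 1) : ℕ) by ring, hN,
      hE _ (by push_cast; omega), smul_zero]
  have main : ∀ n : ℕ, ∃ a : ℤ → A,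
      ∀ j < B + n, h j = ∑ i ∈ Finset.Ico B (B + n), a i • f (j - i) := by
    intro n
    induction n with
    | zero => exact ⟨0, fun j hj => by rw [hB j (by simpa using hj)]; simp⟩
    | succ n ih =>
      obtain ⟨a, ha⟩ := ih
      have h1 := eq_C_of_whit_eq_zero ρ r mu hlam hr (part n a ha).2
      set u := MvPolynomial.constantCoeff
        (h (B + n) - ∑ i ∈ Finset.Ico B (B + n), a i • f (B + n - i))
      refine ⟨Function.update a (B + n) u, fun j hj => ?_⟩
      have h2 : Finset.Ico B (B + (n + 1 : ℕ)) = insert (B + (n : ℤ)) (Finset.Ico B (B + n)) := by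
        ext i; simp only [Finset.mem_Ico, Finset.mem_insert]; omega
      rw [h2, Finset.sum_insert (by simp), Function.update_self]
      have h3 : ∑ i ∈ Finset.Ico B (B + n), Function.update a (B + n) u i • f (j - i) =
          ∑ i ∈ Finset.Ico B (B + n), a i • f (j - i) := by
        refine Finset.sum_congr rfl fun i hi => ?_
        rw [Finset.mem_Ico] at hi
        rw [Function.update_of_ne (by omega)]
      rw [h3]
      rcases lt_or_ge j (B + n) with h4 | h4
      · rw [hneg _ (by omega), smul_zero, zero_add, ha j h4]
      · obtain rfl : j = B + n := by push_cast at hj; omega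
        rw [sub_self, h0, MvPolynomial.smul_eq_C_mul, mul_one, ← h1, sub_add_cancel]
  obtain ⟨a, ha⟩ := main n
  exact ⟨a, ha, (part n a ha).1⟩

/-- The formal solution `f` spans the space of solutions that are bounded below. -/
theorem eq_smul_of_opN_eq (hr : 1 ≤ r) {h : ℤ → MvPolynomial ℕ A} {B : ℤ} (hB : ∀ j < B, h j = 0)
    {ψ : A} (hh : ∀ k : ℕ, opN ρ r mu γ Δ k h = (sgn A (r + k : ℕ) * ψ) • shift A _ (r + k : ℕ) f) :
    ψ = 0 ∧ h = MvPolynomial.constantCoeff (h 0) • f := by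
  wlog hB0 : B ≤ 0 generalizing B
  · exact this (B := 0) (fun j hj => hB j (by omega)) le_rfl
  have key : ∀ m : ℤ, 0 ≤ m → ψ = 0 ∧ ∃ a : A, ∀ j ≤ m, h j = a • f j := by
    intro m hm
    obtain ⟨n, hn⟩ : ∃ n : ℕ, B + n = m + r + 1 := ⟨(m + r + 1 - B).toNat, by omega⟩
    obtain ⟨a, ha, hE⟩ := exists_sum_shift ρ mu γ Δ hlam hneg h0 hf hr hB hh n
    have hc := coeff_eq_zero_of_sum_shift hneg h0
      (fun i => (if i = 0 then ψ else 0) + (i : A) * a i) B (B + n) (B + n - r) (by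
        intro j hj
        rw [← hE j hj]
        simp only [add_smul, Finset.sum_add_distrib, ite_smul, zero_smul, Finset.sum_ite_eq']
        rw [if_pos (Finset.mem_Ico.2 (by omega)), sub_zero])
    have hψ : ψ = 0 := by simpa using hc 0 hB0 (by omega) (by omega)
    have hai : ∀ i, B ≤ i → i ≤ m → i ≠ 0 → a i = 0 := by
      intro i h1 h2 h3
      have h4 := hc i h1 (by omega) (by omega)
      simp only [if_neg h3, zero_add] at h4
      have h5 : algebraMap ℂ A (1 / i) * (i : A) = 1 := by
        rw [← map_intCast (algebraMap ℂ A), ← map_mul, one_div_mul_cancel, map_one]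
        exact Int.cast_ne_zero.2 h3
      linear_combination algebraMap ℂ A (1 / i) * h4 - a i * h5
    have hm' : ∀ j ≤ m, h j = a 0 • f j := by
      intro j hj
      rw [ha j (by omega), Finset.sum_eq_single_of_mem 0 (Finset.mem_Ico.2 (by omega)), sub_zero]
      intro i hi hi0
      rw [Finset.mem_Ico] at hi
      rcases le_or_gt i m with h1 | h1
      · rw [hai i hi.1 h1 hi0, zero_smul]
      · rw [hneg _ (by omega), smul_zero]
    exact ⟨hψ, a 0, hm'⟩
  refine ⟨(key 0 le_rfl).1, funext fun m => ?_⟩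
  obtain ⟨-, a, ha⟩ := key (max m 0) (le_max_right _ _)
  have h1 : MvPolynomial.constantCoeff (h 0) = a := by
    rw [ha 0 (le_max_right _ _), h0, MvPolynomial.smul_eq_C_mul, mul_one,
      MvPolynomial.constantCoeff_C]
  rw [ha m (le_max_left _ _), Pi.smul_apply, h1]

end

/-- The parameters and the formal solution are unique. -/
theorem formal_solution_unique (hr : 1 ≤ r) {γ' : ℕ → A} (hγ : γ' r = γ r)
    {f f' : ℤ → MvPolynomial ℕ A} (hneg : ∀ j < 0, f j = 0) (h0 : f 0 = 1)
    (hf : ∀ k, opN ρ r mu γ Δ k f = 0) (hneg' : ∀ j < 0, f' j = 0) (h0' : f' 0 = 1)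
    (hf' : ∀ k, opN ρ r mu γ' Δ k f' = 0) : (∀ s ≤ r, γ' s = γ s) ∧ f' = f := by
  have hN : ∀ (k : ℕ) (j : ℤ), opN ρ r mu γ Δ k f' j = sgn A (r + k : ℕ) •
      ∑ s ∈ Finset.range r, (γ' s - γ s) • f' (j - ((r + k : ℕ) - s)) := by
    intro k j
    have h := congrFun (opN_sub_opN ρ mu γ Δ hγ k f') j
    rw [hf', Pi.zero_apply, Pi.sub_apply, Pi.smul_apply, Finset.sum_apply, eq_comm,
      sub_eq_zero] at h
    exact h
  -- the exponents `γ_r, γ_{r-1}, …` are compared one by one, each in its own order of `z`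
  have hδ : ∀ M : ℕ, M ≤ r → (∀ s, r - M ≤ s → s ≤ r → γ' s = γ s) ∧
      ∃ a : ℕ → A, a 0 = 1 ∧ ∀ j : ℤ, j < M + 1 → f' j = ∑ i ∈ Finset.range (M + 1), a i • f (j - i) := by
    intro M hM
    induction M with
    | zero =>
      refine ⟨fun s h1 h2 => by rw [show s = r by omega, hγ], fun _ => 1, rfl, fun j hj => ?_⟩
      rcases lt_or_eq_of_le (show j ≤ 0 by push_cast at hj; omega) with h | h
      · simp [hneg' _ h, hneg _ h]
      · simp [h, h0, h0']
    | succ M ih =>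
      obtain ⟨ih, a, ha0, ha⟩ := ih (by omega)
      set G : ℤ → MvPolynomial ℕ A := f' - ∑ i ∈ Finset.range (M + 1), a i • shift A _ (i : ℤ) f
        with hG
      have hGa : ∀ j, G j = f' j - ∑ i ∈ Finset.range (M + 1), a i • f (j - i) := fun j => by
        simp [hG, Finset.sum_apply, shift_apply]
      have hG0 : ∀ j < (M : ℤ) + 1, G j = 0 := fun j hj => by rw [hGa, ha j hj, sub_self]
      have hNG : ∀ k : ℕ, whit ρ r mu k (G (M + 1)) =
          if k = 0 then (sgn A r * (γ' (r - (M + 1)) - γ (r - (M + 1)))) • 1 else 0 := by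
        intro k
        rw [← opN_apply_of_eq_zero ρ mu γ Δ hr _ hG0, hG, map_sub, Pi.sub_apply, map_sum,
          Finset.sum_apply, hN]
        rw [Finset.sum_eq_zero (s := Finset.range (M + 1)), sub_zero,
          Finset.sum_eq_single_of_mem (r - (M + 1)) (Finset.mem_range.2 (by omega))]
        · rw [Nat.cast_sub hM]
          by_cases hk : k = 0
          · rw [if_pos hk, hk, show (M : ℤ) + 1 - ((r + 0 : ℕ) - (r - (M + 1 : ℕ))) = 0 by
              push_cast; ring, h0', smul_smul, add_zero]
          · rw [if_neg hk, hneg' _ (by push_cast; omega), smul_zero, smul_zero]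
        · intro s hs hs'
          rw [Finset.mem_range] at hs
          rcases lt_or_gt_of_ne hs' with h1 | h1
          · rw [hneg' _ (by push_cast; omega), smul_zero]
          · rw [ih s (by omega) (by omega), sub_self, zero_smul]
        · intro i hi
          rw [Finset.mem_range] at hi
          rw [map_smul, opN_shift, hf, map_zero, zero_sub, Pi.smul_apply, Pi.neg_apply,
            Pi.smul_apply, shift_apply]
          rcases Nat.eq_zero_or_pos i with h1 | h1
          · simp [h1]
          · rw [hneg _ (by push_cast; omega)]; simp
      have h1 := eq_C_of_whit_eq_zero ρ r mu hlam hr (p := G (M + 1)) (fun k => by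
        rw [hNG, if_neg (by omega)])
      set u := MvPolynomial.constantCoeff (G (M + 1))
      have h2 := hNG 0
      rw [h1, if_pos rfl, ← mul_one (MvPolynomial.C u), ← MvPolynomial.smul_eq_C_mul, map_smul,
        whit_one, smul_zero] at h2
      have h3 : γ' (r - (M + 1)) - γ (r - (M + 1)) = 0 := by
        have h4 := congrArg MvPolynomial.constantCoeff h2
        simp only [map_zero, MvPolynomial.smul_eq_C_mul, mul_one,
          MvPolynomial.constantCoeff_C] at h4
        have h5 := sgn_mul_self A (r : ℤ)
        linear_combination -(sgn A r) * h4 - (γ' (r - (M + 1)) - γ (r - (M + 1))) * h5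
      refine ⟨fun s h4 h5 => ?_, Function.update a (M + 1) u, ?_, fun j hj => ?_⟩
      · rcases eq_or_ne s (r - (M + 1)) with rfl | h6
        · exact sub_eq_zero.1 h3
        · exact ih s (by omega) h5
      · rw [Function.update_of_ne (by omega), ha0]
      · rw [Finset.sum_range_succ, Function.update_self]
        have h3 : ∑ i ∈ Finset.range (M + 1), Function.update a (M + 1) u i • f (j - i) =
            ∑ i ∈ Finset.range (M + 1), a i • f (j - i) := by
          refine Finset.sum_congr rfl fun i hi => ?_
          rw [Finset.mem_range] at hi
          rw [Function.update_of_ne (by omega)]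
        rw [h3]
        rcases lt_or_ge j (M + 1) with h4 | h4
        · rw [hneg _ (by push_cast; omega), smul_zero, add_zero, ha j h4]
        · obtain rfl : j = M + 1 := by push_cast at hj; omega
          rw [Nat.cast_succ, sub_self, h0, MvPolynomial.smul_eq_C_mul, mul_one, ← h1, hGa,
            add_sub_cancel]
  have hγ' : ∀ s ≤ r, γ' s = γ s := fun s hs => (hδ r le_rfl).1 s (by omega) hs
  refine ⟨hγ', ?_⟩
  have h := (eq_smul_of_opN_eq ρ mu γ Δ hlam hneg h0 hf hr hneg' (ψ := 0) (fun k => by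
    rw [opN_congr ρ mu Δ (fun s hs => (hγ' s hs).symm), hf']; simp)).2
  rwa [h0', map_one, one_smul] at h

end Uniqueness

/-! ### Change of coefficients -/

section ChangeOfCoefficients

variable {A B : Type*} [CommRing A] [Algebra ℂ A] [CommRing B] [Algebra ℂ B]

/-- A map between Fock spaces that commutes with the oscillators and with `rot` commutes with the
Virasoro operators. -/
theorem vir0_comm (σ : MvPolynomial ℕ A →+ MvPolynomial ℕ B)
    (ho : ∀ n p, σ (osc A n p) = osc B n (σ p)) (hrot : ∀ n p, σ (rot A n p) = rot B n (σ p))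
    (hs : ∀ (c : ℂ) p, σ (algebraMap ℂ A c • p) = algebraMap ℂ B c • σ p) (ρ : ℂ) (n : ℤ)
    (p : MvPolynomial ℕ A) : σ (vir0 A ρ n p) = vir0 B ρ n (σ p) := by
  simp only [vir0, quad, LinearMap.sub_apply, LinearMap.add_apply, LinearMap.smul_apply, map_sub,
    map_add, hs, LinearMap.sum_apply, map_sum, Module.End.mul_apply, ho]
  congr 2
  exact hrot n p

section Map

variable (φ : A →ₐ[ℂ] B)

/-- The map on Fock spaces induced by a homomorphism of coefficient rings. -/
noncomputable abbrev fockMap : MvPolynomial ℕ A →+* MvPolynomial ℕ B :=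
  MvPolynomial.map (φ : A →+* B)

theorem fockMap_smul (a : A) (p : MvPolynomial ℕ A) :
    fockMap φ (a • p) = φ a • fockMap φ p := by
  rw [MvPolynomial.smul_eq_C_mul, map_mul, MvPolynomial.map_C, MvPolynomial.smul_eq_C_mul]; rfl

theorem fockMap_xvar (k : ℤ) : fockMap φ (xvar A k) = xvar B k := by
  simp only [xvar]; split_ifs <;> simp

theorem fockMap_osc (n : ℤ) (p : MvPolynomial ℕ A) :
    fockMap φ (osc A n p) = osc B n (fockMap φ p) := by
  rw [osc_apply, osc_apply, map_add, map_mul, fockMap_xvar]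
  congr 1
  simp only [annih]
  split_ifs
  · rw [Derivation.smul_apply, Derivation.smul_apply, map_zsmul, MvPolynomial.pderiv_map]
  · simp

theorem fockMap_rot (n : ℤ) (p : MvPolynomial ℕ A) :
    fockMap φ (rot A n p) = rot B n (fockMap φ p) := by
  induction p using MvPolynomial.induction_on with
  | C a => rw [MvPolynomial.derivation_C, map_zero, MvPolynomial.map_C, MvPolynomial.derivation_C]
  | add p q hp hq => simp only [map_add, hp, hq]
  | mul_X p j hp =>
    rw [Derivation.leibniz, map_add, map_mul, Derivation.leibniz, smul_eq_mul, smul_eq_mul,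
      smul_eq_mul, smul_eq_mul, map_mul, map_mul, hp, MvPolynomial.map_X, rot, rot,
      MvPolynomial.mkDerivation_X, MvPolynomial.mkDerivation_X, map_mul, fockMap_xvar]
    simp

variable (ρ : ℂ) (r : ℕ) (mu : ℕ → A) (γ : ℕ → A) (Δ : A)

theorem map_ell (n : ℤ) : φ (ell ρ r mu n) = ell ρ r (φ ∘ mu) n := by
  simp only [ell, map_sub, map_mul, map_sum, AlgHom.commutes, apply_ite φ, map_zero,
    Function.comp_apply]

theorem fockMap_vir (n : ℤ) (p : MvPolynomial ℕ A) :
    fockMap φ (vir ρ r mu n p) = vir ρ r (φ ∘ mu) n (fockMap φ p) := by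
  simp only [vir, LinearMap.add_apply, LinearMap.sum_apply, LinearMap.smul_apply, map_add, map_sum,
    fockMap_smul, fockMap_osc, map_ell, Module.End.one_apply, Function.comp_apply]
  congr 2
  exact vir0_comm (fockMap φ).toAddMonoidHom (fockMap_osc φ) (fockMap_rot φ)
    (fun c p => by
      change fockMap φ _ = _ • fockMap φ p
      rw [fockMap_smul, φ.commutes]) ρ n p

theorem map_sgn (k : ℤ) : φ (sgn A k) = sgn B k := by simp [sgn]

/-- Formal solutions are mapped to formal solutions by a change of coefficients. -/
theorem fockMap_opN (k : ℕ) (f : ℤ → MvPolynomial ℕ A) (M : ℤ) :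
    opN ρ r (φ ∘ mu) (φ ∘ γ) (φ Δ) k (fun m => fockMap φ (f m)) M =
      fockMap φ (opN ρ r mu γ Δ k f M) := by
  simp only [opN, LinearMap.sub_apply, Pi.sub_apply, opT_apply, LinearMap.smul_apply,
    Module.End.one_apply, Pi.smul_apply, map_sub, map_add, map_sum, fockMap_smul, fockMap_vir,
    map_mul, map_sgn, map_ell, apply_ite φ, map_zero, map_intCast, Function.comp_apply]

theorem fockMap_virRep_list (l : List ℤ) (p : MvPolynomial ℕ A) :
    fockMap φ ((l.map fun i => vir ρ r mu i).prod p) =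
      (l.map fun i => vir ρ r (φ ∘ mu) i).prod (fockMap φ p) := by
  induction l with
  | nil => rfl
  | cons a l ih =>
    rw [List.map_cons, List.prod_cons, Module.End.mul_apply, fockMap_vir, ih, List.map_cons,
      List.prod_cons, Module.End.mul_apply]

theorem virRep_Lneg {k : ℕ} (μ : Nat.Partition k) :
    virRep (isVir_vir ρ r mu) (Lneg A (1 - 12 * ρ ^ 2) r μ) =
      (((μ.parts.sort (· ≥ ·)).map fun i : ℕ => (r : ℤ) - i).map fun i => vir ρ r mu i).prod := by
  rw [Lneg, map_list_prod, List.map_map, List.map_map]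
  congr 2
  funext i
  simp [virRep_L]

theorem fockMap_virRep_Lneg {k : ℕ} (μ : Nat.Partition k) (p : MvPolynomial ℕ A) :
    fockMap φ (virRep (isVir_vir ρ r mu) (Lneg A (1 - 12 * ρ ^ 2) r μ) p) =
      virRep (isVir_vir ρ r (φ ∘ mu)) (Lneg B (1 - 12 * ρ ^ 2) r μ) (fockMap φ p) := by
  rw [virRep_Lneg, virRep_Lneg, fockMap_virRep_list]

end Map

section CoefDer

variable (δ : Derivation ℂ A A)

/-- The coefficientwise action of a derivation of the coefficient ring. -/
noncomputable def coefD : MvPolynomial ℕ A →+ MvPolynomial ℕ A where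
  toFun p := (MvPolynomial.basisMonomials ℕ A).repr.symm
    (Finsupp.mapRange δ (map_zero δ) ((MvPolynomial.basisMonomials ℕ A).repr p))
  map_zero' := by simp
  map_add' p q := by rw [map_add, Finsupp.mapRange_add (by simp), map_add]

theorem coeff_coefD (s : ℕ →₀ ℕ) (p : MvPolynomial ℕ A) :
    (coefD δ p).coeff s = δ (p.coeff s) := rfl

theorem coefD_monomial (s : ℕ →₀ ℕ) (a : A) :
    coefD δ (MvPolynomial.monomial s a) = MvPolynomial.monomial s (δ a) := by
  ext t
  rw [coeff_coefD, MvPolynomial.coeff_monomial, MvPolynomial.coeff_monomial, apply_ite δ, map_zero]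

theorem coefD_smul (a : A) (p : MvPolynomial ℕ A) :
    coefD δ (a • p) = δ a • p + a • coefD δ p := by
  ext t
  simp only [coeff_coefD, MvPolynomial.coeff_smul, MvPolynomial.coeff_add, smul_eq_mul,
    Derivation.leibniz]
  ring

theorem coefD_mul (p q : MvPolynomial ℕ A) :
    coefD δ (p * q) = coefD δ p * q + p * coefD δ q := by
  induction p using MvPolynomial.induction_on' with
  | add p p' hp hp' => simp only [add_mul, map_add, hp, hp']; ring
  | monomial s a =>
    induction q using MvPolynomial.induction_on' with
    | add q q' hq hq' => simp only [mul_add, map_add, hq, hq']; ring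
    | monomial t b =>
      simp only [coefD_monomial, MvPolynomial.monomial_mul, Derivation.leibniz, smul_eq_mul,
        map_add, mul_comm b, add_comm]

theorem coefD_C (a : A) : coefD δ (MvPolynomial.C a) = MvPolynomial.C (δ a) :=
  coefD_monomial δ 0 a

theorem coefD_one : coefD δ 1 = 0 := by
  rw [← MvPolynomial.C_1, coefD_C, Derivation.map_one_eq_zero, MvPolynomial.C_0]

theorem coefD_X (j : ℕ) : coefD δ (MvPolynomial.X j) = 0 := by
  rw [MvPolynomial.X, coefD_monomial, Derivation.map_one_eq_zero, MvPolynomial.monomial_zero]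

theorem coefD_xvar (k : ℤ) : coefD δ (xvar A k) = 0 := by
  simp only [xvar]; split_ifs
  · exact coefD_X δ _
  · exact map_zero _

theorem coefD_intCast (n : ℤ) : coefD δ (n : MvPolynomial ℕ A) = 0 := by
  rw [← map_intCast (MvPolynomial.C : A →+* MvPolynomial ℕ A), coefD_C]; simp

theorem coefD_derivation (D : Derivation A (MvPolynomial ℕ A) (MvPolynomial ℕ A))
    (h : ∀ j, coefD δ (D (MvPolynomial.X j)) = 0) (p : MvPolynomial ℕ A) :
    coefD δ (D p) = D (coefD δ p) := by
  induction p using MvPolynomial.induction_on with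
  | C a => rw [coefD_C, MvPolynomial.derivation_C, MvPolynomial.derivation_C, map_zero]
  | add p q hp hq => simp only [map_add, hp, hq]
  | mul_X p j hp =>
    simp only [Derivation.leibniz, map_add, smul_eq_mul, coefD_mul, hp, h, coefD_X, mul_zero, add_zero]
    ring

theorem coefD_osc (n : ℤ) (p : MvPolynomial ℕ A) : coefD δ (osc A n p) = osc A n (coefD δ p) := by
  rw [osc_apply, osc_apply, map_add, coefD_mul, coefD_xvar, zero_mul, zero_add,
    coefD_derivation δ (annih A n)]
  intro j
  rw [← xvar_natCast_succ, annih_xvar]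
  split_ifs
  · exact coefD_intCast δ _
  · exact map_zero _

theorem coefD_rot (n : ℤ) (p : MvPolynomial ℕ A) : coefD δ (rot A n p) = rot A n (coefD δ p) :=
  coefD_derivation δ _ (fun j => by
    rw [rot, MvPolynomial.mkDerivation_X, coefD_mul, coefD_xvar, map_add, ← Int.cast_natCast, coefD_intCast, coefD_one]
    simp) p

variable (ρ : ℂ) (r : ℕ) (mu : ℕ → A)

theorem coefD_vir0 (n : ℤ) (p : MvPolynomial ℕ A) :
    coefD δ (vir0 A ρ n p) = vir0 A ρ n (coefD δ p) :=
  vir0_comm (coefD δ) (coefD_osc δ) (coefD_rot δ)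
    (fun c p => by rw [coefD_smul, Derivation.map_algebraMap, zero_smul, zero_add]) ρ n p

theorem coefD_vir (n : ℤ) (p : MvPolynomial ℕ A) :
    coefD δ (vir ρ r mu n p) = vir ρ r mu n (coefD δ p) +
      ∑ i ∈ Finset.range (r + 1), δ (mu i) • osc A (n - i) p + δ (ell ρ r mu n) • p := by
  simp only [vir, LinearMap.add_apply, LinearMap.sum_apply, LinearMap.smul_apply, map_add, map_sum,
    coefD_smul, coefD_osc, coefD_vir0, Module.End.one_apply, Finset.sum_add_distrib]
  abel

theorem derivation_ell (n : ℤ) : δ (ell ρ r mu n) =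
    (∑ i ∈ Finset.range (r + 1), ∑ j ∈ Finset.range (r + 1),
      if (i + j : ℤ) = n then δ (mu i) * mu j else 0) -
    algebraMap ℂ A (ρ * (n + 1)) * ∑ i ∈ Finset.range (r + 1), if (i : ℤ) = n then δ (mu i) else 0 := by
  have h2 : algebraMap ℂ A (1 / 2) * 2 = 1 := by
    rw [← map_ofNat (algebraMap ℂ A) 2, ← map_mul]; norm_num
  have h1 : ∑ i ∈ Finset.range (r + 1), ∑ j ∈ Finset.range (r + 1),
      (if (i + j : ℤ) = n then mu i * δ (mu j) else 0) = ∑ i ∈ Finset.range (r + 1),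
      ∑ j ∈ Finset.range (r + 1), if (i + j : ℤ) = n then δ (mu i) * mu j else 0 := by
    rw [Finset.sum_comm]
    refine Finset.sum_congr rfl fun i _ => Finset.sum_congr rfl fun j _ => ?_
    rw [add_comm (j : ℤ), mul_comm]
  have h3 : ∀ i j : ℕ, δ (if (i + j : ℤ) = n then mu i * mu j else 0) =
      (if (i + j : ℤ) = n then mu i * δ (mu j) else 0) +
      (if (i + j : ℤ) = n then δ (mu i) * mu j else 0) := by
    intro i j
    split_ifs
    · rw [Derivation.leibniz, smul_eq_mul, smul_eq_mul, mul_comm (mu j)]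
    · simp
  rw [ell, map_sub, Derivation.leibniz, Derivation.leibniz, Derivation.map_algebraMap,
    Derivation.map_algebraMap, map_sum, map_sum]
  simp only [map_sum, h3, apply_ite δ, map_zero, Finset.sum_add_distrib, h1,
    smul_eq_mul]
  linear_combination (∑ i ∈ Finset.range (r + 1), ∑ j ∈ Finset.range (r + 1),
      if (i + j : ℤ) = n then δ (mu i) * mu j else 0) * h2

end CoefDer

end ChangeOfCoefficients

/-! ### Vector fields in the parameters -/

section ParameterDerivations

variable {r : ℕ} {A : Type*} [CommRing A] (lam : ℕ → A)

section Module

variable {N : Type*} [AddCommGroup N] [Module A N]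

theorem D_eq_zero (der : Finset.Icc 1 r → N → N) {k : ℕ} (hk : r ≤ k) (x : N) :
    D lam der k x = 0 := by
  refine Finset.sum_eq_zero fun p _ => ?_
  have := (Finset.mem_Icc.1 p.2).1
  rw [if_neg (by omega)]

theorem D_add (der : Finset.Icc 1 r → (N →+ N)) (k : ℕ) (x y : N) :
    D lam (fun q => der q) k (x + y) = D lam (fun q => der q) k x + D lam (fun q => der q) k y := by
  rw [D, D, D, ← Finset.sum_add_distrib]
  refine Finset.sum_congr rfl fun p _ => ?_
  split_ifs
  · rw [map_add, smul_add]
  · rw [add_zero]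

theorem D_comm {der : Finset.Icc 1 r → N → N} {N' : Type*} [AddCommGroup N'] [Module A N']
    {der' : Finset.Icc 1 r → N' → N'} (ℓ : N →ₗ[A] N') (h : ∀ q x, ℓ (der q x) = der' q (ℓ x))
    (k : ℕ) (x : N) : ℓ (D lam der k x) = D lam der' k (ℓ x) := by
  rw [D, D, map_sum]
  refine Finset.sum_congr rfl fun p _ => ?_
  split_ifs
  · rw [map_smul, h]
  · rw [map_zero]

variable [Algebra ℂ A] (pd : Finset.Icc 1 r → Derivation ℂ A A)

theorem D_smul {der : Finset.Icc 1 r → N → N}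
    (h : ∀ q (a : A) x, der q (a • x) = pd q a • x + a • der q x) (k : ℕ) (a : A) (x : N) :
    D lam der k (a • x) = D lam (fun q => pd q) k a • x + a • D lam der k x := by
  rw [D, D, D, Finset.sum_smul, Finset.smul_sum, ← Finset.sum_add_distrib]
  refine Finset.sum_congr rfl fun p _ => ?_
  split_ifs
  · rw [h, smul_add, smul_smul, smul_smul, smul_smul, mul_comm a, smul_eq_mul]
  · simp

end Module

variable [Algebra ℂ A] (pd : Finset.Icc 1 r → Derivation ℂ A A)

/-- The vector field `D_k = ∑ p λ_{p+k} ∂/∂λ_p` as a derivation of the coefficient ring. -/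
noncomputable def Dder (k : ℕ) : Derivation ℂ A A :=
  ∑ p : Finset.Icc 1 r, if (p : ℕ) + k ≤ r then (((p : ℕ) : A) * lam ((p : ℕ) + k)) • pd p else 0

theorem Dder_apply (k : ℕ) (a : A) : Dder lam pd k a = D lam (fun q => pd q) k a := by
  rw [Dder, D, derivation_sum_apply]
  refine Finset.sum_congr rfl fun p _ => ?_
  split_ifs <;> simp

theorem Dder_of_pd_eq {k i : ℕ} {x : A} (hi : i ≤ r)
    (h : ∀ q : Finset.Icc 1 r, pd q x = if i = (q : ℕ) then 1 else 0) :
    Dder lam pd k x = if i + k ≤ r then (i : A) * lam (i + k) else 0 := by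
  rw [Dder_apply, D]
  rcases Nat.eq_zero_or_pos i with rfl | hi0
  · rw [Finset.sum_eq_zero]
    · simp
    · intro p _
      have := (Finset.mem_Icc.1 p.2).1
      have h0 : pd p x = 0 := by rw [h, if_neg (by omega)]
      simp [h0]
  · rw [Finset.sum_eq_single (⟨i, Finset.mem_Icc.2 ⟨hi0, hi⟩⟩ : Finset.Icc 1 r)]
    · rw [h, if_pos rfl, smul_eq_mul, mul_one]
    · intro p _ hp
      have : i ≠ (p : ℕ) := fun hc => hp (Subtype.ext hc.symm)
      have h0 : pd p x = 0 := by rw [h, if_neg this]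
      simp [h0]
    · intro hc; exact absurd (Finset.mem_univ _) hc

/-- If `δ` acts on the momenta as the vector field `D_n`, then `δ ℓ_m = (m - n) ℓ_{m+n}` for `m ≥ r`. -/
theorem Dder_ell (ρ : ℂ) {mu : ℕ → A} {δ : Derivation ℂ A A} {n : ℕ}
    (h : ∀ i ≤ r, δ (mu i) = if i + n ≤ r then (i : A) * mu (i + n) else 0) {m : ℕ} (hm : r ≤ m) :
    δ (ell ρ r mu m) = ((m : A) - n) * ell ρ r mu (m + n) := by
  have h1 : ∑ i ∈ Finset.range (r + 1), ∑ j ∈ Finset.range (r + 1),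
      (if (i + j : ℤ) = m then δ (mu i) * mu j else 0) =
      -∑ i ∈ Finset.range (r + 1), ∑ j ∈ Finset.range (r + 1),
      (if (i + j : ℤ) = (n : ℤ) + m then mu i * mu j * (((n : ℤ) - i : ℤ) : A) else 0) := by
    rw [Finset.sum_comm]
    conv_rhs => rw [Finset.sum_comm]
    rw [← Finset.sum_neg_distrib]
    refine Finset.sum_congr rfl fun j hj => ?_
    rw [Finset.mem_range] at hj
    have e1 : ∀ i : ℕ, (if (i + j : ℤ) = m then δ (mu i) * mu j else 0) =
        if i = m - j then δ (mu i) * mu j else 0 := fun i => if_congr (by omega) rfl rfl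
    have e2 : ∀ i : ℕ, (if (i + j : ℤ) = (n : ℤ) + m then mu i * mu j * (((n : ℤ) - i : ℤ) : A) else 0) =
        if i = m - j + n then mu i * mu j * (((n : ℤ) - i : ℤ) : A) else 0 :=
      fun i => if_congr (by omega) rfl rfl
    simp only [e1, e2, Finset.sum_ite_eq', Finset.mem_range]
    by_cases h2 : m - j + n ≤ r
    · rw [if_pos (by omega), if_pos (by omega), h _ (by omega), if_pos h2]
      push_cast
      ring
    · rw [if_neg (c := m - j + n < r + 1) (by omega), neg_zero]
      split_ifs with h3
      · rw [h _ (by omega), if_neg h2, zero_mul]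
      · rfl
  have h2 : ∑ i ∈ Finset.range (r + 1), (if (i : ℤ) = m then δ (mu i) else 0) =
      ((m : A) - n) * ∑ i ∈ Finset.range (r + 1), if (i : ℤ) = (m : ℤ) + n then mu i else 0 := by
    simp only [← Nat.cast_add, Nat.cast_inj, Finset.sum_ite_eq', Finset.mem_range]
    by_cases h3 : m + n ≤ r
    · obtain rfl : n = 0 := by omega
      rw [if_pos (by omega), if_pos (by omega), h _ (by omega), if_pos (by omega)]
      simp
    · rw [if_neg (c := m + n < r + 1) (by omega), mul_zero]
      split_ifs with h4
      · rw [h _ (by omega), if_neg h3]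
      · rfl
  have h3 : algebraMap ℂ A (ρ * ((m : ℤ) + 1)) * (((m : A) - n) *
      ∑ i ∈ Finset.range (r + 1), if (i : ℤ) = (m : ℤ) + n then mu i else 0) =
      ((m : A) - n) * (algebraMap ℂ A (ρ * (((m : ℤ) + n : ℤ) + 1)) *
      ∑ i ∈ Finset.range (r + 1), if (i : ℤ) = (m : ℤ) + n then mu i else 0) := by
    rcases Nat.eq_zero_or_pos n with rfl | hn
    · simp; ring_nf
    · rw [Finset.sum_eq_zero]
      · simp
      · intro i hi
        rw [Finset.mem_range] at hi
        rw [if_neg (by omega)]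
  rw [derivation_ell, h1, sum_ite_mul_sub, h2, ell, h3, add_comm (n : ℤ)]
  push_cast
  ring

end ParameterDerivations

/-! ### A connection on the Fock space -/

section Connection

variable {A : Type*} [CommRing A] [Algebra ℂ A]

/-- The operator `δ + x_q / q + s` on the Fock space, for a derivation `δ` of the coefficient ring. -/
noncomputable def nab (δ : Derivation ℂ A A) (q : ℕ) (s : A) : MvPolynomial ℕ A →+ MvPolynomial ℕ A where
  toFun p := coefD δ p + algebraMap ℂ A (1 / q) • (xvar A q * p) + s • p
  map_zero' := by simp
  map_add' x y := by rw [map_add, mul_add, smul_add, smul_add]; abel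

theorem nab_apply (δ : Derivation ℂ A A) (q : ℕ) (s : A) (p : MvPolynomial ℕ A) :
    nab δ q s p = coefD δ p + algebraMap ℂ A (1 / q) • (xvar A q * p) + s • p := rfl

theorem nab_smul (δ : Derivation ℂ A A) (q : ℕ) (s a : A) (p : MvPolynomial ℕ A) :
    nab δ q s (a • p) = δ a • p + a • nab δ q s p := by
  rw [nab_apply, nab_apply, coefD_smul, mul_smul_comm]
  module

/-- When `δ μ_i = δ_{iq}`, the operator `δ + x_q / q + s` commutes with the Virasoro operators: the
change of `μ_q` under `δ` is compensated by the commutator with the oscillator `a_{-q}`. -/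
theorem nab_vir (ρ : ℂ) {r : ℕ} {mu : ℕ → A} {δ : Derivation ℂ A A} {q : ℕ} (hq : 1 ≤ q)
    (hqr : q ≤ r) (h : ∀ i ≤ r, δ (mu i) = if i = q then 1 else 0) (s : A) (n : ℤ)
    (p : MvPolynomial ℕ A) : nab δ q s (vir ρ r mu n p) = vir ρ r mu n (nab δ q s p) := by
  have hx : ∀ p, xvar A q * p = osc A (-q) p := fun p => by
    rw [osc_apply, annih_of_nonpos (by omega), neg_neg]; simp
  have hq0 : algebraMap ℂ A (1 / q) * (q : A) = 1 := by
    rw [← map_natCast (algebraMap ℂ A), ← map_mul, one_div_mul_cancel, map_one]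
    exact Nat.cast_ne_zero.2 (by omega)
  have h1 : ∑ i ∈ Finset.range (r + 1), δ (mu i) • osc A (n - i) p = osc A (n - q) p := by
    rw [Finset.sum_eq_single_of_mem q (Finset.mem_range.2 (by omega)), h q hqr, if_pos rfl, one_smul]
    intro i hi hne
    rw [h i (by simpa [Nat.lt_succ_iff] using hi), if_neg hne, zero_smul]
  set t : A := ∑ i ∈ Finset.range (r + 1), if (i : ℤ) = n - q then mu i else 0 with ht
  have h2 : δ (ell ρ r mu n) = t - if n = q then algebraMap ℂ A (ρ * (n + 1)) else 0 := by
    rw [derivation_ell]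
    congr 1
    · rw [Finset.sum_eq_single_of_mem q (Finset.mem_range.2 (by omega)), ht]
      · refine Finset.sum_congr rfl fun j _ => ?_
        rw [h q hqr, if_pos rfl, one_mul]
        exact if_congr (by omega) rfl rfl
      · intro i hi hne
        refine Finset.sum_eq_zero fun j _ => ?_
        rw [h i (by simpa [Nat.lt_succ_iff] using hi), if_neg hne, zero_mul, ite_self]
    · rw [Finset.sum_eq_single_of_mem q (Finset.mem_range.2 (by omega)), h q hqr, if_pos rfl]
      · by_cases hn : n = q
        · rw [if_pos hn.symm, if_pos hn, mul_one]
        · rw [if_neg (Ne.symm hn), if_neg hn, mul_zero]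
      · intro i hi hne
        rw [h i (by simpa [Nat.lt_succ_iff] using hi), if_neg hne, ite_self]
  have h3 : ⁅vir ρ r mu n, osc A (-q)⁆ = (q : A) • (osc A (n - q) +
      (t - if n = q then algebraMap ℂ A (ρ * (n + 1)) else 0) • 1) := by
    have e1 : ∑ i ∈ Finset.range (r + 1), mu i • (if n - (i : ℤ) + -(q : ℤ) = 0 then
        ((n - i : ℤ) : Module.End A (MvPolynomial ℕ A)) else 0) = ((q : A) * t) • 1 := by
      rw [ht, Finset.mul_sum, Finset.sum_smul]
      refine Finset.sum_congr rfl fun i _ => ?_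
      by_cases hi : (i : ℤ) = n - q
      · rw [if_pos hi, if_pos (by omega), show n - (i : ℤ) = q by omega]
        apply LinearMap.ext; intro x
        simp only [LinearMap.smul_apply, Int.cast_natCast, Module.End.natCast_apply,
          Module.End.one_apply, ← Nat.cast_smul_eq_nsmul A, smul_smul, mul_comm]
      · rw [if_neg hi, if_neg (by omega)]; simp
    rw [vir, add_rlie, add_rlie, smul_one_rlie, sum_rlie, lie_vir0_osc]
    simp only [smul_rlie, lie_osc, e1, add_zero, neg_neg]
    by_cases hn : n = q
    · rw [if_pos (by omega), if_pos hn, hn]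
      apply LinearMap.ext; intro x
      simp only [LinearMap.add_apply, LinearMap.sub_apply, LinearMap.smul_apply, map_mul,
        Module.End.one_apply, ← Int.cast_smul_eq_zsmul A, Int.cast_natCast, map_natCast]
      rw [← sub_eq_add_neg]
      module
    · rw [if_neg (by omega), if_neg hn, ← sub_eq_add_neg]
      apply LinearMap.ext; intro x
      simp only [LinearMap.add_apply, LinearMap.sub_apply, LinearMap.smul_apply,
        Module.End.one_apply, ← Int.cast_smul_eq_zsmul A, Int.cast_natCast, LinearMap.zero_apply]
      module
  have h4 := LinearMap.congr_fun h3 p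
  simp only [Ring.lie_def, LinearMap.sub_apply, Module.End.mul_apply, LinearMap.smul_apply,
    LinearMap.add_apply, Module.End.one_apply] at h4
  rw [nab_apply, nab_apply, coefD_vir, h1, h2, map_add, map_add, map_smul, map_smul, hx, hx,
    sub_eq_iff_eq_add.1 h4, smul_add, smul_smul, hq0, one_smul]
  abel

end Connection

/-! ### The momenta -/

section Momentum

variable {r : ℕ} {A : Type*} [CommRing A] (lam : ℕ → A) (lamInv B : A)

variable (r) in
/-- The momenta of the Fock space that realizes the irregular Verma module: only `λ_0` is shifted,
so that the eigenvalue of `L_r` receives the contribution of `β_r`. -/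
def mom (i : ℕ) : A := if i = 0 then lam 0 + sgn A (r + 1) * (r * B * lamInv) else lam i

theorem mom_of_pos {i : ℕ} (hi : 1 ≤ i) : mom r lam lamInv B i = lam i := if_neg (by omega)

variable [Algebra ℂ A] (pd : Finset.Icc 1 r → Derivation ℂ A A)
  (hlam : lam r * lamInv = 1)
  (hpd : ∀ (q : Finset.Icc 1 r) (i : ℕ), i ≤ r → pd q (lam i) = if i = (q : ℕ) then 1 else 0)
  (hB : ∀ q : Finset.Icc 1 r, lam r * pd q B = if (q : ℕ) = r then B else 0)

include hlam in
/-- The shift of `λ_0` changes only the eigenvalue of `L_r`. -/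
theorem ell_mom (ρ : ℂ) (hr : 1 ≤ r) {n : ℕ} (hn : r ≤ n) :
    ell ρ r (mom r lam lamInv B) n =
      ell ρ r lam n + if n = r then sgn A (r + 1) * (r * B) else 0 := by
  set ε := sgn A (r + 1) * (r * B * lamInv) with hε
  have h1 : ∑ i ∈ Finset.range (r + 1), (if (i : ℤ) = n then mom r lam lamInv B i else 0) =
      ∑ i ∈ Finset.range (r + 1), (if (i : ℤ) = n then lam i else 0) := by
    refine Finset.sum_congr rfl fun i _ => ?_
    split_ifs
    · rw [mom_of_pos _ _ _ (by omega)]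
    · rfl
  have h2 : ∀ i j : ℕ, i ≤ r → j ≤ r → (if (i + j : ℤ) = n then
      mom r lam lamInv B i * mom r lam lamInv B j else 0) =
      (if (i + j : ℤ) = n then lam i * lam j else 0) +
      ((if i = 0 then if j = r then if n = r then ε * lam r else 0 else 0 else 0) +
      (if j = 0 then if i = r then if n = r then ε * lam r else 0 else 0 else 0)) := by
    intro i j hi hj
    by_cases h : (i + j : ℤ) = n
    · rw [if_pos h, if_pos h]
      have hr0 : r ≠ 0 := by omega
      rcases Nat.eq_zero_or_pos i with hi0 | hi0
      · have hj' : j = r := by omega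
        have hn' : n = r := by omega
        simp only [hi0, hj', hn', mom, ← hε, if_true, if_neg hr0]
        ring
      rcases Nat.eq_zero_or_pos j with hj0 | hj0
      · have hi' : i = r := by omega
        have hn' : n = r := by omega
        simp only [hj0, hi', hn', mom, ← hε, if_true, if_neg hr0]
        ring
      · rw [mom_of_pos _ _ _ hi0, mom_of_pos _ _ _ hj0, if_neg (c := i = 0) (by omega),
          if_neg (c := j = 0) (by omega)]
        ring
    · rw [if_neg h, if_neg h]
      have h3 : (if i = 0 then if j = r then if n = r then ε * lam r else 0 else 0 else 0) = 0 := by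
        split_ifs <;> first | rfl | omega
      have h4 : (if j = 0 then if i = r then if n = r then ε * lam r else 0 else 0 else 0) = 0 := by
        split_ifs <;> first | rfl | omega
      rw [h3, h4]; simp
  have h3 : algebraMap ℂ A (1 / 2) * 2 = 1 := by
    rw [← map_ofNat (algebraMap ℂ A) 2, ← map_mul]; norm_num
  have h4 : ∑ i ∈ Finset.range (r + 1), ∑ j ∈ Finset.range (r + 1), (if (i + j : ℤ) = n then
      mom r lam lamInv B i * mom r lam lamInv B j else 0) =
      ∑ i ∈ Finset.range (r + 1), ∑ j ∈ Finset.range (r + 1),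
        (if (i + j : ℤ) = n then lam i * lam j else 0) + 2 * if n = r then ε * lam r else 0 := by
    rw [Finset.sum_congr rfl fun i hi => Finset.sum_congr rfl fun j hj =>
      h2 i j (by simpa [Nat.lt_succ_iff] using hi) (by simpa [Nat.lt_succ_iff] using hj)]
    simp only [Finset.sum_add_distrib, two_mul]
    congr 2
    · rw [Finset.sum_comm]
      simp
    · simp
  have h5 : (if n = r then ε * lam r else 0) = if n = r then sgn A (r + 1) * (r * B) else 0 := by
    split_ifs
    · rw [hε]; linear_combination sgn A (r + 1) * r * B * hlam
    · rfl
  rw [ell, ell, h1, h4, h5]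
  linear_combination (if n = r then sgn A (r + 1) * ((r : A) * B) else 0) * h3

include hlam hB in
theorem pd_B (q : Finset.Icc 1 r) : pd q B = if (q : ℕ) = r then lamInv * B else 0 := by
  have h := hB q
  split_ifs with hq
  · rw [if_pos hq] at h
    linear_combination lamInv * h - pd q B * hlam
  · rw [if_neg hq] at h
    linear_combination lamInv * h - pd q B * hlam

include hlam hpd in
theorem pd_lamInv (q : Finset.Icc 1 r) :
    pd q lamInv = if (q : ℕ) = r then -(lamInv * lamInv) else 0 := by
  have h := congrArg (pd q) hlam
  rw [Derivation.leibniz, Derivation.map_one_eq_zero, hpd q r le_rfl, smul_eq_mul, smul_eq_mul] at h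
  split_ifs with hq
  · rw [if_pos hq.symm] at h
    linear_combination lamInv * h - pd q lamInv * hlam
  · rw [if_neg (Ne.symm hq)] at h
    linear_combination lamInv * h - pd q lamInv * hlam

include hlam hpd hB in
/-- The shift of `λ_0` is constant in `λ_1, …, λ_r`, by the homogeneity of `β_r`. -/
theorem pd_mom (q : Finset.Icc 1 r) {i : ℕ} (hi : i ≤ r) :
    pd q (mom r lam lamInv B i) = if i = (q : ℕ) then 1 else 0 := by
  have hq := (Finset.mem_Icc.1 q.2).1
  rcases Nat.eq_zero_or_pos i with rfl | hi0
  · have h1 : pd q (sgn A (r + 1)) = 0 := by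
      rw [sgn]; exact (pd q).map_intCast _
    have h2 : pd q (r : A) = 0 := (pd q).map_natCast _
    rw [mom, if_pos rfl, map_add, hpd q 0 hi, Derivation.leibniz, Derivation.leibniz,
      Derivation.leibniz, h1, h2, pd_B lam lamInv B pd hlam hB, pd_lamInv lam lamInv pd hlam hpd]
    split_ifs <;> simp only [smul_eq_mul] <;> ring
  · rw [mom_of_pos _ _ _ hi0, hpd q i hi]

include hlam hpd hB in
theorem Dder_mom (n : ℕ) {i : ℕ} (hi : i ≤ r) : Dder lam pd n (mom r lam lamInv B i) =
    if i + n ≤ r then (i : A) * mom r lam lamInv B (i + n) else 0 := by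
  rw [Dder_of_pd_eq lam pd hi fun q => pd_mom lam lamInv B pd hlam hpd hB q hi]
  rcases Nat.eq_zero_or_pos i with rfl | hi0
  · simp
  · rw [mom_of_pos _ _ _ (by omega)]

include hlam hB in
theorem Dder_B (hr : 1 ≤ r) (n : ℕ) : Dder lam pd n B = if n = 0 then (r : A) * B else 0 := by
  rw [Dder_apply, D, Finset.sum_eq_single (⟨r, Finset.mem_Icc.2 ⟨hr, le_rfl⟩⟩ : Finset.Icc 1 r)]
  · rw [pd_B lam lamInv B pd hlam hB, if_pos rfl]
    by_cases hn : n = 0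
    · subst hn
      rw [if_pos (by simp), if_pos rfl, smul_eq_mul, add_zero]
      linear_combination (r : A) * B * hlam
    · rw [if_neg (by simp; omega), if_neg hn]
  · intro p _ hp
    have : (p : ℕ) ≠ r := fun hc => hp (Subtype.ext hc)
    rw [pd_B lam lamInv B pd hlam hB, if_neg this]
    simp
  · intro hc; exact absurd (Finset.mem_univ _) hc

end Momentum

/-! ### Covariant derivatives of the formal solution -/

section Horizontal

variable {A : Type*} [CommRing A] [Algebra ℂ A] (ρ : ℂ) {r : ℕ} (mu γ : ℕ → A) (Δ : A)
  {δ : Derivation ℂ A A} {E : MvPolynomial ℕ A →+ MvPolynomial ℕ A}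
  (hE : ∀ (a : A) p, E (a • p) = δ a • p + a • E p)
  (hEv : ∀ (n : ℤ) p, E (vir ρ r mu n p) = vir ρ r mu n (E p)) (hΔ : δ Δ = 0)
include hE hEv hΔ

/-- An operator `E` that commutes with the Virasoro operators, and acts on coefficients by a derivation
`δ`, commutes with `opT` up to the derivatives of the exponents `γ_s`. -/
theorem opT_covariant (n : ℕ) (f : ℤ → MvPolynomial ℕ A) (M : ℤ) :
    opT ρ r mu γ Δ n (fun m => E (f m)) M = E (opT ρ r mu γ Δ n f M) +
      sgn A n • ∑ s ∈ Finset.range (r + 1), δ (γ s) • f (M - n + s) := by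
  have h1 : ∀ k : ℤ, ∀ c : ℤ, δ (sgn A k * c) = 0 := fun k c => by
    rw [sgn, ← Int.cast_mul]; exact δ.map_intCast _
  have h2 : ∀ k : ℤ, δ (sgn A k) = 0 := fun k => by rw [sgn]; exact δ.map_intCast _
  have h3 : ∀ i : ℕ, δ (if i = 0 then Δ else 0) = 0 := fun i => by split_ifs <;> simp [hΔ]
  have h4 : ∀ k : ℤ, δ (k : A) = 0 := fun k => δ.map_intCast _
  simp only [opT_apply, map_sub, map_add, map_sum, hE, hEv, h1, h2, h3, h4, zero_smul, zero_add,
    Finset.sum_add_distrib]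
  module

variable {f : ℤ → MvPolynomial ℕ A} (hf : ∀ k, opN ρ r mu γ Δ k f = 0)
  {n : ℕ} (hmu : ∀ i ≤ r, δ (mu i) = if i + n ≤ r then (i : A) * mu (i + n) else 0)
  (hγ : δ (γ r) = if n = 0 then (r : A) * γ r else 0)

omit hE hEv hΔ in
include hf in
theorem opT_eq_smul (k : ℕ) : opT ρ r mu γ Δ (r + k) f =
    (ell ρ r mu (r + k) - if k = 0 then sgn A r * γ r else 0) • f := by
  have h := hf k
  rw [opN, LinearMap.sub_apply, sub_eq_zero] at h
  exact h

include hf hmu hγ in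
/-- The operators `E` and `opT n` have the same commutator with `opN k` up to multiplication operators,
so that `E f - opT n f` solves inhomogeneous equations with right-hand sides `z^j f`. -/
theorem opN_covariant_sub (k : ℕ) :
    opN ρ r mu γ Δ k ((fun m => E (f m)) - opT ρ r mu γ Δ n f) = sgn A (r + k : ℕ) •
      ∑ s ∈ Finset.range (r + 1), δ (γ s) • shift A _ ((r + k : ℕ) - s) f := by
  set c : ℕ → A := fun k => ell ρ r mu (r + k) - if k = 0 then sgn A r * γ r else 0 with hc
  have hT : ∀ k, opT ρ r mu γ Δ (r + k) f = c k • f := opT_eq_smul ρ mu γ Δ hf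
  have hδ : δ (c k) = ((r + k : ℕ) - n : A) * c (k + n) := by
    have h1 := Dder_ell ρ hmu (m := r + k) (by omega)
    have h2 : δ (sgn A r) = 0 := by rw [sgn]; exact δ.map_intCast _
    have h3 : δ (if k = 0 then sgn A r * γ r else 0) =
        ((r + k : ℕ) - n : A) * if k + n = 0 then sgn A r * γ r else 0 := by
      by_cases hk : k = 0
      · subst hk
        rw [if_pos rfl, Derivation.leibniz, h2, hγ, zero_add]
        by_cases hn : n = 0
        · subst hn; simp; ring
        · rw [if_neg hn, if_neg (by omega)]; simp
      · rw [if_neg hk, if_neg (by omega), map_zero, mul_zero]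
    rw [hc]
    simp only
    rw [map_sub, h3, show (r : ℤ) + k = (r + k : ℕ) by push_cast; ring, h1,
      show (r : ℤ) + (k + n : ℕ) = (r + k : ℕ) + n by push_cast; ring]
    ring
  have h1 : opT ρ r mu γ Δ (r + k) (opT ρ r mu γ Δ n f) =
      c k • opT ρ r mu γ Δ n f + (((r + k : ℕ) - n : A) * c (k + n)) • f := by
    have h2 := LinearMap.congr_fun (lie_opT ρ r mu γ Δ (r + k) n) f
    rw [Ring.lie_def, LinearMap.sub_apply, Module.End.mul_apply, Module.End.mul_apply, hT, map_smul,
      LinearMap.smul_apply, add_assoc, hT, sub_eq_iff_eq_add] at h2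
    rw [h2, ← Int.cast_smul_eq_zsmul A, smul_smul, add_comm]
    push_cast
    rfl
  have h2 : opT ρ r mu γ Δ (r + k) (fun m => E (f m)) = c k • (fun m => E (f m)) +
      (((r + k : ℕ) - n : A) * c (k + n)) • f + sgn A (r + k : ℕ) •
      ∑ s ∈ Finset.range (r + 1), δ (γ s) • shift A _ ((r + k : ℕ) - s) f := by
    funext M
    rw [opT_covariant ρ mu γ Δ hE hEv hΔ, hT, Pi.smul_apply, hE, hδ]
    simp only [Pi.add_apply, Pi.smul_apply, Finset.sum_apply, shift_apply]
    rw [add_comm (c k • _)]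
    congr 2
    refine Finset.sum_congr rfl fun s _ => ?_
    congr 2; ring
  rw [opN, LinearMap.sub_apply, map_sub, h1, h2, LinearMap.smul_apply, Module.End.one_apply]
  change _ - c k • _ = _
  module

variable {lamInv : A} (hlam : mu r * lamInv = 1) (hneg : ∀ j < 0, f j = 0) (h0 : f 0 = 1)

include hf hmu hγ hlam hneg h0 in
/-- A covariant derivative of the formal solution agrees with the action of `opT` up to a
multiplication operator. -/
theorem covariant_eq_opT (hr : 1 ≤ r) : δ (γ 0) = 0 ∧ ∃ a : A, (fun m => E (f m)) =
    opT ρ r mu γ Δ n f + a • f + ∑ s ∈ Finset.Icc 1 r,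
      (algebraMap ℂ A (1 / s) * δ (γ s)) • shift A _ (-(s : ℤ)) f := by
  set h : ℤ → MvPolynomial ℕ A := (fun m => E (f m)) - opT ρ r mu γ Δ n f - ∑ s ∈ Finset.Icc 1 r,
      (algebraMap ℂ A (1 / s) * δ (γ s)) • shift A _ (-(s : ℤ)) f with hh
  have hN : ∀ k : ℕ, opN ρ r mu γ Δ k h = (sgn A (r + k : ℕ) * δ (γ 0)) •
      shift A _ (r + k : ℕ) f := by
    intro k
    rw [hh, map_sub, opN_covariant_sub ρ mu γ Δ hE hEv hΔ hf hmu hγ, map_sum, sub_eq_iff_eq_add,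
      Finset.range_eq_Ico, Finset.sum_eq_sum_Ico_succ_bot (by omega), smul_add, smul_smul]
    congr 1
    · rw [Finset.smul_sum]
      refine Finset.sum_congr (by ext; simp only [Finset.mem_Ico, Finset.mem_Icc]; omega) fun s hs => ?_
      rw [Finset.mem_Icc] at hs
      have hs0 : algebraMap ℂ A (1 / s) * (s : A) = 1 := by
        rw [← map_natCast (algebraMap ℂ A), ← map_mul, one_div_mul_cancel, map_one]
        exact Nat.cast_ne_zero.2 (by omega)
      rw [map_smul, opN_shift, hf, map_zero, zero_sub, smul_neg, smul_smul, smul_smul, ← neg_smul,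
        neg_add_eq_sub]
      congr 1
      push_cast
      linear_combination -(sgn A ((r : ℤ) + k) * δ (γ s)) * hs0
  have hB : ∀ j < -(r : ℤ), h j = 0 := by
    intro j hj
    have e1 : opT ρ r mu γ Δ n f j = 0 := by
      rw [opT_apply, hneg j (by omega), Finset.sum_eq_zero, hneg _ (by omega), Finset.sum_eq_zero]
      · simp
      · intro s hs
        rw [Finset.mem_range] at hs
        rw [hneg _ (by omega), smul_zero]
      · intro i hi
        rw [Finset.mem_range] at hi
        rw [hneg _ (by omega)]; simp
    rw [hh, Pi.sub_apply, Pi.sub_apply, e1, hneg j (by omega), map_zero, Finset.sum_apply,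
      Finset.sum_eq_zero]
    · simp
    · intro s hs
      rw [Finset.mem_Icc] at hs
      rw [Pi.smul_apply, shift_apply, hneg _ (by omega), smul_zero]
  obtain ⟨h1, h2⟩ := eq_smul_of_opN_eq ρ mu γ Δ hlam hneg h0 hf hr hB hN
  generalize MvPolynomial.constantCoeff (h 0) = a at h2
  refine ⟨h1, a, ?_⟩
  rw [← h2, hh]
  abel

end Horizontal

/-! ### Triangular systems -/

section Triangular

variable {r : ℕ} {A : Type*} [CommRing A] (lam : ℕ → A)

theorem sum_Icc_coe_ite {N : Type*} [AddCommMonoid N] (n : ℕ) (g : ℕ → N) :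
    ∑ p : Finset.Icc 1 r, (if (p : ℕ) + n ≤ r then g p else 0) =
      ∑ p ∈ Finset.Icc 1 (r - n), g p := by
  rw [Finset.sum_coe_sort (Finset.Icc 1 r) (fun p => if p + n ≤ r then g p else 0),
    ← Finset.sum_filter]
  refine Finset.sum_congr ?_ fun _ _ => rfl
  ext p
  simp only [Finset.mem_filter, Finset.mem_Icc]
  omega

variable {lamInv : A} (hlam : lam r * lamInv = 1) [Algebra ℂ A]
include hlam

/-- The system `∑_p p λ_{p+n} x_p = 0`, `0 ≤ n < r`, is triangular with invertible diagonal. -/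
theorem eq_zero_of_triangular {N : Type*} [AddCommGroup N] [Module A N] (x : Finset.Icc 1 r → N)
    (h : ∀ n < r, ∑ p : Finset.Icc 1 r,
      (if (p : ℕ) + n ≤ r then (((p : ℕ) : A) * lam ((p : ℕ) + n)) • x p else 0) = 0) :
    ∀ p, x p = 0 := by
  have key : ∀ m : ℕ, ∀ p : Finset.Icc 1 r, (p : ℕ) = m → x p = 0 := by
    intro m
    induction m using Nat.strong_induction_on with
    | _ m ih =>
      intro p hp
      have hp' := Finset.mem_Icc.1 p.2
      have h1 := h (r - p) (by omega)
      rw [Finset.sum_eq_single p] at h1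
      · rw [if_pos (by omega), show (p : ℕ) + (r - p) = r by omega] at h1
        have hp0 : algebraMap ℂ A (1 / (p : ℕ)) * ((p : ℕ) : A) = 1 := by
          rw [← map_natCast (algebraMap ℂ A), ← map_mul, one_div_mul_cancel, map_one]
          exact Nat.cast_ne_zero.2 (by omega)
        have h2 := congrArg (fun y => (lamInv * algebraMap ℂ A (1 / (p : ℕ))) • y) h1
        simp only [smul_smul, smul_zero] at h2
        rwa [show lamInv * algebraMap ℂ A (1 / (p : ℕ)) * (((p : ℕ) : A) * lam r) =
          (algebraMap ℂ A (1 / (p : ℕ)) * ((p : ℕ) : A)) * (lam r * lamInv) by ring, hp0, hlam,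
          one_mul, one_smul] at h2
      · intro q _ hq
        split_ifs with hc
        · have : (q : ℕ) ≠ p := fun h => hq (Subtype.ext h)
          rw [ih q (by omega) q rfl, smul_zero]
        · rfl
      · intro hc; exact absurd (Finset.mem_univ _) hc
  exact fun p => key p p rfl

/-- The system `∑_p p λ_{p+n} s_p = c_n`, `0 ≤ n < r`, can be solved. -/
theorem exists_triangular (c : ℕ → A) : ∃ s : ℕ → A, ∀ n < r, ∑ p : Finset.Icc 1 r,
    (if (p : ℕ) + n ≤ r then (((p : ℕ) : A) * lam ((p : ℕ) + n)) * s p else 0) = c n := by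
  have key : ∀ j : ℕ, ∃ s : ℕ → A, ∀ n < r, r ≤ n + j →
      ∑ p ∈ Finset.Icc 1 (r - n), ((p : A) * lam (p + n)) * s p = c n := by
    intro j
    induction j with
    | zero => exact ⟨0, fun n h1 h2 => by omega⟩
    | succ j ih =>
      obtain ⟨s, hs⟩ := ih
      set t : A := c (r - (j + 1)) -
        ∑ p ∈ Finset.Icc 1 j, ((p : A) * lam (p + (r - (j + 1)))) * s p with ht
      refine ⟨Function.update s (j + 1) (lamInv * algebraMap ℂ A (1 / (j + 1 : ℕ)) * t),
        fun n h1 h2 => ?_⟩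
      rcases Nat.lt_or_ge (n + j) r with h3 | h3
      · obtain rfl : n = r - (j + 1) := by omega
        have hj0 : algebraMap ℂ A (1 / (j + 1 : ℕ)) * ((j + 1 : ℕ) : A) = 1 := by
          rw [← map_natCast (algebraMap ℂ A), ← map_mul, one_div_mul_cancel, map_one]
          exact Nat.cast_ne_zero.2 (by omega)
        rw [show r - (r - (j + 1)) = j + 1 by omega, Finset.sum_Icc_succ_top (by omega),
          Function.update_self, show j + 1 + (r - (j + 1)) = r by omega]
        have h4 : ∑ p ∈ Finset.Icc 1 j, ((p : A) * lam (p + (r - (j + 1)))) *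
            Function.update s (j + 1) (lamInv * algebraMap ℂ A (1 / (j + 1 : ℕ)) * t) p =
            ∑ p ∈ Finset.Icc 1 j, ((p : A) * lam (p + (r - (j + 1)))) * s p := by
          refine Finset.sum_congr rfl fun p hp => ?_
          rw [Finset.mem_Icc] at hp
          rw [Function.update_of_ne (by omega)]
        rw [h4]
        linear_combination ht + (algebraMap ℂ A (1 / (j + 1 : ℕ)) * ((j + 1 : ℕ) : A)) * t * hlam
          + t * hj0
      · rw [← hs n h1 h3]
        refine Finset.sum_congr rfl fun p hp => ?_
        rw [Finset.mem_Icc] at hp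
        rw [Function.update_of_ne (by omega)]
  obtain ⟨s, hs⟩ := key r
  exact ⟨s, fun n hn => by
    rw [sum_Icc_coe_ite n (fun p => ((p : A) * lam (p + n)) * s p), hs n hn (by omega)]⟩

end Triangular

/-! ### Binomial inversion -/

section BinomialInversion

variable {N : Type*} [AddCommGroup N]

theorem eq_of_sum_choose_eq {Q Q' : ℕ → N}
    (h : ∀ n, ∑ k ∈ Finset.range (n + 1), n.choose k • Q k =
      ∑ k ∈ Finset.range (n + 1), n.choose k • Q' k) : Q = Q' := by
  funext n
  induction n using Nat.strong_induction_on with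
  | _ n ih =>
    have h1 := h n
    rw [Finset.sum_range_succ, Finset.sum_range_succ, Finset.sum_congr rfl fun k hk => by
      rw [ih k (Finset.mem_range.1 hk)]] at h1
    simpa using h1

/-- Binomial inversion. -/
theorem sum_choose_iff {P Q : ℕ → N} :
    (∀ n, P n = ∑ k ∈ Finset.range (n + 1), n.choose k • Q k) ↔
      ∀ n, Q n = ∑ k ∈ Finset.range (n + 1), ((-1 : ℤ) ^ (n - k) * n.choose k) • P k := by
  have h1 : ∀ (P : ℕ → N) n, P n = ∑ k ∈ Finset.range (n + 1), n.choose k •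
      ∑ j ∈ Finset.range (k + 1), ((-1 : ℤ) ^ (k - j) * k.choose j) • P j := by
    intro P n
    have h := shift_eq_sum_fwdDiff_iter (1 : ℕ) P n 0
    simp only [fwdDiff_iter_eq_sum_shift, zero_add, smul_eq_mul, mul_one] at h
    exact h
  constructor
  · intro h
    have := eq_of_sum_choose_eq (Q := Q)
      (Q' := fun n => ∑ k ∈ Finset.range (n + 1), ((-1 : ℤ) ^ (n - k) * n.choose k) • P k)
      fun n => by rw [← h n, ← h1 P n]
    exact fun n => congrFun this n
  · intro h n
    rw [h1 P n]
    exact Finset.sum_congr rfl fun k _ => by rw [h k]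

end BinomialInversion

/-! ### Inversion of the highest weight equations -/

section HighestWeightEquations

variable {N : Type*} [AddCommGroup N]

theorem shift_shift_apply (a b : ℤ) (g : ℤ → N) :
    shift ℤ N a (shift ℤ N b g) = shift ℤ N (a + b) g := by
  rw [← Module.End.mul_apply, shift_mul]

/-- The equations of index `0, …, n` for the highest weight vector can be inverted, by binomial
inversion of the sequences `θ, z^{-n} x_n` and `θ, z^{-n} y_n`. -/
theorem hw_equations_iff (x y : ℕ → ℤ → N) (θ : ℤ → N) :
    (∀ n : ℕ, x n = shift ℤ N n θ + ∑ k ∈ Finset.range (n + 1),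
        Ring.choose ((n : ℤ) + 1) (k + 1) • shift ℤ N (n - k) (y k)) ↔
      ∀ n : ℕ, y n = ∑ i ∈ Finset.range (n + 1), (((n : ℤ) - i).negOnePow : ℤ) •
        Ring.choose ((n : ℤ) + 1) (i + 1) • shift ℤ N (n - i) (x i) -
          ((n : ℤ).negOnePow : ℤ) • shift ℤ N n θ := by
  let P : ℕ → ℤ → N := fun n => Nat.casesOn n θ fun n => shift ℤ N (-n) (x n)
  let Q : ℕ → ℤ → N := fun n => Nat.casesOn n θ fun n => shift ℤ N (-n) (y n)
  have hinj : ∀ (n : ℕ) (g h : ℤ → N), shift ℤ N (-n) g = shift ℤ N (-n) h ↔ g = h := by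
    intro n g h
    refine ⟨fun e => ?_, fun e => by rw [e]⟩
    have := congrArg (shift ℤ N n) e
    simpa only [shift_shift_apply, add_neg_cancel, shift_zero] using this
  have hch : ∀ n k : ℕ, Ring.choose ((n : ℤ) + 1) (k + 1) = ((n + 1).choose (k + 1) : ℕ) := by
    intro n k
    rw [← Ring.choose_natCast]; push_cast; rfl
  have hsg : ∀ n i : ℕ, i ≤ n → (((n : ℤ) - i).negOnePow : ℤ) = (-1) ^ (n - i) := by
    intro n i h
    rw [← Nat.cast_sub h, Int.negOnePow_def, zpow_natCast]; simp
  have hPQ := sum_choose_iff (P := P) (Q := Q)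
  have e1 : (∀ n, P n = ∑ k ∈ Finset.range (n + 1), n.choose k • Q k) ↔
      (∀ n : ℕ, x n = shift ℤ N n θ + ∑ k ∈ Finset.range (n + 1),
        Ring.choose ((n : ℤ) + 1) (k + 1) • shift ℤ N (n - k) (y k)) := by
    have h0 : ∀ n : ℕ, (P (n + 1) = ∑ k ∈ Finset.range (n + 2), (n + 1).choose k • Q k) ↔
        x n = shift ℤ N n θ + ∑ k ∈ Finset.range (n + 1),
        Ring.choose ((n : ℤ) + 1) (k + 1) • shift ℤ N (n - k) (y k) := by
      intro n
      refine Iff.trans ?_ (hinj n _ _)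
      rw [Finset.sum_range_succ', map_add, shift_shift_apply, neg_add_cancel, shift_zero,
        map_sum]
      have h1 : ∑ k ∈ Finset.range (n + 1), (n + 1).choose (k + 1) • Q (k + 1) =
          ∑ k ∈ Finset.range (n + 1), shift ℤ N (-n)
            (Ring.choose ((n : ℤ) + 1) (k + 1) • shift ℤ N (n - k) (y k)) := by
        refine Finset.sum_congr rfl fun k _ => ?_
        rw [map_zsmul, shift_shift_apply, hch, natCast_zsmul,
          show -(n : ℤ) + (n - k) = -k by ring]
      rw [h1, add_comm θ, Nat.choose_zero_right, one_smul]
      exact Iff.rfl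
    refine ⟨fun h n => (h0 n).1 (h (n + 1)), fun h n => ?_⟩
    cases n with
    | zero => simp [P, Q]
    | succ n => exact (h0 n).2 (h n)
  have e2 : (∀ n, Q n = ∑ k ∈ Finset.range (n + 1), ((-1 : ℤ) ^ (n - k) * n.choose k) • P k) ↔
      ∀ n : ℕ, y n = ∑ i ∈ Finset.range (n + 1), (((n : ℤ) - i).negOnePow : ℤ) •
        Ring.choose ((n : ℤ) + 1) (i + 1) • shift ℤ N (n - i) (x i) -
          ((n : ℤ).negOnePow : ℤ) • shift ℤ N n θ := by
    have h0 : ∀ n : ℕ, (Q (n + 1) = ∑ k ∈ Finset.range (n + 2),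
        ((-1 : ℤ) ^ (n + 1 - k) * (n + 1).choose k) • P k) ↔
        y n = ∑ i ∈ Finset.range (n + 1), (((n : ℤ) - i).negOnePow : ℤ) •
        Ring.choose ((n : ℤ) + 1) (i + 1) • shift ℤ N (n - i) (x i) -
          ((n : ℤ).negOnePow : ℤ) • shift ℤ N n θ := by
      intro n
      have hs0 := hsg n 0 (Nat.zero_le n)
      rw [Nat.cast_zero, sub_zero, Nat.sub_zero] at hs0
      refine Iff.trans ?_ (hinj n _ _)
      rw [Finset.sum_range_succ', map_sub, map_zsmul, shift_shift_apply, neg_add_cancel,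
        shift_zero, map_sum, hs0, sub_eq_add_neg, ← neg_smul]
      have h1 : ∑ k ∈ Finset.range (n + 1), ((-1 : ℤ) ^ (n + 1 - (k + 1)) *
          (n + 1).choose (k + 1)) • P (k + 1) = ∑ i ∈ Finset.range (n + 1),
          shift ℤ N (-n) ((((n : ℤ) - i).negOnePow : ℤ) •
            Ring.choose ((n : ℤ) + 1) (i + 1) • shift ℤ N (n - i) (x i)) := by
        refine Finset.sum_congr rfl fun i hi => ?_
        rw [map_zsmul, map_zsmul, shift_shift_apply, hch, hsg n i (by simpa [Nat.lt_succ_iff] using hi),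
          smul_smul, show n + 1 - (i + 1) = n - i by omega, show -(n : ℤ) + (n - i) = -i by ring]
      rw [h1]
      rw [Nat.choose_zero_right, Nat.sub_zero, pow_succ, Nat.cast_one, mul_one, mul_neg, mul_one]
      exact Iff.rfl
    refine ⟨fun h n => (h0 n).1 (h (n + 1)), fun h n => ?_⟩
    cases n with
    | zero => simp [P, Q]
    | succ n => exact (h0 n).2 (h n)
  rw [← e1, hPQ, e2]

end HighestWeightEquations

/-! ### The right-hand side of the commutation relation -/

section RightHandSide

variable {r : ℕ} {A : Type*} [CommRing A] [Algebra ℂ A] (lam : ℕ → A)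
  (pd : Finset.Icc 1 r → Derivation ℂ A A) (p : Params r A) (ρ : ℂ)
  {N : Type*} [AddCommGroup N] [Module A N] (nabla : Finset.Icc 1 r → (N →+ N))

/-- The operator `D_k + ℓ_k`, which is the coefficient of `binom(n+1,k+1) z^{n-k}` in the commutator
of `L_n` with the vertex operator. -/
noncomputable def scrD (k : ℕ) (g : ℤ → N) : ℤ → N :=
  dlam lam pd p nabla k g + ell ρ r lam k • g

theorem dlam_eq_zero {k : ℕ} (hk : r ≤ k) (g : ℤ → N) : dlam lam pd p nabla k g = 0 := by
  funext m
  rw [dlam, D_eq_zero lam _ hk, Finset.sum_eq_zero]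
  · simp
  · intro i _
    rw [D_eq_zero lam _ hk, zero_smul]

/-- The differential operator on the right-hand side of the commutation relation. -/
noncomputable def scrL (n : ℤ) (g : ℤ → N) : ℤ → N :=
  zpow n (zpow 1 (dz p g)) + ∑ k ∈ Finset.range (2 * r + 1),
    Ring.choose (n + 1) (k + 1) • zpow (n - k) (scrD lam pd p ρ nabla k g)

theorem rhs_eq_scrL (n : ℤ) (g : ℤ → N) :
    zpow (n + 1) (dz p g) + ∑ i ∈ Finset.range r,
      Ring.choose (n + 1) (i + 1) • zpow (n - i) (dlam lam pd p nabla i g)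
    + ∑ i ∈ Finset.range (r + 1), ∑ j ∈ Finset.range (r + 1),
        Ring.choose (n + 1) (i + j + 1) •
          (algebraMap ℂ A (1 / 2) * lam i * lam j) • zpow (n - i - j) g
    - ∑ i ∈ Finset.range (r + 1),
        Ring.choose (n + 1) (i + 1) •
          (algebraMap ℂ A ρ * ((i : A) + 1) * lam i) • zpow (n - i) g =
    scrL lam pd p ρ nabla n g := by
  have h1 : ∑ k ∈ Finset.range (2 * r + 1),
      Ring.choose (n + 1) (k + 1) • zpow (n - k) (dlam lam pd p nabla k g) =
      ∑ k ∈ Finset.range r,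
      Ring.choose (n + 1) (k + 1) • zpow (n - k) (dlam lam pd p nabla k g) := by
    symm
    refine Finset.sum_subset (Finset.range_mono (by omega)) fun k _ hk => ?_
    rw [dlam_eq_zero lam pd p nabla (by simpa using hk)]
    exact smul_zero _
  have h2 : ∑ k ∈ Finset.range (2 * r + 1), Ring.choose (n + 1) (k + 1) •
      (algebraMap ℂ A (1 / 2) * ∑ i ∈ Finset.range (r + 1), ∑ j ∈ Finset.range (r + 1),
        if (i + j : ℤ) = k then lam i * lam j else 0) • zpow (n - k) g =
      ∑ i ∈ Finset.range (r + 1), ∑ j ∈ Finset.range (r + 1),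
        Ring.choose (n + 1) (i + j + 1) •
          (algebraMap ℂ A (1 / 2) * lam i * lam j) • zpow (n - i - j) g := by
    simp only [Finset.mul_sum, Finset.sum_smul, Finset.smul_sum]
    rw [Finset.sum_comm]
    refine Finset.sum_congr rfl fun i hi => ?_
    rw [Finset.sum_comm]
    refine Finset.sum_congr rfl fun j hj => ?_
    rw [Finset.mem_range] at hi hj
    rw [Finset.sum_eq_single_of_mem (i + j) (Finset.mem_range.2 (by omega)), if_pos (by push_cast; rfl),
      mul_assoc, Nat.cast_add, sub_sub]
    intro k _ hk
    rw [if_neg (by omega), mul_zero, zero_smul, smul_zero]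
  have h3 : ∑ k ∈ Finset.range (2 * r + 1), Ring.choose (n + 1) (k + 1) •
      (algebraMap ℂ A (ρ * ((k : ℤ) + 1)) * ∑ i ∈ Finset.range (r + 1),
        if (i : ℤ) = k then lam i else 0) • zpow (n - k) g =
      ∑ i ∈ Finset.range (r + 1), Ring.choose (n + 1) (i + 1) •
          (algebraMap ℂ A ρ * ((i : A) + 1) * lam i) • zpow (n - i) g := by
    simp only [Finset.mul_sum, Finset.sum_smul, Finset.smul_sum]
    rw [Finset.sum_comm]
    refine Finset.sum_congr rfl fun i hi => ?_
    rw [Finset.mem_range] at hi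
    rw [Finset.sum_eq_single_of_mem i (Finset.mem_range.2 (by omega)), if_pos rfl]
    · simp
    · intro k _ hk
      rw [if_neg (by omega), mul_zero, zero_smul, smul_zero]
  have h4 : ∀ k : ℕ, zpow (n - k) (scrD lam pd p ρ nabla k g) =
      zpow (n - k) (dlam lam pd p nabla k g) + ell ρ r lam k • zpow (n - k) g := fun k => rfl
  simp only [scrL, h4, ell, smul_add, sub_smul, smul_sub, Finset.sum_add_distrib,
    Finset.sum_sub_distrib, h1, h2, h3]
  have h5 : zpow n (zpow 1 (dz p g)) = zpow (n + 1) (dz p g) := by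
    funext m; simp only [zpow]; congr 1; ring
  rw [h5]
  abel

/-- For `n ≥ 0` the terms with `k > n` vanish because the binomial coefficients do, and those with
`k > 2r` because `scrD k` does. -/
theorem scrL_eq (n : ℕ) (g : ℤ → N) : scrL lam pd p ρ nabla n g =
    shift ℤ N n (zpow 1 (dz p g)) + ∑ k ∈ Finset.range (n + 1),
      Ring.choose ((n : ℤ) + 1) (k + 1) • shift ℤ N (n - k) (scrD lam pd p ρ nabla k g) := by
  have h1 : ∀ K : ℕ, n < K → 2 * r < K → ∀ K', (n < K' ∨ 2 * r < K') → K' ≤ K →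
      ∑ k ∈ Finset.range K', Ring.choose ((n : ℤ) + 1) (k + 1) •
        shift ℤ N (n - k) (scrD lam pd p ρ nabla k g) = ∑ k ∈ Finset.range K,
        Ring.choose ((n : ℤ) + 1) (k + 1) • shift ℤ N (n - k) (scrD lam pd p ρ nabla k g) := by
    intro K _ _ K' hK' hle
    refine Finset.sum_subset (Finset.range_mono hle) fun k _ hk => ?_
    rw [Finset.mem_range, not_lt] at hk
    by_cases h : n < k
    · rw [choose_eq_zero_of_le h, zero_smul]
    · rw [scrD, dlam_eq_zero lam pd p nabla (by omega), ell_eq_zero ρ r lam (by omega), zero_smul,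
        add_zero, map_zero, smul_zero]
  rw [h1 (n + 2 * r + 1) (by omega) (by omega) _ (Or.inl (Nat.lt_succ_self n)) (by omega),
    ← h1 (n + 2 * r + 1) (by omega) (by omega) _ (Or.inr (Nat.lt_succ_self _)) (by omega)]
  rfl

section Naturality

variable {N' : Type*} [AddCommGroup N'] [Module A N'] (nabla' : Finset.Icc 1 r → (N' →+ N'))
  (e : N →ₗ[A] N') (he : ∀ q x, e (nabla q x) = nabla' q (e x))
include he

theorem map_scrD (k : ℕ) (g : ℤ → N) (m : ℤ) :
    e (scrD lam pd p ρ nabla k g m) = scrD lam pd p ρ nabla' k (fun m => e (g m)) m := by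
  simp only [scrD, Pi.add_apply, Pi.smul_apply, dlam, map_add, map_sum, map_smul]
  rw [D_comm lam e he]

theorem map_scrL (n : ℤ) (g : ℤ → N) (m : ℤ) :
    e (scrL lam pd p ρ nabla n g m) = scrL lam pd p ρ nabla' n (fun m => e (g m)) m := by
  simp only [scrL, Pi.add_apply, Finset.sum_apply, Pi.smul_apply, map_add, map_sum, map_zsmul, zpow,
    map_scrD lam pd p ρ nabla nabla' e he, dz, map_sub, map_smul]

end Naturality

end RightHandSide

/-! ### Commutators of the differential operators -/

section Flatness

variable {r : ℕ} {A : Type*} [CommRing A] [Algebra ℂ A] (lam : ℕ → A)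
  (pd : Finset.Icc 1 r → Derivation ℂ A A) (p : Params r A) (ρ : ℂ)
  {N : Type*} [AddCommGroup N] [Module A N] [Module ℂ N] [IsScalarTower ℂ A N]
  (nabla : Finset.Icc 1 r → (N →+ N))
  (hsmul : ∀ q (a : A) x, nabla q (a • x) = pd q a • x + a • nabla q x)

/-- The operator `D_k` on a module with the action `nabla` of the derivations, as a `ℂ`-linear
map. -/
noncomputable def Dlin (k : ℕ) : Module.End ℂ N where
  toFun := D lam (fun q => nabla q) k
  map_add' := D_add lam nabla k
  map_smul' c x := by
    rw [← algebraMap_smul A c x, D_smul lam pd hsmul, ← Dder_apply, Derivation.map_algebraMap,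
      zero_smul, zero_add, algebraMap_smul, RingHom.id_apply]

theorem Dlin_apply (k : ℕ) (x : N) :
    Dlin lam pd nabla hsmul k x = D lam (fun q => nabla q) k x := rfl

theorem Dlin_smul (k : ℕ) (a : A) (x : N) : Dlin lam pd nabla hsmul k (a • x) =
    Dder lam pd k a • x + a • Dlin lam pd nabla hsmul k x := by
  rw [Dlin_apply, D_smul lam pd hsmul, Dder_apply]; rfl

variable (hpd : ∀ (q : Finset.Icc 1 r) (i : ℕ), i ≤ r → pd q (lam i) = if i = (q : ℕ) then 1 else 0)
  (hflat : ∀ q q', ∃ c : A, ∀ x, nabla q (nabla q' x) - nabla q' (nabla q x) = c • x)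

omit [IsScalarTower ℂ A N] [Module ℂ N] in
include hsmul hpd in
/-- The second order terms of `D_m D_n`, and the first order terms, which come from
`D_m λ_{q+n} = (q + n) λ_{q+n+m}`. -/
theorem D_D (m n : ℕ) (x : N) : D lam (fun q => nabla q) m (D lam (fun q => nabla q) n x) =
    ∑ q : Finset.Icc 1 r, (if (q : ℕ) + (m + n) ≤ r then
      (((q : ℕ) : A) * (((q : ℕ) + n : ℕ) : A) * lam ((q : ℕ) + (m + n))) • nabla q x else 0) +
    ∑ q : Finset.Icc 1 r, ∑ q' : Finset.Icc 1 r, (if (q : ℕ) + m ≤ r then if (q' : ℕ) + n ≤ r then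
      ((((q : ℕ) : A) * lam ((q : ℕ) + m)) * (((q' : ℕ) : A) * lam ((q' : ℕ) + n))) •
        nabla q (nabla q' x) else 0 else 0) := by
  have h1 : ∀ s : Finset (Finset.Icc 1 r), ∀ g : Finset.Icc 1 r → N,
      D lam (fun q => nabla q) m (∑ q ∈ s, g q) = ∑ q ∈ s, D lam (fun q => nabla q) m (g q) := by
    intro s g
    exact map_sum (AddMonoidHom.mk' (D lam (fun q => nabla q) m) (D_add lam nabla m)) g s
  have h0 : D lam (fun q => nabla q) m (0 : N) = 0 :=
    map_zero (AddMonoidHom.mk' (D lam (fun q => nabla q) m) (D_add lam nabla m))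
  conv_lhs => rw [D.eq_def lam (fun q => nabla q) n x]
  rw [h1, Finset.sum_comm, ← Finset.sum_add_distrib]
  refine Finset.sum_congr rfl fun q' _ => ?_
  by_cases hq : (q' : ℕ) + n ≤ r
  · simp only [if_pos hq]
    rw [D_smul lam pd hsmul, ← Dder_apply, Derivation.leibniz]
    have h2 : Dder lam pd m ((q' : ℕ) : A) = 0 := Derivation.map_natCast _ _
    rw [h2, smul_zero, add_zero, Dder_of_pd_eq lam pd hq fun q => hpd q _ hq,
      show (q' : ℕ) + n + m = q' + (m + n) by ring, D, Finset.smul_sum]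
    congr 1
    · split_ifs
      · rw [smul_eq_mul, mul_assoc]
      · simp
    · refine Finset.sum_congr rfl fun q _ => ?_
      split_ifs
      · rw [smul_smul, mul_comm]
      · rw [smul_zero]
  · simp only [if_neg hq, ite_self, Finset.sum_const_zero, add_zero, h0]
    rw [if_neg (by omega)]

omit [IsScalarTower ℂ A N] [Module ℂ N] in
include hsmul hpd hflat in
/-- If the curvature of the `nabla q` is scalar, then `[D_m, D_n] = (n - m) D_{m+n}` up to a scalar. -/
theorem exists_D_D_sub (m n : ℕ) : ∃ c : A, ∀ x : N,
    D lam (fun q => nabla q) m (D lam (fun q => nabla q) n x) -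
      D lam (fun q => nabla q) n (D lam (fun q => nabla q) m x) =
    ((n : A) - m) • D lam (fun q => nabla q) (m + n) x + c • x := by
  choose c hc using hflat
  refine ⟨∑ q : Finset.Icc 1 r, ∑ q' : Finset.Icc 1 r, (if (q : ℕ) + m ≤ r then
    if (q' : ℕ) + n ≤ r then ((((q : ℕ) : A) * lam ((q : ℕ) + m)) *
      (((q' : ℕ) : A) * lam ((q' : ℕ) + n))) * c q q' else 0 else 0), fun x => ?_⟩
  rw [D_D lam pd nabla hsmul hpd, D_D lam pd nabla hsmul hpd, add_sub_add_comm]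
  congr 1
  · rw [D, Finset.smul_sum, ← Finset.sum_sub_distrib, add_comm n m]
    refine Finset.sum_congr rfl fun q _ => ?_
    split_ifs
    · rw [← sub_smul, smul_smul]
      congr 1
      push_cast
      ring
    · simp
  · have h0 := Finset.sum_comm (s := Finset.univ) (t := Finset.univ)
      (f := fun q q' : Finset.Icc 1 r => if (q : ℕ) + n ≤ r then if (q' : ℕ) + m ≤ r then
        ((((q : ℕ) : A) * lam ((q : ℕ) + n)) * (((q' : ℕ) : A) * lam ((q' : ℕ) + m))) •
          nabla q (nabla q' x) else 0 else 0)
    rw [h0]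
    rw [Finset.sum_smul, ← Finset.sum_sub_distrib]
    refine Finset.sum_congr rfl fun q _ => ?_
    rw [Finset.sum_smul, ← Finset.sum_sub_distrib]
    refine Finset.sum_congr rfl fun q' _ => ?_
    by_cases h1 : (q : ℕ) + m ≤ r <;> by_cases h2 : (q' : ℕ) + n ≤ r <;>
      simp only [h1, h2, if_true, if_false, sub_zero, zero_smul]
    rw [mul_comm (((q' : ℕ) : A) * _), ← smul_sub, hc, smul_smul]

/-- The coefficients of the multiplication part of `scrD`. -/
noncomputable def scrG (k i : ℕ) : A := if i = 0 then ell ρ r lam k else Dder lam pd k (p.b i)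

theorem scrD_apply (k : ℕ) (g : ℤ → N) (m : ℤ) : scrD lam pd p ρ nabla k g m =
    Dlin lam pd nabla hsmul k (g m) +
      ∑ i ∈ Finset.range (r + 1), scrG lam pd p ρ k i • g (m + i) := by
  rw [scrD, Pi.add_apply, dlam, Finset.range_eq_Ico, Finset.sum_eq_sum_Ico_succ_bot (by omega),
    add_assoc, Pi.smul_apply, Dlin_apply]
  congr 1
  rw [add_comm]
  congr 1
  · simp [scrG]
  · refine Finset.sum_congr (by ext; simp only [Finset.mem_Ico, Finset.mem_Icc]; omega) fun i hi => ?_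
    rw [Finset.mem_Ico] at hi
    rw [scrG, if_neg (by omega), Dder_apply]

/-- `scrD` as a `ℂ`-linear operator on sequences. -/
noncomputable def scrDlin (k : ℕ) : Module.End ℂ (ℤ → N) :=
  coef (Dlin lam pd nabla hsmul k) +
    ∑ i ∈ Finset.range (r + 1), scrG lam pd p ρ k i • shift ℂ N (-i)

theorem scrDlin_apply (k : ℕ) (g : ℤ → N) :
    scrDlin lam pd p ρ nabla hsmul k g = scrD lam pd p ρ nabla k g := by
  funext m
  rw [scrD_apply lam pd p ρ nabla hsmul, scrDlin, LinearMap.add_apply, Pi.add_apply, coef_apply,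
    LinearMap.sum_apply, Finset.sum_apply]
  congr 1
  refine Finset.sum_congr rfl fun i _ => ?_
  rw [LinearMap.smul_apply, Pi.smul_apply, shift_apply, sub_neg_eq_add]

/-- The operator `z ∂_z` acting on series with the prefactor, as a `ℂ`-linear operator. -/
noncomputable def thetaLin : Module.End ℂ (ℤ → N) :=
  euler ℂ N + p.α • 1 - ∑ i ∈ Finset.Icc 1 r, ((i : A) * p.b i) • shift ℂ N (-i)

omit [IsScalarTower ℂ A N] [Algebra ℂ A] [Module ℂ N] in
theorem zpow_one_dz (g : ℤ → N) (m : ℤ) : zpow 1 (dz p g) m = m • g m + p.α • g m -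
    ∑ i ∈ Finset.Icc 1 r, ((i : A) * p.b i) • g (m + i) := by
  simp only [zpow, dz, sub_add_cancel, add_smul, Int.cast_smul_eq_zsmul]
  rw [add_comm (p.α • _)]

theorem thetaLin_apply (g : ℤ → N) : thetaLin p g = zpow 1 (dz p g) := by
  funext m
  rw [zpow_one_dz]
  simp only [thetaLin, LinearMap.sub_apply, LinearMap.add_apply, Pi.sub_apply, Pi.add_apply,
    euler_apply, LinearMap.smul_apply, Module.End.one_apply, Pi.smul_apply, LinearMap.sum_apply,
    Finset.sum_apply, shift_apply, sub_neg_eq_add]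

theorem smulShift_rlie (a b : A) (i j : ℤ) : ⁅a • shift ℂ N i, b • shift ℂ N j⁆ = 0 := by
  apply LinearMap.ext; intro g; funext m
  simp only [Ring.lie_def, LinearMap.sub_apply, Module.End.mul_apply, LinearMap.smul_apply,
    Pi.sub_apply, Pi.smul_apply, shift_apply, smul_smul, LinearMap.zero_apply, Pi.zero_apply]
  rw [mul_comm, sub_right_comm, sub_self]

theorem coefDlin_rlie (k : ℕ) (a : A) (i : ℤ) :
    ⁅coef (Dlin lam pd nabla hsmul k), a • shift ℂ N i⁆ = Dder lam pd k a • shift ℂ N i := by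
  apply LinearMap.ext; intro g; funext m
  simp only [Ring.lie_def, LinearMap.sub_apply, Module.End.mul_apply, LinearMap.smul_apply,
    Pi.sub_apply, Pi.smul_apply, coef_apply, Dlin_smul, shift_apply]
  abel

theorem thetaLin_mul_shift (a : ℤ) :
    thetaLin p * shift ℂ N a = shift ℂ N a * thetaLin p + a • shift ℂ N a := by
  apply LinearMap.ext; intro g; funext m
  simp only [Module.End.mul_apply, LinearMap.add_apply, Pi.add_apply, thetaLin_apply, zpow_one_dz,
    shift_apply, LinearMap.smul_apply, Pi.smul_apply, sub_add_eq_add_sub, sub_smul]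
  abel

theorem scrDlin_mul_shift (k : ℕ) (a : ℤ) :
    scrDlin lam pd p ρ nabla hsmul k * shift ℂ N a =
      shift ℂ N a * scrDlin lam pd p ρ nabla hsmul k := by
  apply LinearMap.ext; intro g; funext m
  simp only [Module.End.mul_apply, scrDlin_apply, shift_apply,
    scrD_apply lam pd p ρ nabla hsmul, add_sub_right_comm]

/-- The cross derivatives agree because `scrD k` and `z ∂_z` are conjugated by the same prefactor. -/
theorem scrDlin_mul_thetaLin (hα : ∀ q, pd q p.α = 0) (k : ℕ) :
    scrDlin lam pd p ρ nabla hsmul k * thetaLin p = thetaLin p * scrDlin lam pd p ρ nabla hsmul k := by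
  have hb : ∀ i : ℕ, i ∈ Finset.Icc 1 r → ⁅scrG lam pd p ρ k i • shift ℂ N (-i), euler ℂ N⁆ =
      ⁅coef (Dlin lam pd nabla hsmul k), ((i : A) * p.b i) • shift ℂ N (-(i : ℤ))⁆ := by
    intro i hi
    rw [Finset.mem_Icc] at hi
    rw [coefDlin_rlie, Derivation.leibniz, Derivation.map_natCast, smul_zero, add_zero, scrG,
      if_neg (by omega), smul_eq_mul]
    apply LinearMap.ext; intro g; funext m
    simp only [Ring.lie_def, LinearMap.sub_apply, Module.End.mul_apply, LinearMap.smul_apply,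
      Pi.sub_apply, Pi.smul_apply, euler_apply, shift_apply, sub_neg_eq_add, add_smul, smul_add,
      smul_comm (m : ℤ), add_sub_cancel_left, mul_smul, Nat.cast_smul_eq_nsmul]
    rw [smul_comm]
  have h0 : ⁅scrG lam pd p ρ k 0 • shift ℂ N (-(0 : ℕ)), euler ℂ N⁆ = 0 := by
    apply LinearMap.ext; intro g; funext m
    simp only [Ring.lie_def, LinearMap.sub_apply, Module.End.mul_apply, LinearMap.smul_apply,
      Pi.sub_apply, Pi.smul_apply, euler_apply, shift_apply, Nat.cast_zero, neg_zero, sub_zero,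
      smul_comm (m : ℤ), sub_self, LinearMap.zero_apply, Pi.zero_apply]
  have h1 : ⁅∑ i ∈ Finset.range (r + 1), scrG lam pd p ρ k i • shift ℂ N (-i), euler ℂ N⁆ =
      ∑ i ∈ Finset.Icc 1 r,
        ⁅coef (Dlin lam pd nabla hsmul k), ((i : A) * p.b i) • shift ℂ N (-(i : ℤ))⁆ := by
    rw [sum_rlie, Finset.range_eq_Ico, Finset.sum_eq_sum_Ico_succ_bot (by omega), h0, zero_add]
    refine Finset.sum_congr (by ext; simp only [Finset.mem_Ico, Finset.mem_Icc]; omega)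
      fun i hi => hb i ?_
    simpa only [Finset.mem_Icc] using hi
  have h2 : ∀ (a : A) (i : ℤ),
      ⁅∑ i ∈ Finset.range (r + 1), scrG lam pd p ρ k i • shift ℂ N (-i), a • shift ℂ N i⁆ = 0 := by
    intro a i
    rw [sum_rlie]
    exact Finset.sum_eq_zero fun j _ => smulShift_rlie ..
  have h3 : ⁅coef (Dlin lam pd nabla hsmul k), euler ℂ N⁆ = 0 := by
    rw [Ring.lie_def, coef_mul_euler, sub_self]
  have h4 : Dder lam pd k p.α = 0 := by
    rw [Dder_apply, D]
    exact Finset.sum_eq_zero fun q _ => by rw [hα, smul_zero, ite_self]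
  have h5 : ⁅scrDlin lam pd p ρ nabla hsmul k, thetaLin (N := N) p⁆ = 0 := by
    have h6 : (1 : Module.End ℂ (ℤ → N)) = shift ℂ N 0 := LinearMap.ext fun g => (shift_zero g).symm
    rw [thetaLin, h6, rlie_sub, rlie_add, scrDlin, add_rlie, add_rlie, add_rlie, h1, h2,
      h3, coefDlin_rlie, h4, rlie_sum, rlie_sum, Finset.sum_eq_zero (fun i _ => h2 ..)]
    simp
  rwa [Ring.lie_def, sub_eq_zero] at h5

theorem scrDlin_rlie (m n : ℕ) :
    ⁅scrDlin lam pd p ρ nabla hsmul m, scrDlin lam pd p ρ nabla hsmul n⁆ =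
      coef ⁅Dlin lam pd nabla hsmul m, Dlin lam pd nabla hsmul n⁆ +
      ∑ i ∈ Finset.range (r + 1), (Dder lam pd m (scrG lam pd p ρ n i) -
        Dder lam pd n (scrG lam pd p ρ m i)) • shift ℂ N (-i) := by
  have h1 : ∀ m n, ⁅coef (Dlin lam pd nabla hsmul m),
      ∑ i ∈ Finset.range (r + 1), scrG lam pd p ρ n i • shift ℂ N (-i)⁆ =
      ∑ i ∈ Finset.range (r + 1), Dder lam pd m (scrG lam pd p ρ n i) • shift ℂ N (-i) := by
    intro m n
    rw [rlie_sum]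
    exact Finset.sum_congr rfl fun i _ => coefDlin_rlie ..
  have h2 : ⁅∑ i ∈ Finset.range (r + 1), scrG lam pd p ρ m i • shift ℂ N (-(i : ℤ)),
      ∑ i ∈ Finset.range (r + 1), scrG lam pd p ρ n i • shift ℂ N (-(i : ℤ))⁆ = 0 := by
    rw [sum_rlie]
    refine Finset.sum_eq_zero fun i _ => ?_
    rw [rlie_sum]
    exact Finset.sum_eq_zero fun j _ => smulShift_rlie ..
  rw [scrDlin, scrDlin, add_rlie, rlie_add, rlie_add, h1, rlie_skew (Finset.sum _ _) (coef _), h1,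
    coef_rlie, h2]
  have h3 : ∀ i : ℕ, (Dder lam pd m (scrG lam pd p ρ n i) - Dder lam pd n (scrG lam pd p ρ m i)) •
      shift ℂ N (-(i : ℤ)) = Dder lam pd m (scrG lam pd p ρ n i) • shift ℂ N (-(i : ℤ)) -
        Dder lam pd n (scrG lam pd p ρ m i) • shift ℂ N (-(i : ℤ)) := fun i => by
    apply LinearMap.ext; intro g; funext m
    exact sub_smul ..
  rw [Finset.sum_congr rfl fun i _ => h3 i, Finset.sum_sub_distrib]
  abel

end Flatness

/-! ### Vanishing of the curvature -/

section Independence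

variable {A : Type*} [CommRing A] {N : Type*} [AddCommGroup N] [Module A N]

/-- If the coefficients of `z^m` in `(∑_i κ_i z^{-i}) f` vanish for `m ≤ -t`, where `f = f_0 + O(z)` and
`f_0` is not a torsion vector, then `κ_i = 0` for `i ≥ t`. -/
theorem eq_zero_of_sum_smul {f : ℤ → N} (hneg : ∀ j < 0, f j = 0) (h0 : ∀ a : A, a • f 0 = 0 → a = 0)
    (κ : ℕ → A) (r t : ℕ)
    (h : ∀ m : ℤ, m ≤ -t → ∑ i ∈ Finset.range (r + 1), κ i • f (m + i) = 0) :
    ∀ i, t ≤ i → i ≤ r → κ i = 0 := by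
  have key : ∀ n, ∀ i, t ≤ i → i ≤ r → r - i = n → κ i = 0 := by
    intro n
    induction n using Nat.strong_induction_on with
    | _ n ih =>
      intro i ht hi hn
      have h1 := h (-i) (by omega)
      rw [Finset.sum_eq_single_of_mem i (Finset.mem_range.2 (by omega)), neg_add_cancel] at h1
      · exact h0 _ h1
      · intro j hj hji
        rw [Finset.mem_range] at hj
        rcases lt_or_gt_of_ne hji with h2 | h2
        · rw [hneg _ (by omega), smul_zero]
        · rw [ih (r - j) (by omega) j (by omega) (by omega) rfl, zero_smul]
  exact fun i ht hi => key _ i ht hi rfl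

end Independence

section FockConnection

variable {r : ℕ} {A : Type*} [CommRing A] [Algebra ℂ A] (lam : ℕ → A)
  (pd : Finset.Icc 1 r → Derivation ℂ A A) (p : Params r A) (ρ : ℂ) (mu γ : ℕ → A) (Δ : A)

omit [Algebra ℂ A] in
theorem thetaOp_eq {N : Type*} [AddCommGroup N] [Module A N] (hγ0 : γ 0 = p.α)
    (hγs : ∀ s ∈ Finset.Icc 1 r, γ s = -((s : A) * p.b s)) (g : ℤ → N) :
    thetaOp r γ N g = zpow 1 (dz p g) := by
  funext m
  rw [thetaOp_apply, zpow_one_dz, Finset.range_eq_Ico, Finset.sum_eq_sum_Ico_succ_bot (by omega),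
    hγ0, Nat.cast_zero, add_zero, ← add_assoc, sub_eq_add_neg, ← Finset.sum_neg_distrib]
  congr 1
  refine Finset.sum_congr (by ext; simp only [Finset.mem_Ico, Finset.mem_Icc]; omega) fun i hi => ?_
  rw [hγs i (by simpa only [Finset.mem_Icc] using hi), neg_smul]

/-- The operator `opT` is the right-hand side of the inverted equations of `hw_equations_iff`. -/
theorem opT_eq_sum (n : ℕ) (g : ℤ → MvPolynomial ℕ A) : opT ρ r mu γ Δ n g =
    ∑ i ∈ Finset.range (n + 1), (((n : ℤ) - i).negOnePow : ℤ) •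
      Ring.choose ((n : ℤ) + 1) (i + 1) • shift ℤ _ (n - i)
        (fun m => vir ρ r mu i (g m) - (if i = 0 then Δ else 0) • g m) -
      ((n : ℤ).negOnePow : ℤ) • shift ℤ _ n (thetaOp r γ _ g) := by
  funext M
  simp only [opT, vect, LinearMap.sub_apply, LinearMap.sum_apply, Module.End.mul_apply,
    LinearMap.smul_apply, Pi.sub_apply, Finset.sum_apply, Pi.smul_apply, shift_apply, coef_apply,
    sgn, Int.cast_smul_eq_zsmul, Module.End.one_apply]
  congr 1
  refine Finset.sum_congr rfl fun i _ => ?_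
  rw [smul_comm]

variable (nabla : Finset.Icc 1 r → (MvPolynomial ℕ A →+ MvPolynomial ℕ A))
  (hsmul : ∀ q (a : A) x, nabla q (a • x) = pd q a • x + a • nabla q x)
  (hvir : ∀ q (n : ℤ) x, nabla q (vir ρ r mu n x) = vir ρ r mu n (nabla q x))
  (hα : ∀ q, pd q p.α = 0) (hγ0 : γ 0 = p.α)
  (hγs : ∀ s ∈ Finset.Icc 1 r, γ s = -((s : A) * p.b s))

include hsmul hvir hα hγ0 hγs in
theorem scrDlin_opT (Δ : ℂ) (k n : ℕ) (g : ℤ → MvPolynomial ℕ A) :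
    scrDlin lam pd p ρ nabla hsmul k (opT ρ r mu γ (algebraMap ℂ A Δ) n g) =
      opT ρ r mu γ (algebraMap ℂ A Δ) n (scrDlin lam pd p ρ nabla hsmul k g) := by
  have h1 : ∀ (a : ℤ) (g : ℤ → MvPolynomial ℕ A), scrDlin lam pd p ρ nabla hsmul k (shift ℤ _ a g) =
      shift ℤ _ a (scrDlin lam pd p ρ nabla hsmul k g) := fun a g =>
    LinearMap.congr_fun (scrDlin_mul_shift lam pd p ρ nabla hsmul k a) g
  have h2 : scrDlin lam pd p ρ nabla hsmul k (thetaOp r γ _ g) =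
      thetaOp r γ _ (scrDlin lam pd p ρ nabla hsmul k g) := by
    rw [thetaOp_eq p γ hγ0 hγs, thetaOp_eq p γ hγ0 hγs, ← thetaLin_apply, ← thetaLin_apply]
    exact LinearMap.congr_fun (scrDlin_mul_thetaLin lam pd p ρ nabla hsmul hα k) g
  have h3 : ∀ i : ℕ, scrDlin lam pd p ρ nabla hsmul k
      (fun m => vir ρ r mu i (g m) - (if i = 0 then algebraMap ℂ A Δ else 0) • g m) =
      fun m => vir ρ r mu i (scrDlin lam pd p ρ nabla hsmul k g m) -
        (if i = 0 then algebraMap ℂ A Δ else 0) • scrDlin lam pd p ρ nabla hsmul k g m := by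
    intro i
    have e1 : (fun m => vir ρ r mu i (g m) - (if i = 0 then algebraMap ℂ A Δ else 0) • g m) =
        (fun m => vir ρ r mu i (g m)) - (if i = 0 then Δ else 0) • g := by
      funext m
      rw [Pi.sub_apply, Pi.smul_apply, ← algebraMap_smul A]
      split_ifs <;> simp
    have e2 := map_scrD lam pd p ρ nabla nabla (vir ρ r mu i) (fun q x => (hvir q i x).symm) k g
    rw [e1, map_sub, map_smul]
    funext m
    rw [Pi.sub_apply, Pi.smul_apply, ← algebraMap_smul A, scrDlin_apply, scrDlin_apply, e2]
    split_ifs <;> simp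
  rw [opT_eq_sum, opT_eq_sum, map_sub, map_sum, map_zsmul, h1, h2]
  congr 1
  refine Finset.sum_congr rfl fun i _ => ?_
  rw [map_zsmul, map_zsmul, h1, h3]

variable (hpd : ∀ (q : Finset.Icc 1 r) (i : ℕ), i ≤ r → pd q (lam i) = if i = (q : ℕ) then 1 else 0)
  (hflat : ∀ q q', ∃ c : A, ∀ x, nabla q (nabla q' x) - nabla q' (nabla q x) = c • x)
  {f : ℤ → MvPolynomial ℕ A} (hneg : ∀ j < 0, f j = 0) (h0 : f 0 = 1)

include hsmul hvir hα hγ0 hγs hpd hflat hneg h0 in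
/-- The commutators of the operators `scrD` are multiplication operators, and they vanish because
they kill the formal solution. -/
theorem scrDlin_lie (Δ : ℂ)
    (hT : ∀ n, scrD lam pd p ρ nabla n f = opT ρ r mu γ (algebraMap ℂ A Δ) n f) (m n : ℕ) :
    ⁅scrDlin lam pd p ρ nabla hsmul m, scrDlin lam pd p ρ nabla hsmul n⁆ =
      ((n : ℤ) - m) • scrDlin lam pd p ρ nabla hsmul (m + n) := by
  -- `κ_i` are the coefficients of the Laurent polynomial `[scrD m, scrD n] - (n - m) scrD (m + n)`
  obtain ⟨c, hc⟩ := exists_D_D_sub lam pd nabla hsmul hpd hflat m n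
  let κ : ℕ → A := fun i => (Dder lam pd m (scrG lam pd p ρ n i) -
    Dder lam pd n (scrG lam pd p ρ m i)) - ((n : A) - m) * scrG lam pd p ρ (m + n) i +
      if i = 0 then c else 0
  have h1 : ∀ g : ℤ → MvPolynomial ℕ A, ∀ M : ℤ,
      (⁅scrDlin lam pd p ρ nabla hsmul m, scrDlin lam pd p ρ nabla hsmul n⁆ g) M =
      ((((n : ℤ) - m) • scrDlin lam pd p ρ nabla hsmul (m + n)) g) M +
        ∑ i ∈ Finset.range (r + 1), κ i • g (M + i) := by
    intro g M
    have e1 : (coef ⁅Dlin lam pd nabla hsmul m, Dlin lam pd nabla hsmul n⁆ g) M =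
        ((n : A) - m) • D lam (fun q => nabla q) (m + n) (g M) + c • g M := hc (g M)
    have e2 : ∑ i ∈ Finset.range (r + 1), κ i • g (M + i) =
        ∑ i ∈ Finset.range (r + 1), (Dder lam pd m (scrG lam pd p ρ n i) -
          Dder lam pd n (scrG lam pd p ρ m i)) • g (M + i) -
        ((n : A) - m) • ∑ i ∈ Finset.range (r + 1), scrG lam pd p ρ (m + n) i • g (M + i) +
          c • g M := by
      simp only [κ, add_smul, sub_smul _ (_ * _), mul_smul, Finset.sum_add_distrib,
        Finset.sum_sub_distrib, Finset.smul_sum, ite_smul, zero_smul]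
      simp
    rw [scrDlin_rlie, LinearMap.add_apply, Pi.add_apply, e1, e2, LinearMap.smul_apply, Pi.smul_apply,
      scrDlin_apply, scrD_apply lam pd p ρ nabla hsmul, Dlin_apply, LinearMap.sum_apply,
      Finset.sum_apply]
    simp only [LinearMap.smul_apply, Pi.smul_apply, shift_apply, sub_neg_eq_add,
      ← Int.cast_smul_eq_zsmul A, Int.cast_sub, Int.cast_natCast, smul_add]
    abel
  have h2 : ⁅scrDlin lam pd p ρ nabla hsmul m, scrDlin lam pd p ρ nabla hsmul n⁆ f =
      (((n : ℤ) - m) • scrDlin lam pd p ρ nabla hsmul (m + n)) f := by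
    -- `scrD` commutes with `opT`, which reverses the order of the two factors
    have e : ∀ k l, scrDlin lam pd p ρ nabla hsmul k (scrDlin lam pd p ρ nabla hsmul l f) =
        opT ρ r mu γ (algebraMap ℂ A Δ) l (opT ρ r mu γ (algebraMap ℂ A Δ) k f) := by
      intro k l
      rw [scrDlin_apply lam pd p ρ nabla hsmul l, hT,
        scrDlin_opT lam pd p ρ mu γ nabla hsmul hvir hα hγ0 hγs, scrDlin_apply, hT]
    have e3 := LinearMap.congr_fun (lie_opT ρ r mu γ (algebraMap ℂ A Δ) n m) f
    rw [Ring.lie_def, LinearMap.sub_apply, Module.End.mul_apply, Module.End.mul_apply] at e3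
    rw [Ring.lie_def, LinearMap.sub_apply, Module.End.mul_apply, Module.End.mul_apply, e, e, e3,
      LinearMap.smul_apply, LinearMap.smul_apply, scrDlin_apply, hT, add_comm n m]
  have h3 : ∀ M : ℤ, ∑ i ∈ Finset.range (r + 1), κ i • f (M + i) = 0 := by
    intro M
    have := h1 f M
    rw [h2] at this
    simpa using this
  have h4 : ∀ i ≤ r, κ i = 0 := by
    refine fun i => eq_zero_of_sum_smul hneg (fun a ha => ?_) κ r 0 (fun M _ => h3 M) i (Nat.zero_le _)
    rw [h0] at ha
    simpa [MvPolynomial.smul_eq_C_mul] using congrArg MvPolynomial.constantCoeff ha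
  apply LinearMap.ext; intro g; funext M
  rw [h1, Finset.sum_eq_zero, add_zero]
  intro i hi
  rw [h4 i (by simpa [Nat.lt_succ_iff] using hi), zero_smul]

end FockConnection

/-! ### The action of the derivations -/

section ConnectionOnFockSpace

variable {r : ℕ} {A : Type*} [CommRing A] [Algebra ℂ A] (lam : ℕ → A) (lamInv B : A)
  (pd : Finset.Icc 1 r → Derivation ℂ A A)

/-- The curvature of the connection is scalar. -/
theorem nab_nab_sub {δ δ' : Derivation ℂ A A} (h : ∀ a, δ (δ' a) = δ' (δ a)) (q q' : ℕ) (s s' : A)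
    (x : MvPolynomial ℕ A) : nab δ q s (nab δ' q' s' x) - nab δ' q' s' (nab δ q s x) =
      (δ s' - δ' s) • x := by
  have h1 : coefD δ (coefD δ' x) = coefD δ' (coefD δ x) := by
    ext t
    simp only [coeff_coefD, h]
  simp only [nab_apply, map_add, coefD_smul, coefD_mul, coefD_xvar, h1, Derivation.map_algebraMap,
    zero_mul, zero_add, zero_smul, mul_smul_comm, sub_smul,
    mul_left_comm (xvar A q'), smul_comm (algebraMap ℂ A (1 / q')) , smul_comm s']
  abel

theorem D_nab (s : ℕ → A) (n : ℕ) (x : MvPolynomial ℕ A) :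
    D lam (fun q => nab (pd q) q (s q)) n x = D lam (fun q => nab (pd q) q 0) n x +
      (∑ q : Finset.Icc 1 r,
        (if (q : ℕ) + n ≤ r then (((q : ℕ) : A) * lam ((q : ℕ) + n)) * s q else 0)) • x := by
  rw [D, D, Finset.sum_smul, ← Finset.sum_add_distrib]
  refine Finset.sum_congr rfl fun q _ => ?_
  split_ifs
  · rw [nab_apply, nab_apply, zero_smul, add_zero, smul_add _ _ (s q • x), smul_smul _ (s q)]
  · rw [zero_smul, add_zero]

variable (hlam : lam r * lamInv = 1)
  (hpd : ∀ (q : Finset.Icc 1 r) (i : ℕ), i ≤ r → pd q (lam i) = if i = (q : ℕ) then 1 else 0)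
  (hB : ∀ q : Finset.Icc 1 r, lam r * pd q B = if (q : ℕ) = r then B else 0)
  (hcomm : ∀ q q' a, pd q (pd q' a) = pd q' (pd q a))
  (ρ Δ : ℂ) {γ : ℕ → A} {f : ℤ → MvPolynomial ℕ A} (hγ : γ r = -(r * B)) (hr : 1 ≤ r)
  (hneg : ∀ j < 0, f j = 0) (h0 : f 0 = 1)
  (hf : ∀ k, opN ρ r (mom r lam lamInv B) γ (algebraMap ℂ A Δ) k f = 0)
include hlam hpd hB hγ hr hneg h0 hf

/-- The vector field `D_n`, lifted to the Fock space with `s_q = 0`, acts on the formal solution as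
`opT n` up to multiplication by a Laurent polynomial. -/
theorem covariant_mom (n : ℕ) : Dder lam pd n (γ 0) = 0 ∧ ∃ a : A,
    (fun m => D lam (fun q => nab (pd q) q 0) n (f m)) =
    opT ρ r (mom r lam lamInv B) γ (algebraMap ℂ A Δ) n f + a • f + ∑ s ∈ Finset.Icc 1 r,
      (algebraMap ℂ A (1 / s) * Dder lam pd n (γ s)) • shift A _ (-(s : ℤ)) f := by
  refine covariant_eq_opT ρ (mom r lam lamInv B) γ (algebraMap ℂ A Δ) (lamInv := lamInv)
    (δ := Dder lam pd n)
    (E := AddMonoidHom.mk' (D lam (fun q => nab (pd q) q 0) n) (D_add lam _ n)) ?_ ?_ ?_ hf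
    (fun i hi => Dder_mom lam lamInv B pd hlam hpd hB n hi) ?_ ?_ hneg h0 hr
  · intro a x
    exact (D_smul lam pd (fun q a x => nab_smul (pd q) q 0 a x) n a x).trans (by
      rw [Dder_apply]; rfl)
  · intro k x
    refine (D_comm lam (der := fun q => nab (pd q) q 0) (der' := fun q => nab (pd q) q 0)
      (vir ρ r (mom r lam lamInv B) k) (fun q x => ?_) n x).symm
    exact (nab_vir ρ (Finset.mem_Icc.1 q.2).1 (Finset.mem_Icc.1 q.2).2
      (fun i hi => pd_mom lam lamInv B pd hlam hpd hB q hi) 0 k x).symm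
  · exact Derivation.map_algebraMap _ _
  · have h1 : Dder lam pd n (r : A) = 0 := Derivation.map_natCast _ _
    rw [hγ, map_neg, Derivation.leibniz, h1, Dder_B lam lamInv B pd hlam hB hr]
    split_ifs <;> simp
  · rw [mom_of_pos _ _ _ hr, hlam]

/-- The exponent `α = γ_0` is constant in `λ_1, …, λ_r`. -/
theorem pd_exponent_eq_zero (q : Finset.Icc 1 r) : pd q (γ 0) = 0 := by
  refine eq_zero_of_triangular lam hlam (fun q => pd q (γ 0)) (fun n _ => ?_) q
  have := (covariant_mom lam lamInv B pd hlam hpd hB ρ Δ hγ hr hneg h0 hf n).1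
  rwa [Dder_apply] at this

/-- The derivations `∂/∂λ_q` are lifted to the Fock space by `∂/∂λ_q + x_q / q + s_q`, with
functions `s_q` that are determined by a triangular system. -/
theorem exists_connection (p : Params r A)
    (hγs : ∀ s ∈ Finset.Icc 1 r, γ s = -((s : A) * p.b s)) : ∃ s : ℕ → A, ∀ n,
    scrD lam pd p ρ (fun q => nab (pd q) q (s q)) n f =
      opT ρ r (mom r lam lamInv B) γ (algebraMap ℂ A Δ) n f := by
  choose a ha using fun n => (covariant_mom lam lamInv B pd hlam hpd hB ρ Δ hγ hr hneg h0 hf n).2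
  obtain ⟨s, hs⟩ := exists_triangular lam hlam fun n => -(a n + ell ρ r lam n)
  refine ⟨s, fun n => ?_⟩
  rcases lt_or_ge n r with hn | hn
  · funext m
    have h1 := congrFun (ha n) m
    have h2 : ∀ i ∈ Finset.Icc 1 r, D lam (fun q => pd q) n (p.b i) • f (m + i) =
        -((algebraMap ℂ A (1 / i) * Dder lam pd n (γ i)) • f (m + i)) := by
      intro i hi
      have hi0 : algebraMap ℂ A (1 / i) * (i : A) = 1 := by
        rw [← map_natCast (algebraMap ℂ A), ← map_mul, one_div_mul_cancel, map_one]
        have := (Finset.mem_Icc.1 hi).1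
        exact Nat.cast_ne_zero.2 (by omega)
      rw [hγs i hi, map_neg, Derivation.leibniz, Derivation.map_natCast, smul_zero, add_zero,
        smul_eq_mul, mul_neg, ← mul_assoc, hi0, one_mul, neg_smul, neg_neg, Dder_apply]
    simp only [Pi.add_apply, Pi.smul_apply, Finset.sum_apply, shift_apply, sub_neg_eq_add] at h1
    rw [scrD, Pi.add_apply, dlam, D_nab, h1, hs n hn, Finset.sum_congr rfl h2,
      Finset.sum_neg_distrib, Pi.smul_apply]
    module
  · -- for `n ≥ r` the claim is `opN k f = 0`
    obtain ⟨k, rfl⟩ := Nat.exists_eq_add_of_le hn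
    rw [scrD, dlam_eq_zero lam pd p _ hn, zero_add, opT_eq_smul ρ _ _ _ hf,
      ← Nat.cast_add, ell_mom lam lamInv B hlam ρ hr hn, hγ, sgn_add]
    congr 1
    by_cases hk : k = 0
    · rw [if_pos hk, if_pos (by omega)]
      simp [sgn]
    · rw [if_neg hk, if_neg (by omega)]
      simp

end ConnectionOnFockSpace

/-! ### The Virasoro action on Laurent series -/

section VectorFieldRepresentation

variable {r : ℕ} {A : Type*} [CommRing A] [Algebra ℂ A] (lam : ℕ → A)
  (pd : Finset.Icc 1 r → Derivation ℂ A A) (p : Params r A) (ρ : ℂ)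

section

variable {N : Type*} [AddCommGroup N] [Module A N] (nabla : Finset.Icc 1 r → (N →+ N))

theorem scrD_eq_zero {k : ℕ} (hk : 2 * r < k) (g : ℤ → N) : scrD lam pd p ρ nabla k g = 0 := by
  rw [scrD, dlam_eq_zero lam pd p nabla (by omega), ell_eq_zero ρ r lam (by omega), zero_smul,
    add_zero]

/-- The operator `scrL n` preserves boundedness from below. -/
theorem scrL_eq_zero {g : ℤ → N} {M : ℤ} (hg : ∀ m < M, g m = 0) (n m : ℤ)
    (hm : m < M + n - 3 * r) : scrL lam pd p ρ nabla n g m = 0 := by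
  have h0 : ∀ k, D lam (fun q => nabla q) k (0 : N) = 0 := fun k =>
    map_zero (AddMonoidHom.mk' (D lam (fun q => nabla q) k) (D_add lam nabla k))
  have h1 : zpow n (zpow 1 (dz p g)) m = 0 := by
    rw [zpow, zpow_one_dz, hg _ (by omega), Finset.sum_eq_zero]
    · simp
    · intro i hi
      rw [Finset.mem_Icc] at hi
      rw [hg _ (by omega), smul_zero]
  have h2 : ∀ k ∈ Finset.range (2 * r + 1), zpow (n - k) (scrD lam pd p ρ nabla k g) m = 0 := by
    intro k hk
    rw [Finset.mem_range] at hk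
    rw [zpow, scrD, Pi.add_apply, Pi.smul_apply, dlam, hg _ (by omega), h0, smul_zero, zero_add,
      add_zero, Finset.sum_eq_zero]
    intro i hi
    rw [Finset.mem_Icc] at hi
    rw [hg _ (by omega), smul_zero]
  rw [scrL, Pi.add_apply, h1, zero_add, Finset.sum_apply, Finset.sum_eq_zero]
  intro k hk
  rw [Pi.smul_apply, h2 k hk, smul_zero]

end

theorem neg_mul_comm_of_mul_comm {R : Type*} [Ring R] {x y : R} (h : x * y = y * x) :
    -x * y = y * -x := by
  rw [neg_mul, mul_neg, h]

theorem neg_rlie_neg_of_rlie {R : Type*} [Ring R] {x y z : R} {i j : ℤ} (h : ⁅x, y⁆ = (j - i) • z) :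
    ⁅-x, -y⁆ = (i - j) • -z := by
  rw [Ring.lie_def] at h
  rw [Ring.lie_def, neg_mul_neg, neg_mul_neg, h, smul_neg, ← neg_smul, neg_sub]

variable {N : Type*} [AddCommGroup N] [Module A N] [Module ℂ N] [IsScalarTower ℂ A N]
  (nabla : Finset.Icc 1 r → (N →+ N))
  (hsmul : ∀ q (a : A) x, nabla q (a • x) = pd q a • x + a • nabla q x)

/-- The operator `- scrL n`, as a linear combination of vector fields. -/
noncomputable def negScrL (n : ℤ) : Module.End ℂ (ℤ → N) :=
  vect (shift ℂ N) (thetaLin p) (fun k => -scrDlin lam pd p ρ nabla hsmul k) (2 * r + 1) n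

theorem negScrL_apply (n : ℤ) (g : ℤ → N) :
    negScrL lam pd p ρ nabla hsmul n g = -scrL lam pd p ρ nabla n g := by
  rw [negScrL, vect, scrL, LinearMap.sub_apply, LinearMap.sum_apply, neg_add_rev, sub_eq_add_neg,
    ← Finset.sum_neg_distrib, Module.End.mul_apply, thetaLin_apply]
  congr 1
  refine Finset.sum_congr rfl fun k _ => ?_
  rw [LinearMap.smul_apply, Module.End.mul_apply, LinearMap.neg_apply, map_neg, smul_neg,
    scrDlin_apply]
  rfl

/-- The operators `- scrL n` satisfy the relations of the Witt algebra. -/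
theorem negScrL_rlie (hα : ∀ q, pd q p.α = 0)
    (hlie : ∀ m n, ⁅scrDlin lam pd p ρ nabla hsmul m, scrDlin lam pd p ρ nabla hsmul n⁆ =
      ((n : ℤ) - m) • scrDlin lam pd p ρ nabla hsmul (m + n)) (m n : ℤ) :
    ⁅negScrL lam pd p ρ nabla hsmul m, negScrL lam pd p ρ nabla hsmul n⁆ =
      (m - n) • negScrL lam pd p ρ nabla hsmul (m + n) := by
  refine lie_vect shift_mul (thetaLin_mul_shift p) ?_ ?_ ?_ _ m n ?_
  · exact fun i a => neg_mul_comm_of_mul_comm (scrDlin_mul_shift lam pd p ρ nabla hsmul i a)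
  · exact fun i => neg_mul_comm_of_mul_comm (scrDlin_mul_thetaLin lam pd p ρ nabla hsmul hα i)
  · exact fun i j => neg_rlie_neg_of_rlie (hlie i j)
  · intro i j h
    right; right
    rw [neg_eq_zero]
    apply LinearMap.ext; intro g
    rw [scrDlin_apply, scrD_eq_zero lam pd p ρ nabla (by omega), LinearMap.zero_apply]

variable {ℓ : ℤ → Module.End A N} {c : ℂ} (hℓ : IsVir c ℓ)

/-- The operators `g ↦ L_n g - scrL n g`. -/
noncomputable def totalL (ℓ : ℤ → Module.End A N) (n : ℤ) : Module.End ℂ (ℤ → N) :=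
  coef ((ℓ n).restrictScalars ℂ) + negScrL lam pd p ρ nabla hsmul n

theorem totalL_apply (n : ℤ) (g : ℤ → N) (m : ℤ) : totalL lam pd p ρ nabla hsmul ℓ n g m =
    ℓ n (g m) - scrL lam pd p ρ nabla n g m := by
  rw [totalL, LinearMap.add_apply, negScrL_apply, Pi.add_apply, Pi.neg_apply, ← sub_eq_add_neg]
  rfl

include hℓ in
/-- The operators `L_n - scrL n` satisfy the Virasoro relations, because `L_m` commutes with `scrL n`. -/
theorem isVir_totalL (hα : ∀ q, pd q p.α = 0)
    (hnab : ∀ q (n : ℤ) x, nabla q (ℓ n x) = ℓ n (nabla q x))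
    (hlie : ∀ m n, ⁅scrDlin lam pd p ρ nabla hsmul m, scrDlin lam pd p ρ nabla hsmul n⁆ =
      ((n : ℤ) - m) • scrDlin lam pd p ρ nabla hsmul (m + n)) :
    IsVir c (totalL lam pd p ρ nabla hsmul ℓ) := by
  intro m n
  have h1 : ∀ m n, ⁅coef ((ℓ m).restrictScalars ℂ), negScrL lam pd p ρ nabla hsmul n⁆ = 0 := by
    intro m n
    apply LinearMap.ext; intro g; funext M
    have h2 := map_scrL lam pd p ρ nabla nabla (ℓ m) (fun q x => (hnab q m x).symm) n g M
    rw [Ring.lie_def, LinearMap.sub_apply, Pi.sub_apply, Module.End.mul_apply, Module.End.mul_apply,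
      coef_apply, negScrL_apply, negScrL_apply, Pi.neg_apply, Pi.neg_apply, map_neg]
    change -(ℓ m) (scrL lam pd p ρ nabla n g M) - -scrL lam pd p ρ nabla n
      (fun m' => ℓ m (g m')) M = 0
    rw [h2, sub_self]
  have h2 := negScrL_rlie lam pd p ρ nabla hsmul hα hlie m n
  have h3 : ⁅coef ((ℓ m).restrictScalars ℂ), coef ((ℓ n).restrictScalars ℂ)⁆ =
      (m - n) • coef ((ℓ (m + n)).restrictScalars ℂ) + (if m + n = 0 then
        algebraMap ℂ ℂ (((m : ℂ) ^ 3 - m) / 12 * c) else 0) • 1 := by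
    apply LinearMap.ext; intro g; funext M
    have h4 := LinearMap.congr_fun (hℓ m n) (g M)
    have h5 : (((if m + n = 0 then algebraMap ℂ ℂ (((m : ℂ) ^ 3 - m) / 12 * c) else 0) •
        (1 : Module.End ℂ (ℤ → N))) g) M = (if m + n = 0 then
        algebraMap ℂ A (((m : ℂ) ^ 3 - m) / 12 * c) else 0) • g M := by
      rw [LinearMap.smul_apply, Module.End.one_apply, Pi.smul_apply, ← algebraMap_smul A]
      split_ifs <;> simp
    rw [LinearMap.add_apply, Pi.add_apply, h5]
    exact h4
  rw [← Ring.lie_def, totalL, totalL, totalL, add_rlie, rlie_add, rlie_add, h1, rlie_skew (negScrL ..) (coef _),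
    h1, h2, h3, smul_add]
  abel

end VectorFieldRepresentation

/-! ### Existence of vertex operators -/

section ToFock

variable {A : Type*} [CommRing A] [Algebra ℂ A] (ρ : ℂ) (r : ℕ) (lam : ℕ → A) {Λ : ℕ → A}
  (hΛ : ∀ n : ℕ, r ≤ n → ell ρ r lam n = Λ n)

theorem toFock_irrVec : toFock ρ r lam hΛ (irrVec A (1 - 12 * ρ ^ 2) r Λ) = 1 :=
  irrLift_irrVec _ _ _

theorem toFock_L (n : ℤ) (x : IrrVerma A (1 - 12 * ρ ^ 2) r Λ) :
    toFock ρ r lam hΛ (L A (1 - 12 * ρ ^ 2) n • x) = vir ρ r lam n (toFock ρ r lam hΛ x) :=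
  irrLift_L _ _ _ n x

theorem toFock_smul_irrVec (u : Vir A (1 - 12 * ρ ^ 2)) :
    toFock ρ r lam hΛ (u • irrVec A (1 - 12 * ρ ^ 2) r Λ) = virRep (isVir_vir ρ r lam) u 1 := by
  rw [toFock, irrLift_smul, irrLift_irrVec]

end ToFock

section Existence

variable {r : ℕ} {A : Type*} [CommRing A] [Algebra ℂ A] (lam : ℕ → A) (lamInv B : A)
  (pd : Finset.Icc 1 r → Derivation ℂ A A) (ρ Δ : ℂ) (p : Params r A)

/-- Construction of a vertex operator on a module `F` isomorphic to the irregular Verma module: `Φ` is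
the map from the Verma module to Laurent series, with the action of the `L_n - scrL n`, that sends
the highest weight vector to `f`. -/
theorem nonempty_vertexOp_of_equiv {F : Type*} [AddCommGroup F] [Module A F] [Module ℂ F]
    [IsScalarTower ℂ A F] (e : IrrVerma A (1 - 12 * ρ ^ 2) r p.l ≃ₗ[A] F)
    {ℓ : ℤ → Module.End A F} (he : ∀ n x, e (L A (1 - 12 * ρ ^ 2) n • x) = ℓ n (e x))
    (hℓ : IsVir (1 - 12 * ρ ^ 2) ℓ) (nabla : Finset.Icc 1 r → (F →+ F))
    (hsmul : ∀ q (a : A) x, nabla q (a • x) = pd q a • x + a • nabla q x)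
    (hnab : ∀ q (n : ℤ) x, nabla q (ℓ n x) = ℓ n (nabla q x)) (hα : ∀ q, pd q p.α = 0)
    (hlie : ∀ m n, ⁅scrDlin lam pd p ρ nabla hsmul m, scrDlin lam pd p ρ nabla hsmul n⁆ =
      ((n : ℤ) - m) • scrDlin lam pd p ρ nabla hsmul (m + n))
    {f : ℤ → F} (hneg : ∀ m < 0, f m = 0) (h0 : f 0 = e (irrVec A (1 - 12 * ρ ^ 2) r p.l))
    (hf : ∀ n : ℕ, (fun m => ℓ n (f m) - (if n = 0 then algebraMap ℂ A Δ else 0) • f m) =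
      scrL lam pd p ρ nabla n f) : Nonempty (VertexOp lam pd ρ Δ p) := by
  have hvir := isVir_totalL lam pd p ρ nabla hsmul hℓ hα hnab hlie
  have hw : ∀ n : ℕ, 0 ≤ n → totalL lam pd p ρ nabla hsmul ℓ n f = (if n = 0 then Δ else 0) • f := by
    intro n _
    funext m
    have h := congrFun (hf n) m
    rw [totalL_apply, ← h, sub_sub_cancel, Pi.smul_apply, ← algebraMap_smul A]
    split_ifs <;> simp
  let Ψ : Verma (1 - 12 * ρ ^ 2) Δ →ₗ[ℂ] (ℤ → F) := irrLift hvir f hw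
  have hΨL : ∀ (n : ℤ) u m, Ψ (L ℂ (1 - 12 * ρ ^ 2) n • u) m =
      ℓ n (Ψ u m) - scrL lam pd p ρ nabla n (Ψ u) m := fun n u m => by
    rw [← totalL_apply lam pd p ρ nabla hsmul]
    exact congrFun (irrLift_L hvir f hw n u) m
  have hΨ0 : Ψ (hwVec (1 - 12 * ρ ^ 2) Δ) = f := irrLift_irrVec hvir f hw
  have hes : ∀ n x, e.symm (ℓ n x) = L A (1 - 12 * ρ ^ 2) n • e.symm x := fun n x => by
    rw [LinearEquiv.symm_apply_eq, he, LinearEquiv.apply_symm_apply]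
  refine ⟨{
    nabla := fun q => (e.symm : F →+ _).comp ((nabla q).comp (e : _ →+ F))
    nabla_smul := fun q a x => ?_
    nabla_L := fun q n x => ?_
    Φ := ((e.symm.toLinearMap.restrictScalars ℂ).compLeft ℤ).comp Ψ
    bounded := fun u => ?_
    α_const := hα
    comm := fun n u => ?_
    hw_neg := fun m hm => ?_
    hw_zero := ?_ }⟩
  · change e.symm (nabla q (e (a • x))) = pd q a • x + a • e.symm (nabla q (e x))
    rw [map_smul, hsmul, map_add, map_smul, map_smul, LinearEquiv.symm_apply_apply]
  · change e.symm (nabla q (e (L A (1 - 12 * ρ ^ 2) n • x))) =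
      L A (1 - 12 * ρ ^ 2) n • e.symm (nabla q (e x))
    rw [he, hnab, hes]
  · -- boundedness is inherited by `L_n u`, as `scrL n` lowers the order by a bounded amount
    let S : Submodule ℂ (Verma (1 - 12 * ρ ^ 2) Δ) :=
      { carrier := {u | ∃ N : ℤ, ∀ m < N, Ψ u m = 0}
        add_mem' := by
          rintro u u' ⟨N, hN⟩ ⟨N', hN'⟩
          refine ⟨min N N', fun m hm => ?_⟩
          rw [map_add, Pi.add_apply, hN m (by omega), hN' m (by omega), add_zero]
        zero_mem' := ⟨0, fun m _ => by rw [map_zero, Pi.zero_apply]⟩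
        smul_mem' := by
          rintro a u ⟨N, hN⟩
          exact ⟨N, fun m hm => by rw [map_smul, Pi.smul_apply, hN m hm, smul_zero]⟩ }
    have hS : u ∈ S := by
      refine irrVerma_induction S ⟨0, fun m hm => ?_⟩ ?_ u
      · exact (congrFun hΨ0 m).trans (hneg m hm)
      · rintro n x ⟨N, hN⟩
        refine ⟨min N (N + n - 3 * r), fun m hm => ?_⟩
        rw [hΨL, hN m (by omega), map_zero, scrL_eq_zero lam pd p ρ nabla hN n m (by omega), sub_zero]
    obtain ⟨N, hN⟩ := hS
    refine ⟨N, fun m hm => ?_⟩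
    change e.symm (Ψ u m) = 0
    rw [hN m hm, map_zero]
  · rw [rhs_eq_scrL]
    funext m
    change L A (1 - 12 * ρ ^ 2) n • e.symm (Ψ u m) - e.symm (Ψ (L ℂ (1 - 12 * ρ ^ 2) n • u) m) =
      scrL lam pd p ρ _ n (fun m => e.symm.toLinearMap (Ψ u m)) m
    rw [← map_scrL lam pd p ρ nabla _ e.symm.toLinearMap, hΨL, map_sub, hes]
    · exact sub_sub_cancel ..
    · intro q x
      change e.symm (nabla q x) = e.symm (nabla q (e (e.symm x)))
      rw [LinearEquiv.apply_symm_apply]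
  · change e.symm (Ψ (hwVec (1 - 12 * ρ ^ 2) Δ) m) = 0
    rw [hΨ0, hneg m hm, map_zero]
  · change e.symm (Ψ (hwVec (1 - 12 * ρ ^ 2) Δ) 0) = _
    rw [hΨ0, h0, LinearEquiv.symm_apply_apply]

/-- A formal solution defines a vertex operator. -/
theorem nonempty_vertexOp (hlam : lam r * lamInv = 1)
    (hpd : ∀ (q : Finset.Icc 1 r) (i : ℕ), i ≤ r → pd q (lam i) = if i = (q : ℕ) then 1 else 0)
    (hB : ∀ q : Finset.Icc 1 r, lam r * pd q B = if (q : ℕ) = r then B else 0)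
    (hcomm : ∀ q q' a, pd q (pd q' a) = pd q' (pd q a)) {γ : ℕ → A} {f : ℤ → MvPolynomial ℕ A}
    (hγ : γ r = -(r * B)) (hr : 1 ≤ r) (hneg : ∀ j < 0, f j = 0) (h0 : f 0 = 1)
    (hf : ∀ k, opN ρ r (mom r lam lamInv B) γ (algebraMap ℂ A Δ) k f = 0) (hγ0 : γ 0 = p.α)
    (hγs : ∀ s ∈ Finset.Icc 1 r, γ s = -((s : A) * p.b s))
    (hΛ : ∀ n : ℕ, r ≤ n → ell ρ r (mom r lam lamInv B) n = p.l n) :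
    Nonempty (VertexOp lam pd ρ Δ p) := by
  obtain ⟨s, hs⟩ := exists_connection lam lamInv B pd hlam hpd hB ρ Δ hγ hr hneg h0 hf p hγs
  have hsmul := fun (q : Finset.Icc 1 r) a x => nab_smul (pd q) q (s q) a x
  have hvir := fun (q : Finset.Icc 1 r) (n : ℤ) x =>
    nab_vir ρ (Finset.mem_Icc.1 q.2).1 (Finset.mem_Icc.1 q.2).2
      (fun i hi => pd_mom lam lamInv B pd hlam hpd hB q hi) (s q) n x
  have hα : ∀ q, pd q p.α = 0 := fun q => by
    rw [← hγ0]
    exact pd_exponent_eq_zero lam lamInv B pd hlam hpd hB ρ Δ hγ hr hneg h0 hf q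
  have hflat : ∀ q q' : Finset.Icc 1 r, ∃ c : A, ∀ x, nab (pd q) q (s q) (nab (pd q') q' (s q') x) -
      nab (pd q') q' (s q') (nab (pd q) q (s q) x) = c • x := fun q q' =>
    ⟨_, fun x => nab_nab_sub (hcomm q q') q q' (s q) (s q') x⟩
  have hmom : mom r lam lamInv B r * lamInv = 1 := by rw [mom_of_pos _ _ _ hr, hlam]
  refine nonempty_vertexOp_of_equiv lam pd ρ Δ p
    (LinearEquiv.ofBijective _ (toFock_bijective ρ r _ hmom hΛ hr))
    (toFock_L ρ r _ hΛ) (isVir_vir ρ r _) (fun q => nab (pd q) q (s q)) hsmul hvir hα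
    (scrDlin_lie lam pd p ρ _ γ _ hsmul hvir hα hγ0 hγs hpd hflat hneg h0 Δ hs) hneg ?_ ?_
  · rw [h0]
    exact (toFock_irrVec ρ r _ hΛ).symm
  · refine fun n => Eq.trans ?_ (scrL_eq lam pd p ρ _ n f).symm
    refine (hw_equations_iff (fun n m => vir ρ r (mom r lam lamInv B) n (f m) -
      (if n = 0 then algebraMap ℂ A Δ else 0) • f m)
      (fun k => scrD lam pd p ρ (fun q => nab (pd q) q (s q)) k f) (zpow 1 (dz p f))).2 (fun n => ?_) n
    rw [hs, opT_eq_sum, thetaOp_eq p γ hγ0 hγs]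

end Existence

/-- The exponents `α` and `-i β_i` of the prefactor in the normalization of `thetaOp`: the operator
`z ∂_z` acts on the prefactor as `∑_s (p.exps s) z^{-s}`. -/
def Params.exps {r : ℕ} {A : Type*} [CommRing A] (p : Params r A) (s : ℕ) : A :=
  if s = 0 then p.α else -(s * p.b s)

theorem Params.exps_zero {r : ℕ} {A : Type*} [CommRing A] (p : Params r A) : p.exps 0 = p.α :=
  if_pos rfl

theorem Params.exps_of_mem {r : ℕ} {A : Type*} [CommRing A] (p : Params r A) {s : ℕ}
    (hs : s ∈ Finset.Icc 1 r) : p.exps s = -((s : A) * p.b s) :=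
  if_neg (by have := (Finset.mem_Icc.1 hs).1; omega)

/-! ### Necessary conditions -/

section SolvedEquations

variable {r : ℕ} {A : Type*} [CommRing A] [Algebra ℂ A] (lam : ℕ → A)
  (pd : Finset.Icc 1 r → Derivation ℂ A A) (p : Params r A) (ρ : ℂ)
  {N : Type*} [AddCommGroup N] [Module A N] (nabla : Finset.Icc 1 r → (N →+ N))
  {w : ℤ → N} {x : ℕ → ℤ → N} (hneg : ∀ m < 0, w m = 0) (hx : ∀ n, ∀ m < 0, x n m = 0)
  (hscr : ∀ n : ℕ, scrD lam pd p ρ nabla n w =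
    ∑ i ∈ Finset.range (n + 1), (((n : ℤ) - i).negOnePow : ℤ) •
      Ring.choose ((n : ℤ) + 1) (i + 1) • shift ℤ _ (n - i) (x i) -
      ((n : ℤ).negOnePow : ℤ) • shift ℤ _ n (thetaOp r p.exps _ w))
  (h0 : ∀ a : A, a • w 0 = 0 → a = 0) (hr : 1 ≤ r)

include hx hscr in
/-- In orders `m ≤ 0` only the term `i = n` of the sum contributes, as `x i` has no poles. -/
theorem scrD_apply_of_nonpos (n : ℕ) {m : ℤ} (hm : m ≤ 0) : scrD lam pd p ρ nabla n w m = x n m -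
    sgn A n • ((m - n) • w (m - n) + ∑ s ∈ Finset.range (r + 1), p.exps s • w (m - n + s)) := by
  rw [hscr, Finset.sum_range_succ, choose_self, sub_self, one_smul, shift_zero, Int.negOnePow_zero,
    Units.val_one, one_smul, Pi.sub_apply, Pi.add_apply, Pi.smul_apply, shift_apply, thetaOp_apply,
    Finset.sum_apply, Finset.sum_eq_zero, zero_add, sgn, Int.cast_smul_eq_zsmul]
  intro i hi
  rw [Finset.mem_range] at hi
  rw [Pi.smul_apply, Pi.smul_apply, shift_apply, hx _ _ (by omega), smul_zero, smul_zero]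

include hneg hx hscr h0 hr

/-- The eigenvalues `Λ_n`, from the coefficient of `|Λ⟩`. -/
theorem eigenvalue_eq {n : ℕ} (hn : r ≤ n) {Λ : A} (hΛ : x n 0 = Λ • w 0) :
    Λ = ell ρ r lam n + if n = r then sgn A (r + 1) * (r * p.b r) else 0 := by
  have h := scrD_apply_of_nonpos lam pd p ρ nabla hx hscr n le_rfl
  rw [scrD, dlam_eq_zero lam pd p _ hn, zero_add, Pi.smul_apply, hΛ, hneg (0 - n) (by omega),
    smul_zero, zero_add] at h
  have h1 : ∑ s ∈ Finset.range (r + 1), p.exps s • w (0 - n + s) =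
      (if n = r then -(r * p.b r) else 0) • w 0 := by
    rw [Finset.sum_range_succ, Finset.sum_eq_zero, zero_add]
    · by_cases hnr : n = r
      · rw [if_pos hnr, hnr, p.exps_of_mem (Finset.mem_Icc.2 ⟨hr, le_rfl⟩),
          show (0 : ℤ) - r + r = 0 by ring]
      · rw [if_neg hnr, hneg _ (by omega), smul_zero, zero_smul]
    · intro s hs
      rw [Finset.mem_range] at hs
      rw [hneg _ (by omega), smul_zero]
  rw [h1, smul_smul, ← sub_smul, ← sub_eq_zero, ← sub_smul] at h
  have h2 := h0 _ h
  rw [sgn_add]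
  by_cases hnr : n = r
  · subst hnr
    rw [if_pos rfl] at h2 ⊢
    have : sgn A 1 = -1 := by simp [sgn]
    rw [this]
    linear_combination -h2
  · rw [if_neg hnr] at h2 ⊢
    linear_combination -h2

/-- The action of the vector fields `D_n` on `β_r`, from the coefficients of `z^{-i}|Λ⟩`. -/
theorem D_exponent_eq {n : ℕ} (hn : n < r) :
    D lam (fun q => pd q) n (p.b r) = if n = 0 then (r : A) * p.b r else 0 := by
  -- the coefficient of `z^m`, `m < 0`, of the equation of index `n` is `∑_i κ_i w_{m+i} = 0`
  let κ : ℕ → A := fun i => D lam (fun q => pd q) n (p.b i) +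
    sgn A n * (if i + n ≤ r then p.exps (i + n) else 0)
  have hD : ∀ k, D lam (fun q => nabla q) k (0 : N) = 0 :=
    fun k => map_zero (AddMonoidHom.mk' (D lam (fun q => nabla q) k) (D_add lam nabla k))
  have h1 : ∀ m : ℤ, m ≤ -(1 : ℕ) → ∑ i ∈ Finset.range (r + 1), κ i • w (m + i) = 0 := by
    intro m hm
    have h := scrD_apply_of_nonpos lam pd p ρ nabla hx hscr n (m := m) (by omega)
    rw [scrD, Pi.add_apply, Pi.smul_apply, dlam, hneg m (by omega), hneg (m - n) (by omega),
      hD, hx n m (by omega), smul_zero, smul_zero, zero_add, zero_add, add_zero, zero_sub] at h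
    have h2 : ∑ s ∈ Finset.range (r + 1), p.exps s • w (m - n + s) =
        ∑ i ∈ Finset.Icc 1 r, (if i + n ≤ r then p.exps (i + n) else 0) • w (m + i) := by
      refine (Finset.sum_bij_ne_zero (fun i _ _ => i + n) ?_ ?_ ?_ ?_).symm
      · intro i _ hi
        rw [Finset.mem_range]
        by_contra hc
        rw [if_neg (by omega), zero_smul] at hi
        exact hi rfl
      · intro i _ _ j _ _ hij
        exact Nat.add_right_cancel hij
      · intro s hs hs0
        rw [Finset.mem_range] at hs
        have hns : n < s := by
          by_contra hc
          rw [hneg _ (by omega), smul_zero] at hs0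
          exact hs0 rfl
        have e1 : s - n + n = s := by omega
        refine ⟨s - n, Finset.mem_Icc.2 (by omega), ?_, e1⟩
        rw [e1, if_pos (by omega), show m + (s - n : ℕ) = m - n + s by omega]
        exact hs0
      · intro i _ hi
        have : i + n ≤ r := by
          by_contra hc
          rw [if_neg hc, zero_smul] at hi
          exact hi rfl
        rw [if_pos this, show m - n + (i + n : ℕ) = m + i by omega]
    rw [h2, ← sub_eq_zero, sub_neg_eq_add, Finset.smul_sum, ← Finset.sum_add_distrib] at h
    rw [Finset.range_eq_Ico, Finset.sum_eq_sum_Ico_succ_bot (by omega), Nat.cast_zero, add_zero,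
      hneg m (by omega), smul_zero, zero_add, ← h]
    refine Finset.sum_congr (by ext; simp only [Finset.mem_Ico, Finset.mem_Icc]; omega) fun i _ => ?_
    rw [smul_smul, ← add_smul]
  have h3 := eq_zero_of_sum_smul hneg h0 κ r 1 h1 r hr le_rfl
  have h4 := eq_neg_of_add_eq_zero_left h3
  rw [h4]
  by_cases hn0 : n = 0
  · subst hn0
    rw [if_pos (by omega), if_pos rfl, add_zero, p.exps_of_mem (Finset.mem_Icc.2 ⟨hr, le_rfl⟩),
      Nat.cast_zero, sgn_zero, one_mul, neg_neg]
  · rw [if_neg (by omega), if_neg hn0, mul_zero, neg_zero]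

end SolvedEquations

section Modules

variable {A : Type*} [CommRing A] {N : Type*} [AddCommGroup N] [Module A N]

theorem sub_ite_algebraMap_smul [Algebra ℂ A] [Module ℂ N] [IsScalarTower ℂ A N] (P : Prop)
    [Decidable P] (Δ : ℂ) (x y : N) :
    x - (if P then algebraMap ℂ A Δ else 0) • y = x - (if P then Δ else 0) • y := by
  rw [← algebraMap_smul A (if P then Δ else 0), apply_ite (algebraMap ℂ A), map_zero]

theorem sub_ite_smul_of_not {P : Prop} [Decidable P] (hP : ¬P) (a : A) (x y : N) :
    x - (if P then a else 0) • y = x := by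
  rw [if_neg hP, zero_smul, sub_zero]

theorem sub_smul_eq_zero {x y : N} (hx : x = 0) (hy : y = 0) (a : A) : x - a • y = 0 := by
  rw [hx, hy, smul_zero, sub_zero]

end Modules

/-! ### The highest weight vector of a vertex operator -/

section HighestWeightVector

variable {r : ℕ} {A : Type*} [CommRing A] [Algebra ℂ A] {lam : ℕ → A}
  {pd : Finset.Icc 1 r → Derivation ℂ A A} {ρ Δ : ℂ} {p : Params r A} (V : VertexOp lam pd ρ Δ p)

namespace VertexOp

/-- The coefficients of `Φ(z)|Δ⟩`, indexed by integers. -/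
noncomputable def w : ℤ → IrrVerma A (1 - 12 * ρ ^ 2) r p.l := V.Φ (hwVec (1 - 12 * ρ ^ 2) Δ)

theorem w_neg (m : ℤ) (hm : m < 0) : V.w m = 0 := V.hw_neg m hm

theorem w_zero : V.w 0 = irrVec A (1 - 12 * ρ ^ 2) r p.l := V.hw_zero

theorem comm_eq_scrL (n : ℤ) (u : Verma (1 - 12 * ρ ^ 2) Δ) :
    (fun m => L A (1 - 12 * ρ ^ 2) n • V.Φ u m) - V.Φ (L ℂ (1 - 12 * ρ ^ 2) n • u) =
      scrL lam pd p ρ V.nabla n (V.Φ u) :=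
  (V.comm n u).trans (rhs_eq_scrL lam pd p ρ V.nabla n (V.Φ u))

theorem eq_zero_of_smul_w (hr : 1 ≤ r) {a : A} (ha : a • V.w 0 = 0) : a = 0 :=
  eq_zero_of_smul_irrVec_eq_zero ρ r hr p.l (fun n hn => by
    rw [Params.l, dif_neg (by rw [Finset.mem_Icc]; omega)]) (V.w_zero ▸ ha)

/-- The image of the highest weight vector under `L_n - Δ δ_{n0}`. -/
noncomputable def x (n : ℕ) (m : ℤ) : IrrVerma A (1 - 12 * ρ ^ 2) r p.l :=
  L A (1 - 12 * ρ ^ 2) n • V.w m - (if n = 0 then algebraMap ℂ A Δ else 0) • V.w m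

theorem x_neg (n : ℕ) (m : ℤ) (hm : m < 0) : V.x n m = 0 := by
  refine sub_smul_eq_zero (A := A) ?_ (V.w_neg m hm) _
  rw [V.w_neg m hm, smul_zero]

theorem x_zero {n : ℕ} (hn : r ≤ n) (hr : 1 ≤ r) : V.x n 0 = p.l n • V.w 0 := by
  refine (sub_ite_smul_of_not (show n ≠ 0 by omega) (algebraMap ℂ A Δ)
    (L A (1 - 12 * ρ ^ 2) n • V.w 0) (V.w 0)).trans ?_
  rw [V.w_zero, L_smul_irrVec hn]

/-- The equations for the highest weight vector, solved for the action of the derivations. -/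
theorem scrD_w (n : ℕ) : scrD lam pd p ρ V.nabla n V.w =
    ∑ i ∈ Finset.range (n + 1), (((n : ℤ) - i).negOnePow : ℤ) •
      Ring.choose ((n : ℤ) + 1) (i + 1) • shift ℤ _ (n - i)
        (V.x i) -
      ((n : ℤ).negOnePow : ℤ) • shift ℤ _ n (thetaOp r p.exps _ V.w) := by
  rw [thetaOp_eq p p.exps p.exps_zero fun s hs => p.exps_of_mem hs]
  refine (hw_equations_iff V.x (fun k => scrD lam pd p ρ V.nabla k V.w)
    (zpow 1 (dz p V.w))).1 (fun n => ?_) n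
  refine Eq.trans ?_ (scrL_eq lam pd p ρ V.nabla n V.w)
  rw [w, ← V.comm_eq_scrL, hwVec, L_smul_irrVec (Nat.zero_le n), map_smul]
  funext m
  rw [Pi.sub_apply, Pi.smul_apply]
  exact sub_ite_algebraMap_smul (A := A) (n = 0) Δ (L A (1 - 12 * ρ ^ 2) n • V.w m) (V.w m)

variable (hr : 1 ≤ r)
include V hr

theorem l_eq {n : ℕ} (hn : r ≤ n) :
    p.l n = ell ρ r lam n + if n = r then sgn A (r + 1) * (r * p.b r) else 0 :=
  eigenvalue_eq lam pd p ρ V.nabla V.w_neg V.x_neg V.scrD_w (fun _ => V.eq_zero_of_smul_w hr) hr hn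
    (V.x_zero hn hr)

theorem Dder_b (n : ℕ) (hn : n < r) :
    D lam (fun q => pd q) n (p.b r) = if n = 0 then (r : A) * p.b r else 0 :=
  D_exponent_eq lam pd p ρ V.nabla V.w_neg V.x_neg V.scrD_w (fun _ => V.eq_zero_of_smul_w hr) hr hn

variable {lamInv : A} (hlam : lam r * lamInv = 1)
include hlam

/-- The function `β_r / λ_r` is constant in `λ_1, …, λ_r`. -/
theorem lam_mul_pd_b (q : Finset.Icc 1 r) :
    lam r * pd q (p.b r) = if (q : ℕ) = r then p.b r else 0 := by
  rw [← sub_eq_zero]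
  refine eq_zero_of_triangular lam hlam
    (fun q => lam r * pd q (p.b r) - if (q : ℕ) = r then p.b r else 0) (fun n hn => ?_) q
  have h1 := V.Dder_b hr n hn
  have h2 : ∑ q : Finset.Icc 1 r, (if (q : ℕ) + n ≤ r then (((q : ℕ) : A) * lam ((q : ℕ) + n)) •
      (if (q : ℕ) = r then p.b r else 0) else 0) = lam r * if n = 0 then (r : A) * p.b r else 0 := by
    rw [Finset.sum_eq_single (⟨r, Finset.mem_Icc.2 ⟨hr, le_rfl⟩⟩ : Finset.Icc 1 r)]
    · by_cases hn0 : n = 0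
      · subst hn0
        rw [if_pos (by simp), if_pos rfl, if_pos rfl, smul_eq_mul, add_zero]
        ring
      · rw [if_neg (by simp; omega), if_neg hn0, mul_zero]
    · intro q _ hq
      have : (q : ℕ) ≠ r := fun hc => hq (Subtype.ext hc)
      rw [if_neg this, smul_zero, ite_self]
    · intro hc; exact absurd (Finset.mem_univ _) hc
  have h3 : ∑ q : Finset.Icc 1 r, (if (q : ℕ) + n ≤ r then (((q : ℕ) : A) * lam ((q : ℕ) + n)) •
      (lam r * pd q (p.b r)) else 0) = lam r * if n = 0 then (r : A) * p.b r else 0 := by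
    rw [← h1, D, Finset.mul_sum]
    refine Finset.sum_congr rfl fun q _ => ?_
    rw [mul_ite, mul_zero, smul_eq_mul, smul_eq_mul, mul_left_comm]
  have h4 := sub_eq_zero.2 (h3.trans h2.symm)
  rw [← Finset.sum_sub_distrib] at h4
  refine Eq.trans (Finset.sum_congr rfl fun q _ => ?_) h4
  by_cases hq : (q : ℕ) + n ≤ r
  · simp only [if_pos hq, smul_sub]
  · simp only [if_neg hq, sub_zero]

theorem ell_mom_eq_l {n : ℕ} (hn : r ≤ n) : ell ρ r (mom r lam lamInv (p.b r)) n = p.l n := by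
  rw [ell_mom lam lamInv _ hlam ρ hr hn, V.l_eq hr hn]

/-- In the Fock space, the coefficients of `Φ(z)|Δ⟩` form a formal solution. -/
theorem opN_toFock (hΛ : ∀ n : ℕ, r ≤ n → ell ρ r (mom r lam lamInv (p.b r)) n = p.l n) (k : ℕ) :
    opN ρ r (mom r lam lamInv (p.b r)) p.exps (algebraMap ℂ A Δ) k
      (fun m => toFock ρ r _ hΛ (V.w m)) = 0 := by
  have h1 : opT ρ r (mom r lam lamInv (p.b r)) p.exps (algebraMap ℂ A Δ) (r + k)
      (fun m => toFock ρ r _ hΛ (V.w m)) =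
      fun m => toFock ρ r _ hΛ (scrD lam pd p ρ V.nabla (r + k) V.w m) := by
    funext m
    rw [opT_eq_sum, V.scrD_w]
    simp only [Pi.sub_apply, Finset.sum_apply, Pi.smul_apply, shift_apply, map_sub, map_sum,
      map_zsmul, map_smul, x, toFock_L, thetaOp_apply, map_add]
  rw [opN, LinearMap.sub_apply, h1, ← Nat.cast_add, ell_mom lam lamInv _ hlam ρ hr (by omega)]
  funext m
  rw [scrD, dlam_eq_zero lam pd p _ (by omega), zero_add, Pi.sub_apply, Pi.smul_apply, map_smul,
    LinearMap.smul_apply, Module.End.one_apply, Pi.smul_apply, ← sub_smul,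
    p.exps_of_mem (Finset.mem_Icc.2 ⟨hr, le_rfl⟩), sgn_add]
  have : sgn A 1 = -1 := by simp [sgn]
  rw [this]
  by_cases hk : k = 0
  · subst hk
    simp
  · rw [if_neg (by omega), if_neg hk]
    simp

end VertexOp

end HighestWeightVector

/-! ### Uniqueness of vertex operators -/

section Uniqueness

variable {r : ℕ} {A : Type*} [CommRing A] [Algebra ℂ A] {lam : ℕ → A}
  {pd : Finset.Icc 1 r → Derivation ℂ A A} {ρ Δ : ℂ} {p : Params r A}
  {lamInv : A} (hlam : lam r * lamInv = 1)
include hlam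

/-- A vertex operator is determined by the image of the highest weight vector. -/
theorem VertexOp.eq_of_w_eq {V V' : VertexOp lam pd ρ Δ p} (h : V.w = V'.w) : V = V' := by
  -- the derivations on `|Λ⟩` are determined by the coefficient of `z^0` in the equations for `n < r`
  have h1 : ∀ q, V.nabla q (irrVec A (1 - 12 * ρ ^ 2) r p.l) =
      V'.nabla q (irrVec A (1 - 12 * ρ ^ 2) r p.l) := by
    intro q
    rw [← sub_eq_zero]
    refine eq_zero_of_triangular lam hlam (fun q => V.nabla q (irrVec A (1 - 12 * ρ ^ 2) r p.l) -
      V'.nabla q (irrVec A (1 - 12 * ρ ^ 2) r p.l)) (fun n _ => ?_) q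
    have h2 : scrD lam pd p ρ V.nabla n V.w = scrD lam pd p ρ V'.nabla n V'.w := by
      rw [V.scrD_w, V'.scrD_w, show V.x = V'.x by unfold x; rw [h], h]
    have h3 := congrFun h2 0
    rw [scrD, scrD, Pi.add_apply, Pi.add_apply, ← h, add_left_inj, dlam, dlam, add_left_inj,
      V.w_zero, D, D, ← sub_eq_zero, ← Finset.sum_sub_distrib] at h3
    refine Eq.trans (Finset.sum_congr rfl fun q _ => ?_) h3
    split_ifs <;> simp only [smul_sub, sub_zero]
  have h2 : V.nabla = V'.nabla := by
    funext q
    refine AddMonoidHom.ext fun x => ?_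
    let S : Submodule A (IrrVerma A (1 - 12 * ρ ^ 2) r p.l) :=
      { carrier := {x | V.nabla q x = V'.nabla q x}
        add_mem' := fun {x y} hx hy => by
          change V.nabla q x = V'.nabla q x at hx
          change V.nabla q y = V'.nabla q y at hy
          change V.nabla q (x + y) = V'.nabla q (x + y)
          rw [map_add, map_add, hx, hy]
        zero_mem' := (map_zero (V.nabla q)).trans (map_zero (V'.nabla q)).symm
        smul_mem' := fun a x hx => by
          change V.nabla q x = V'.nabla q x at hx
          change V.nabla q (a • x) = V'.nabla q (a • x)
          rw [V.nabla_smul, V'.nabla_smul, hx] }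
    refine irrVerma_induction S (h1 q) (fun n x hx => ?_) x
    change V.nabla q _ = V'.nabla q _
    rw [V.nabla_L, V'.nabla_L, show V.nabla q x = V'.nabla q x from hx]
  refine VertexOp.ext h2 (LinearMap.ext fun u => ?_)
  refine irrVerma_induction (LinearMap.eqLocus V.Φ V'.Φ) h (fun n x hx => ?_) u
  rw [LinearMap.mem_eqLocus] at hx ⊢
  have e1 := V.comm_eq_scrL n x
  have e2 := V'.comm_eq_scrL n x
  rw [hx, h2, ← e2] at e1
  exact sub_right_injective e1

variable (hr : 1 ≤ r) {γ : ℕ → A} {f : ℤ → MvPolynomial ℕ A} (hγ : γ r = -(r * p.b r))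
  (hneg : ∀ j < 0, f j = 0) (h0 : f 0 = 1)
  (hf : ∀ k, opN ρ r (mom r lam lamInv (p.b r)) γ (algebraMap ℂ A Δ) k f = 0)
include hr hγ hneg h0 hf

/-- The prefactor and the coefficients of `Φ(z)|Δ⟩` are those of the formal solution. -/
theorem VertexOp.exps_eq_and_toFock_w (V : VertexOp lam pd ρ Δ p)
    (hΛ : ∀ n : ℕ, r ≤ n → ell ρ r (mom r lam lamInv (p.b r)) n = p.l n) :
    (∀ s ≤ r, p.exps s = γ s) ∧ ∀ m, toFock ρ r _ hΛ (V.w m) = f m := by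
  have hmom : mom r lam lamInv (p.b r) r * lamInv = 1 := by rw [mom_of_pos _ _ _ hr, hlam]
  have h := formal_solution_unique ρ (mom r lam lamInv (p.b r)) γ (algebraMap ℂ A Δ) hmom hr
    (γ' := p.exps) (f' := fun m => toFock ρ r _ hΛ (V.w m))
    (by rw [p.exps_of_mem (Finset.mem_Icc.2 ⟨hr, le_rfl⟩), hγ]) hneg h0 hf
    (fun j hj => by rw [V.w_neg j hj, map_zero]) (by rw [V.w_zero, toFock_irrVec])
    (V.opN_toFock hr hlam hΛ)
  exact ⟨h.1, fun m => congrFun h.2 m⟩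

end Uniqueness

/-! ### Holomorphic functions -/

section Holomorphic

variable {r : ℕ} (U : TopologicalSpace.Opens (Fin (r + 1) → ℂ))

theorem ext0_eventuallyEq {f : U → ℂ} {g : (Fin (r + 1) → ℂ) → ℂ} (h : ∀ x : U, f x = g x)
    {x : Fin (r + 1) → ℂ} (hx : x ∈ U) : ext0 U f =ᶠ[nhds x] g := by
  filter_upwards [U.isOpen.mem_nhds hx] with y hy
  rw [ext0_apply f hy, h]

theorem partialD_apply (i : Fin (r + 1)) (f : Hol U) (x : U) :
    (partialD U i f : U → ℂ) x = fderiv ℂ (ext0 U f) x (Pi.single i 1) := rfl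

theorem partialD_coord (i j : Fin (r + 1)) : partialD U i (coord U j) = if j = i then 1 else 0 := by
  apply Subtype.ext; funext x
  have h : ext0 U (coord U j : U → ℂ) =ᶠ[nhds (x : Fin (r + 1) → ℂ)]
      ContinuousLinearMap.proj (R := ℂ) (φ := fun _ : Fin (r + 1) => ℂ) j :=
    ext0_eventuallyEq U (f := (coord U j : U → ℂ)) (fun _ => rfl) x.2
  rw [partialD_apply, h.fderiv_eq, ContinuousLinearMap.fderiv, ContinuousLinearMap.proj_apply,
    Pi.single_apply]
  split_ifs <;> rfl

theorem partialD_comm (i j : Fin (r + 1)) (f : Hol U) :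
    partialD U i (partialD U j f) = partialD U j (partialD U i f) := by
  apply Subtype.ext; funext x
  have h1 : ∀ i j : Fin (r + 1), (partialD U i (partialD U j f) : U → ℂ) x =
      fderiv ℂ (fderiv ℂ (ext0 U f)) x (Pi.single i 1) (Pi.single j 1) := by
    intro i j
    have h : ext0 U (partialD U j f : U → ℂ) =ᶠ[nhds (x : Fin (r + 1) → ℂ)]
        fun y => fderiv ℂ (ext0 U f) y (Pi.single j 1) :=
      ext0_eventuallyEq U (f := (partialD U j f : U → ℂ)) (fun _ => rfl) x.2
    have hd : DifferentiableAt ℂ (fderiv ℂ (ext0 U f)) x := (f.2.fderiv x x.2).differentiableAt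
    rw [partialD_apply, h.fderiv_eq, fderiv_clm_apply hd (differentiableAt_const _)]
    simp
  have h2 : IsSymmSndFDerivAt ℂ (ext0 U f) x :=
    ((f.2 x x.2).contDiffAt (n := ⊤)).isSymmSndFDerivAt (by simp)
  rw [h1, h1, h2]

theorem pdHol_lamHol (q : Finset.Icc 1 r) (i : ℕ) (hi : i ≤ r) :
    pdHol U q (lamHol U i) = if i = (q : ℕ) then 1 else 0 := by
  rw [pdHol, lamHol, dif_pos (Nat.lt_succ_of_le hi), partialD_coord]
  simp only [Fin.mk.injEq]

theorem lamHol_mul_coordInv (hU : ∀ x ∈ U, x (Fin.last r) ≠ 0) : lamHol U r * coordInv U hU = 1 := by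
  rw [lamHol, dif_pos (Nat.lt_succ_self r)]
  apply Subtype.ext; funext x
  exact mul_inv_cancel₀ (hU x x.2)

end Holomorphic

/-! ### The universal formal solution -/

section Universal

/-- The exponents `β_i` and `γ_i = -i β_i` determine each other. -/
theorem eq_algebraMap_mul_iff {A : Type*} [CommRing A] [Algebra ℂ A] {i : ℕ} (hi : i ≠ 0) (x y : A) :
    x = algebraMap ℂ A (-(1 / i)) * y ↔ y = -(i * x) := by
  have h : algebraMap ℂ A (1 / i) * (i : A) = 1 := by
    rw [← map_natCast (algebraMap ℂ A), ← map_mul, one_div_mul_cancel (Nat.cast_ne_zero.2 hi), map_one]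
  rw [map_neg]
  constructor
  · rintro rfl
    linear_combination -y * h
  · intro hy
    rw [hy]
    linear_combination -x * h

/-- The values of `λ_0, λ_1, …` given by values of the variables. -/
def lamOf {r : ℕ} {A : Type*} [Zero A] (val : ParamVar r → A) (i : ℕ) : A :=
  if h : i < r + 1 then val (.lam ⟨i, h⟩) else 0

theorem comp_lamOf {r : ℕ} {A B : Type*} [CommRing A] [CommRing B] [Algebra ℂ A] [Algebra ℂ B]
    (φ : A →ₐ[ℂ] B) (val : ParamVar r → A) : φ ∘ lamOf val = lamOf (φ ∘ val) := by
  funext i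
  simp only [lamOf, Function.comp_apply]
  split_ifs
  · rfl
  · exact map_zero φ

theorem comp_mom {r : ℕ} {A B : Type*} [CommRing A] [CommRing B] [Algebra ℂ A] [Algebra ℂ B]
    (φ : A →ₐ[ℂ] B) (lam : ℕ → A) (lamInv b : A) :
    φ ∘ mom r lam lamInv b = mom r (φ ∘ lam) (φ lamInv) (φ b) := by
  funext i
  simp only [mom, Function.comp_apply, apply_ite φ, map_add, map_mul, map_natCast, map_sgn]

/-- The formal solution is universal: it is obtained from polynomials in the parameters. -/
theorem exists_universal_solution (r : ℕ) (hr : 1 ≤ r) (ρ : ℂ) :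
    ∃ (Pγ : ℕ → MvPolynomial (ParamVar r) ℂ) (Pl : ℕ → MvPolynomial (ParamVar r) ℂ)
      (Pc : ℕ → (k : ℕ) → Nat.Partition k → MvPolynomial (ParamVar r) ℂ),
      ∀ (A : Type) [CommRing A] [Algebra ℂ A] (val : ParamVar r → A),
        lamOf val r * val .lamInv = 1 →
        MvPolynomial.aeval val (Pγ r) = -(r * val .betaR) ∧
        (∀ n : ℕ, ell ρ r (mom r (lamOf val) (val .lamInv) (val .betaR)) n =
          MvPolynomial.aeval val (Pl n)) ∧
        ∃ f : ℤ → MvPolynomial ℕ A, (∀ j < 0, f j = 0) ∧ f 0 = 1 ∧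
          (∀ k, opN ρ r (mom r (lamOf val) (val .lamInv) (val .betaR))
            (fun s => MvPolynomial.aeval val (Pγ s)) (val .delta) k f = 0) ∧
          ∀ m : ℕ, f m = ∑ k ∈ Finset.range (m * (r + 1) + 1), ∑ μ : Nat.Partition k,
            MvPolynomial.aeval val (Pc m k μ) •
              virRep (isVir_vir ρ r (mom r (lamOf val) (val .lamInv) (val .betaR)))
                (Lneg A (1 - 12 * ρ ^ 2) r μ) 1 := by
  -- the formal solution over `ℂ[λ_0, …, λ_r, λ_r^{-1}, β_r, Δ]` is specialized
  let R₀ := MvPolynomial (ParamVar r) ℂ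
  let I : Ideal R₀ := Ideal.span {lamOf MvPolynomial.X r * MvPolynomial.X .lamInv - 1}
  let π : R₀ →ₐ[ℂ] R₀ ⧸ I := Ideal.Quotient.mkₐ ℂ I
  have hπ : Function.Surjective π := Ideal.Quotient.mkₐ_surjective ℂ I
  let valU : ParamVar r → R₀ ⧸ I := π ∘ MvPolynomial.X
  have hU : lamOf valU r * valU .lamInv = 1 := by
    rw [← comp_lamOf]
    change π _ * π _ = 1
    rw [← map_mul, ← sub_eq_zero,
      ← map_one π, ← map_sub]
    exact Ideal.Quotient.eq_zero_iff_mem.2 (Ideal.subset_span rfl)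
  set mu := mom r (lamOf valU) (valU .lamInv) (valU .betaR) with hmu
  have hmom : mu r * valU .lamInv = 1 := by rw [hmu, mom_of_pos _ _ _ hr, hU]
  obtain ⟨γ, f, hγ, h0, hfil, hf⟩ := exists_formal_solution ρ mu (valU .delta) hmom hr
    (-(r * valU .betaR))
  have hneg : ∀ j < 0, f j = 0 := fun j hj => fil_neg_eq_zero hr hfil hj
  have hc : ∀ m : ℕ, ∃ a : (k : ℕ) → Nat.Partition k → R₀ ⧸ I, f m =
      ∑ k ∈ Finset.range (m * (r + 1) + 1), ∑ μ : Nat.Partition k,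
        a k μ • virRep (isVir_vir ρ r mu) (Lneg (R₀ ⧸ I) (1 - 12 * ρ ^ 2) r μ) 1 := fun m =>
    exists_partition_sum ρ r mu hmom hr (m * (r + 1)) (f m) (by
      have := hfil m
      rwa [show ((r : ℤ) + 1) * m = (m * (r + 1) : ℕ) by push_cast; ring] at this)
  choose a ha using hc
  -- `σ` lifts the coefficients to polynomials
  choose σ hσ using hπ
  refine ⟨fun s => σ (γ s), fun n => σ (ell ρ r mu n), fun m k μ => σ (a m k μ),
    fun A _ _ val hval => ?_⟩
  let φ : R₀ ⧸ I →ₐ[ℂ] A := Ideal.Quotient.liftₐ I (MvPolynomial.aeval val) (fun x hx => by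
    have hle : I ≤ RingHom.ker (MvPolynomial.aeval val : R₀ →ₐ[ℂ] A) := by
      rw [Ideal.span_le, Set.singleton_subset_iff, SetLike.mem_coe, RingHom.mem_ker, map_sub, map_mul,
        map_one, sub_eq_zero, ← Function.comp_apply (f := MvPolynomial.aeval val) (g := lamOf _),
        comp_lamOf, MvPolynomial.aeval_X, ← hval]
      congr 2
      funext v
      exact MvPolynomial.aeval_X val v
    exact hle hx)
  have hφπ : ∀ P, φ (π P) = MvPolynomial.aeval val P := fun P => rfl
  have hφσ : ∀ x, MvPolynomial.aeval val (σ x) = φ x := fun x => by rw [← hφπ, hσ]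
  have hφval : φ ∘ valU = val := by
    funext v
    exact MvPolynomial.aeval_X val v
  have hφv : ∀ v, φ (valU v) = val v := congrFun hφval
  have hφmu : φ ∘ mu = mom r (lamOf val) (val .lamInv) (val .betaR) := by
    rw [hmu, comp_mom, comp_lamOf, hφval, hφv, hφv]
  refine ⟨?_, fun n => ?_, fun m => fockMap φ (f m), fun j hj => ?_, ?_, fun k => ?_, fun m => ?_⟩
  · rw [hφσ, hγ, map_neg, map_mul, map_natCast, hφv]
  · rw [hφσ, map_ell, hφmu]
  · change fockMap φ (f j) = 0
    rw [hneg j hj, map_zero]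
  · change fockMap φ (f 0) = 1
    rw [h0, map_one]
  · funext M
    have h := fockMap_opN φ ρ r mu γ (valU .delta) k f M
    rw [hf, hφmu, hφv, Pi.zero_apply, map_zero] at h
    simp only [hφσ]
    exact h
  · change fockMap φ (f m) = _
    rw [ha, map_sum]
    refine Finset.sum_congr rfl fun k _ => ?_
    rw [map_sum]
    refine Finset.sum_congr rfl fun μ _ => ?_
    rw [fockMap_smul, fockMap_virRep_Lneg, map_one, hφσ]
    simp only [hφmu]

end Universal
end IrrVertex

theorem mainTheorem2 (r : ℕ) (hr : 1 ≤ r) (ρ : ℂ) :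
    ∃ (Pα : MvPolynomial (ParamVar r) ℂ)
      (Pβ : Finset.Icc 1 r → MvPolynomial (ParamVar r) ℂ)
      (PΛ : Finset.Icc r (2 * r) → MvPolynomial (ParamVar r) ℂ)
      (Pc : ℕ → (k : ℕ) → Nat.Partition k → MvPolynomial (ParamVar r) ℂ),
      ∀ (U : TopologicalSpace.Opens (Fin (r + 1) → ℂ)) (hU : ∀ x ∈ U, x (Fin.last r) ≠ 0)
        (Δ : ℂ) (B : Hol U),
        -- an operator with the given `β_r` can only exist if `β_r` is homogeneous
        ((∃ p : Params r (Hol U), p.b r = B ∧ Nonempty (VertexOp (lamHol U) (pdHol U) ρ Δ p)) ↔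
          ∀ q : Finset.Icc 1 r, lamHol U r * pdHol U q B = if (q : ℕ) = r then B else 0) ∧
        -- the parameters are determined, and the operator is unique
        ∀ p : Params r (Hol U), p.b r = B → ∀ V : VertexOp (lamHol U) (pdHol U) ρ Δ p,
          p.α = polyVal U hU Δ B Pα ∧
          (∀ i, p.β i = polyVal U hU Δ B (Pβ i)) ∧
          (∀ n, p.Λ n = polyVal U hU Δ B (PΛ n)) ∧
          (∀ m : ℕ, V.v m = ∑ k ∈ Finset.range (m * (r + 1) + 1), ∑ μ : Nat.Partition k,
            polyVal U hU Δ B (Pc m k μ) •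
              (Lneg (Hol U) (1 - 12 * ρ ^ 2) r μ • irrVec (Hol U) (1 - 12 * ρ ^ 2) r p.l)) ∧
          (∀ V' : VertexOp (lamHol U) (pdHol U) ρ Δ p, V' = V) := by
  obtain ⟨Pγ, Pl, Pc, hP⟩ := exists_universal_solution r hr ρ
  refine ⟨Pγ 0, fun i => MvPolynomial.C (-(1 / ((i : ℕ) : ℂ))) * Pγ i, fun n => Pl n, Pc,
    fun U hU Δ B => ?_⟩
  have hlam := lamHol_mul_coordInv U hU
  have hpd := pdHol_lamHol U
  obtain ⟨hγ, hl, f, hneg, h0, hf, hc⟩ := hP (Hol U) (varVal U hU Δ B) hlam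
  -- the factors `-1/i` come from the normalization `γ_i = -i β_i` of the exponents
  have hβ : ∀ (i : Finset.Icc 1 r) (x y : Hol U), y = polyVal U hU Δ B (Pγ i) →
      (x = polyVal U hU Δ B (MvPolynomial.C (-(1 / ((i : ℕ) : ℂ))) * Pγ i) ↔
        y = -(((i : ℕ) : Hol U) * x)) := by
    rintro i x y rfl
    have hi := (Finset.mem_Icc.1 i.2).1
    refine Iff.trans ?_ (eq_algebraMap_mul_iff (by omega) x _)
    rw [polyVal, map_mul, MvPolynomial.aeval_C, polyVal]
  refine ⟨⟨?_, fun hB => ?_⟩, ?_⟩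
  · rintro ⟨p, rfl, ⟨V⟩⟩
    exact V.lam_mul_pd_b hr hlam
  · let p : Params r (Hol U) :=
      { α := polyVal U hU Δ B (Pγ 0)
        β := fun i => polyVal U hU Δ B (MvPolynomial.C (-(1 / ((i : ℕ) : ℂ))) * Pγ i)
        Λ := fun n => polyVal U hU Δ B (Pl n) }
    have hγs : ∀ s ∈ Finset.Icc 1 r, polyVal U hU Δ B (Pγ s) = -((s : Hol U) * p.b s) := by
      intro s hs
      rw [Params.b, dif_pos hs]
      exact (hβ ⟨s, hs⟩ _ _ rfl).1 rfl
    refine ⟨p, ?_, nonempty_vertexOp (lamHol U) (coordInv U hU) B (pdHol U) ρ Δ p hlam hpd hB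
      (fun q q' a => partialD_comm U _ _ a) hγ hr hneg h0 hf rfl hγs fun n hn => ?_⟩
    · have hr' := Finset.mem_Icc.2 ⟨hr, le_rfl⟩
      rw [Params.b, dif_pos hr']
      symm
      exact (hβ ⟨r, hr'⟩ _ _ rfl).2 hγ
    · rw [Params.l]
      split_ifs with h
      · exact hl n
      · rw [Finset.mem_Icc] at h
        exact ell_eq_zero ρ r _ (by omega)
  · rintro p rfl V
    have hΛ : ∀ n : ℕ, r ≤ n →
        ell ρ r (mom r (lamHol U) (coordInv U hU) (p.b r)) n = p.l n := fun n hn =>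
      V.ell_mom_eq_l hr hlam hn
    have key := fun V : VertexOp (lamHol U) (pdHol U) ρ Δ p =>
      V.exps_eq_and_toFock_w hlam hr hγ hneg h0 hf hΛ
    have hmom : mom r (lamHol U) (coordInv U hU) (p.b r) r * coordInv U hU = 1 := by
      rw [mom_of_pos _ _ _ hr, hlam]
    have hinj := (toFock_bijective ρ r _ hmom hΛ hr).1
    refine ⟨?_, fun i => ?_, fun n => ?_, fun m => ?_, fun V' => ?_⟩
    · rw [← p.exps_zero]
      exact (key V).1 0 (Nat.zero_le r)
    · refine (hβ i _ _ ((key V).1 i (Finset.mem_Icc.1 i.2).2)).2 ?_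
      rw [p.exps_of_mem i.2, Params.b, dif_pos i.2]
    · have h := hΛ n (Finset.mem_Icc.1 n.2).1
      rw [Params.l, dif_pos n.2] at h
      exact h.symm.trans (hl n)
    · refine hinj (((key V).2 m).trans ((hc m).trans ?_))
      rw [map_sum]
      refine Finset.sum_congr rfl fun k _ => ?_
      rw [map_sum]
      refine Finset.sum_congr rfl fun μ _ => ?_
      rw [map_smul, toFock_smul_irrVec]
      rfl
    · refine VertexOp.eq_of_w_eq hlam (funext fun m => hinj ?_)
      rw [(key V').2, (key V).2]
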